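/- **Setting.** Let $N,p\ge 0$ be integers, let $\varrho$ be a representation of $gl(N)$ on a finite-dimensional complex space $V$ with basis labelled by $\alpha$ (with $T^\mu_\nu$ the matrix units, $[T^\mu_\nu,T^\sigma_\tau]=\delta^\sigma_\nu T^\mu_\tau-\delta^\mu_\tau T^\sigma_\nu$), and let $\lambda,w\in\mathbb C$. Upper signs refer to bosons, lower signs to fermions; repeated indices are summed. Let $\xi=\xi^\mu(x)\partial_\mu$ run over vector fields in $N$ variables with polynomial components, and $f=f(t)\,d/dt$ over vector fields on the circle $S^1=\mathbb R/2\pi\mathbb Z$ with trigonometric polynomial coefficient. The algebra $Obs(N)$ is the abelian Lie algebra of local functionals $\int dt\,P(t,q(t),\dot q(t),\dots)$, where $P$ is polynomial in finitely many derivatives of $q^0,\dots,q^{N-1}$ with trigonometric polynomials in $t$ as coefficients, modulo integrals of total time derivatives. $DRO(N)$ is the extension of $diff(N)\oplus diff(1)$ by $Obs(N)$ with brackets $$[\mathcal L_\xi,\mathcal L_\eta]=\mathcal L_{[\xi,\eta]}+\frac1{2\pi i}\int dt\,\dot q^\rho(t)\big(c_1\partial_\rho\partial_\nu\xi^\mu\,\partial_\mu\eta^\nu+c_2\partial_\rho\partial_\mu\xi^\mu\,\partial_\nu\eta^\nu\big)(q(t)),$$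 $$[L_f,\mathcal L_\xi]=\frac1{4\pi i}\int dt\,(c_3\ddot f-ia_3\dot f)\,\partial_\mu\xi^\mu(q(t)),\qquad [L_f,L_g]=L_{[f,g]}+\frac{c_4}{24\pi i}\int dt\,(\ddot f\dot g-\dot f g),$$ $$[\mathcal L_\xi,q^\mu(t)]=\xi^\mu(q(t)),\qquad [L_f,q^\mu(t)]=-f(t)\dot q^\mu(t),\qquad [q^\mu(s),q^\nu(t)]=0,$$ extended to $Obs(N)$ by the Leibniz rule and linearity, where $[f,g]=(f\dot g-g\dot f)d/dt$. **Fock space.** For multi-indices $\mathbf m$ with $|\mathbf m|\le p$, consider fields $F(t)=\sum_{n\in\mathbb Z}\hat F(n)e^{-int}$, $F=q^\mu,p_\mu,\phi_{\alpha,\mathbf m},\pi^{\alpha,\mathbf m}$, whose only non-zero graded commutators are $[p_\mu(s),q^\nu(t)]=\delta^\nu_\mu\delta(s-t)$ and $[\pi^{\alpha,\mathbf m}(s),\phi_{\beta,\mathbf n}(t)]=\mp[\phi_{\beta,\mathbf n}(t),\pi^{\alpha,\mathbf m}(s)]=\delta^{\mathbf m}_{\mathbf n}\delta^\alpha_\beta\delta(s-t)$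 ($q,p$ bosonic; $\phi,\pi$ all bosonic or all fermionic). $J^p\mathcal F$ is the algebra generated by the modes subject to these relations, modulo the left ideal generated by the negative modes of all fields and the zero modes of $p_\mu$ and $\pi^{\alpha,\mathbf m}$. Let $\leq$ and $>$ denote the parts of non-positive and of positive frequency. For a function $h$ of $q(t)$, and with $\phi$ also allowed to be $\dot\phi$, put $:\!hp_\mu\!:\;=hp_\mu^{\le}+p_\mu^{>}h$ (also with $h=\dot q^\mu$) and $:\!\pi h\phi\!:\;=\pi_{>}h\phi\pm h\phi\,\pi_{\le}$. Let $\underline\mu$ be the unit multi-index, and let $$T^{\mathbf m}_{\mathbf n}(\xi)=\sum_{\mu,\nu}\binom{\mathbf n}{\mathbf m}\partial_{\mathbf n-\mathbf m+\underline\nu}\xi^\mu\,\varrho(T^\nu_\mu)+\sum_\mu\binom{\mathbf n}{\mathbf m-\underline\mu}\big(1-\delta^{\mathbf m-\underline\mu}_{\mathbf n}\big)\partial_{\mathbf n-\mathbf m+\underline\mu}\xi^\mu\,\varrho(1),$$ a matrix acting on the suppressed $V$-index of the fields; binomials of multi-indices are products of binomials, zero unless the lower index is between $0$ and the upper one. **Theorem.**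 There are numbers $k_0,k_1,k_2$ with $\operatorname{tr}\varrho(T^\mu_\nu)=k_0\delta^\mu_\nu$ and $\operatorname{tr}\varrho(T^\mu_\nu)\varrho(T^\sigma_\tau)=k_1\delta^\mu_\tau\delta^\sigma_\nu+k_2\delta^\mu_\nu\delta^\sigma_\tau$. For any such numbers, the operators $\mathcal L_\xi$ and $L_f=\int dt\,f(t)L(t)$, where $$\mathcal L_\xi=\int dt\Big(:\!\xi^\mu(q(t))p_\mu(t)\!:\;\mp\sum_{|\mathbf m|\le|\mathbf n|\le p}:\!\pi^{,\mathbf n}(t)\,T^{\mathbf m}_{\mathbf n}(\xi(q(t)))\,\phi_{,\mathbf m}(t)\!:\Big),$$ $$L(t)=-:\!\dot q^\mu(t)p_\mu(t)\!:\;\pm\sum_{|\mathbf m|\le p}\Big\{-:\!\pi^{,\mathbf m}\dot\phi_{,\mathbf m}\!:+\lambda\frac d{dt}:\!\pi^{,\mathbf m}\phi_{,\mathbf m}\!:+iw:\!\pi^{,\mathbf m}\phi_{,\mathbf m}\!:\Big\}(t)\;\pm\binom{N+p}{p}\dim\varrho\,\frac{\lambda-\lambda^2-w+w^2}{4\pi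 i},$$ are well defined on $J^p\mathcal F$ (all infinite sums of products of modes are finite on every vector), as are the operators $\int dt\,P(t,q(t),\dot q(t),\dots)$, and together they give a realization (Lie algebra homomorphism into the linear operators on $J^p\mathcal F$) of $DRO(N)$ with $c_1=1+c_1'$, $c_3=1+c_3'$, $a_3=1+a_3'$, $c_4=2N+c_4'$, where $$c_1'=\pm\Big(\tbinom{N+p}{p}k_1+\tbinom{N+p+1}{p-1}\dim\varrho\Big),\qquad c_2=\pm\Big(\tbinom{N+p}{p}k_2+\tbinom{N+p}{p-2}\dim\varrho+2\tbinom{N+p}{p-1}k_0\Big),$$ $$c_3'=\pm(2\lambda-1)\Big(\tbinom{N+p}{p}k_0+\tbinom{N+p}{p-1}\dim\varrho\Big),\qquad a_3'=\pm(2w-1)\Big(\tbinom{N+p}{p}k_0+\tbinom{N+p}{p-1}\dim\varrho\Big),$$ $$c_4'=\pm2(1-6\lambda+6\lambda^2)\tbinom{N+p}{p}\dim\varrho,$$ and binomials with a negative lower entry are zero. -/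

import Mathlib

open MvPolynomial LaurentPolynomial

attribute [local instance] LieRing.ofAssociativeRing

namespace DRO

noncomputable section

/-! ### Functions and vector fields -/

/-- Trigonometric polynomials on the circle; the variable `T` is the function `e^{it}`. -/
abbrev Trig : Type := LaurentPolynomial ℂ

/-- Polynomial functions on spacetime, with coordinates `x^0, …, x^{N-1}`. -/
abbrev Fun (N : ℕ) : Type := MvPolynomial (Fin N) ℂ

/-- `diff(N)`: vector fields on spacetime with polynomial components, as derivations;
the bracket is the commutator of vector fields. -/
abbrev Diff (N : ℕ) : Type := Derivation ℂ (Fun N) (Fun N)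

/-- `diff(1)`: vector fields `f(t) d/dt` on the circle, as derivations. -/
abbrev Diff1 : Type := Derivation ℂ Trig Trig

/-- The component `ξ^μ` of `ξ = ξ^μ ∂_μ`. -/
def comp {N : ℕ} (ξ : Diff N) (μ : Fin N) : Fun N := ξ (X μ)

/-- The divergence `∂_μ ξ^μ`. -/
def divergence {N : ℕ} (ξ : Diff N) : Fun N := ∑ μ, pderiv μ (comp ξ μ)

/-- The coefficient `f(t)` of the vector field `f(t) d/dt`: since `d e^{it}/dt = i e^{it}`, it is
`-i e^{-it}` times the derivative of `e^{it}` along the field. -/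
def fcoef (f : Diff1) : Trig := LaurentPolynomial.C (-Complex.I) * T (-1) * f (T 1)

/-- `d/dt` on trigonometric polynomials, as a linear map: `e^{imt} ↦ i m e^{imt}`. -/
def dtLin : Trig →ₗ[ℂ] Trig where
  toFun f := f.coeff.sum fun m c => LaurentPolynomial.C (Complex.I * m * c) * T m
  map_add' f g := by
    rw [AddMonoidAlgebra.coeff_add, Finsupp.sum_add_index'] <;> intros <;>
      simp [mul_add, add_mul]
  map_smul' c f := by
    rw [AddMonoidAlgebra.coeff_smul, Finsupp.sum_smul_index']
    · simp only [RingHom.id_apply, Finsupp.smul_sum, smul_eq_mul]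
      refine Finsupp.sum_congr fun m _ => ?_
      rw [LaurentPolynomial.smul_eq_C_mul]
      simp only [map_mul]; ring
    · simp

theorem dtLin_C_mul_T (a : ℂ) (m : ℤ) : dtLin (LaurentPolynomial.C a * T m)
    = LaurentPolynomial.C (Complex.I * m * a) * T m := by
  rw [← LaurentPolynomial.single_eq_C_mul_T]
  simp [dtLin, -LaurentPolynomial.single_eq_C_mul_T]

/-- `d/dt` on trigonometric polynomials. -/
def dt : Derivation ℂ Trig Trig := Derivation.mk' dtLin (by
  intro f g
  induction f using LaurentPolynomial.induction_on' with
  | add p q hp hq => rw [add_mul, map_add, hp, hq, map_add, smul_eq_mul, smul_eq_mul,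
      smul_eq_mul, smul_eq_mul, smul_eq_mul, smul_eq_mul]; ring
  | C_mul_T m a =>
    induction g using LaurentPolynomial.induction_on' with
    | add p q hp hq => rw [mul_add, map_add, hp, hq, map_add, smul_eq_mul, smul_eq_mul,
        smul_eq_mul, smul_eq_mul, smul_eq_mul, smul_eq_mul]; ring
    | C_mul_T n b =>
      have h : (LaurentPolynomial.C a * T m) * (LaurentPolynomial.C b * T n)
          = (LaurentPolynomial.C (a * b) * T (m + n) : Trig) := by
        rw [T_add, map_mul]; ring
      rw [h, dtLin_C_mul_T, dtLin_C_mul_T, dtLin_C_mul_T, T_add]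
      simp only [smul_eq_mul, map_mul, Int.cast_add, map_add]
      ring)

@[simp] theorem dt_T (m : ℤ) : dt (T m) = LaurentPolynomial.C (Complex.I * m) * T m := by
  have h := dtLin_C_mul_T 1 m
  rw [map_one, one_mul, mul_one] at h
  exact h

theorem diff1_apply (f : Diff1) (g : Trig) : f g = fcoef f * dt g := by
  have hI : (LaurentPolynomial.C Complex.I * LaurentPolynomial.C Complex.I : Trig) = -1 := by
    rw [← map_mul, Complex.I_mul_I, map_neg, map_one]
  have key : ∀ m : ℤ, f (T m) = (LaurentPolynomial.C (m : ℂ)) * T (m - 1) * f (T 1) := by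
    have step : ∀ m : ℤ, f (T (m + 1)) = T m * f (T 1) + T 1 * f (T m) := by
      intro m; rw [T_add, Derivation.leibniz, smul_eq_mul, smul_eq_mul]
    intro m
    induction m using Int.induction_on with
    | zero => simp
    | succ n ih =>
      rw [step, ih, show (T (n : ℤ) : Trig) = T 1 * T (n - 1) by rw [← T_add]; congr 1; ring]
      rw [show ((n : ℤ) + 1 - 1) = 1 + (n - 1) by ring, T_add]
      push_cast; rw [map_add, map_one]; ring
    | pred n ih =>
      have h := step (-(n : ℤ) - 1)
      rw [show (-(n : ℤ) - 1 + 1) = -n by ring, ih] at h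
      have h2 : T (-1) * (T 1 * f (T (-(n : ℤ) - 1))) = f (T (-(n : ℤ) - 1)) := by
        rw [← mul_assoc, ← T_add]; simp
      rw [← h2, ← sub_eq_iff_eq_add'.mpr h,
        show (-(n : ℤ) - 1 - 1) = -1 + (-n - 1) by ring, T_add]
      push_cast; rw [map_sub, map_one]; ring
  induction g using LaurentPolynomial.induction_on' with
  | add p q hp hq => rw [map_add, map_add, hp, hq, mul_add]
  | C_mul_T m a =>
    rw [← LaurentPolynomial.smul_eq_C_mul, Derivation.map_smul, Derivation.map_smul, dt_T, key, fcoef,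
      show (m - 1) = -1 + m by ring, T_add, LaurentPolynomial.smul_eq_C_mul,
      LaurentPolynomial.smul_eq_C_mul, map_mul, map_neg]
    linear_combination ((LaurentPolynomial.C a * LaurentPolynomial.C (m : ℂ) * T (-1) * T m * f (T 1))) * hI

theorem apply_T_one (f : Diff1) : f (T 1) = LaurentPolynomial.C Complex.I * T 1 * fcoef f := by
  rw [diff1_apply, dt_T]; push_cast; rw [mul_one]; ring

theorem fcoef_lie (f g : Diff1) : fcoef ⁅f, g⁆ = fcoef f * dt (fcoef g) - fcoef g * dt (fcoef f) := by
  have hI : (LaurentPolynomial.C Complex.I * LaurentPolynomial.C Complex.I : Trig) = -1 := by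
    rw [← map_mul, Complex.I_mul_I, map_neg, map_one]
  have hT : (T (-1) * T 1 : Trig) = 1 := by rw [← T_add]; simp
  have hC : dt (LaurentPolynomial.C Complex.I) = 0 := dt.map_algebraMap Complex.I
  have e : (⁅f, g⁆ : Diff1) (T 1) = LaurentPolynomial.C Complex.I * T 1 *
      (fcoef f * dt (fcoef g) - fcoef g * dt (fcoef f)) := by
    rw [Derivation.commutator_apply, diff1_apply f, diff1_apply g (f _), apply_T_one f,
      apply_T_one g]
    simp only [Derivation.leibniz, smul_eq_mul, hC, dt_T]
    push_cast; ring
  rw [fcoef, e, map_neg]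
  linear_combination (-(T (-1) * T 1) * (fcoef f * dt (fcoef g) - fcoef g * dt (fcoef f))) * hI
    + (fcoef f * dt (fcoef g) - fcoef g * dt (fcoef f)) * hT

theorem fcoef_add (f g : Diff1) : fcoef (f + g) = fcoef f + fcoef g := by
  simp [fcoef, mul_add]

theorem fcoef_smul (c : ℂ) (f : Diff1) : fcoef (c • f) = c • fcoef f := by
  simp [fcoef]

/-! ### The observer algebra -/

/-- Local densities `P(t, q(t), q'(t), …)`: polynomials in the variables `X (μ, k)`, standing for
`d^k q^μ(t)/dt^k`, with coefficients that are trigonometric polynomials in `t`. -/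
abbrev Loc (N : ℕ) : Type := MvPolynomial (Fin N × ℕ) Trig

/-- `∂/∂t` acting on the explicit time dependence only. -/
def dtExplicitLin (N : ℕ) : Loc N →ₗ[ℂ] Loc N where
  toFun P := AddMonoidAlgebra.map (dt : Trig →+ Trig) P
  map_add' P Q := AddMonoidAlgebra.map_add _ P Q
  map_smul' c P := by
    ext m : 2
    simp [Derivation.map_smul]

theorem coeff_dtExplicitLin {N : ℕ} (P : Loc N) (s : Fin N × ℕ →₀ ℕ) :
    MvPolynomial.coeff s (dtExplicitLin N P) = dt (MvPolynomial.coeff s P) := rfl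

/-- `∂/∂t` acting on the explicit time dependence only, as a derivation. -/
def dtExplicit (N : ℕ) : Derivation ℂ (Loc N) (Loc N) := Derivation.mk' (dtExplicitLin N) (by
  intro P Q
  refine MvPolynomial.ext _ _ fun s => ?_
  rw [coeff_dtExplicitLin, smul_eq_mul, smul_eq_mul, MvPolynomial.coeff_add, mul_comm Q,
    MvPolynomial.coeff_mul, MvPolynomial.coeff_mul, MvPolynomial.coeff_mul, map_sum,
    ← Finset.sum_add_distrib]
  refine Finset.sum_congr rfl fun x _ => ?_
  rw [Derivation.leibniz, coeff_dtExplicitLin, coeff_dtExplicitLin, smul_eq_mul, smul_eq_mul]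
  ring)

theorem dtExplicit_C {N : ℕ} (f : Trig) : dtExplicit N (MvPolynomial.C f) = MvPolynomial.C (dt f) :=
  AddMonoidAlgebra.map_single _ _ _

theorem dtExplicit_X {N : ℕ} (i : Fin N × ℕ) : dtExplicit N (X i) = 0 := by
  have h : dtExplicit N (X i) = MvPolynomial.monomial (Finsupp.single i 1) (dt 1) :=
    AddMonoidAlgebra.map_single _ _ _
  rw [h, Derivation.map_one_eq_zero, map_zero]

/-- The total time derivative `d/dt` of local densities. -/
def totalD (N : ℕ) : Derivation ℂ (Loc N) (Loc N) :=
  dtExplicit N + (mkDerivation Trig fun i : Fin N × ℕ =>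
    (X (i.1, i.2 + 1) : Loc N)).restrictScalars ℂ

@[simp] theorem totalD_C {N : ℕ} (f : Trig) : totalD N (MvPolynomial.C f) = MvPolynomial.C (dt f) := by
  simp [totalD, dtExplicit_C]

@[simp] theorem totalD_X {N : ℕ} (i : Fin N × ℕ) : totalD N (X i) = X (i.1, i.2 + 1) := by
  simp [totalD, dtExplicit_X]

/-- `Obs(N)`: the space of local functionals `∫ dt P(t, q(t), q'(t), …)`, i.e. local densities
modulo total time derivatives. -/
abbrev Obs (N : ℕ) : Type := Loc N ⧸ LinearMap.range (totalD N).toLinearMap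

/-- The local functional `∫ dt P`. -/
def integral {N : ℕ} : Loc N →ₗ[ℂ] Obs N := Submodule.mkQ _

theorem integral_eq_zero {N : ℕ} {P Q : Loc N} (h : P = totalD N Q) : integral P = 0 := by
  rw [integral, Submodule.mkQ_apply, Submodule.Quotient.mk_eq_zero, h]
  exact ⟨Q, rfl⟩

/-- The density `h(q(t))` for a function `h` on spacetime. -/
def atQ {N : ℕ} : Fun N →ₐ[ℂ] Loc N := MvPolynomial.aeval fun μ => X (μ, 0)

/-! ### The action of `diff(N) ⊕ diff(1)` on the observer algebra -/

/-- The variation of `q^μ(t)` under `(ξ, f)`: it is `ξ^μ(q(t)) - f(t) dq^μ(t)/dt`. -/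
def deltaQ {N : ℕ} (x : Diff N × Diff1) (μ : Fin N) : Loc N :=
  atQ (comp x.1 μ) - MvPolynomial.C (fcoef x.2) * X (μ, 1)

/-- The action of `(ξ, f)` on local densities: the derivation that extends `deltaQ` and commutes
with `d/dt`, at fixed `t`. -/
def act {N : ℕ} (x : Diff N × Diff1) : Derivation Trig (Loc N) (Loc N) :=
  mkDerivation Trig fun i => (totalD N)^[i.2] (deltaQ x i.1)

theorem act_X {N : ℕ} (x : Diff N × Diff1) (i : Fin N × ℕ) :
    act x (X i) = (totalD N)^[i.2] (deltaQ x i.1) := by simp [act]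

theorem act_X_zero {N : ℕ} (x : Diff N × Diff1) (μ : Fin N) :
    act x (X (μ, 0)) = deltaQ x μ := by simp [act]

@[simp] theorem act_C {N : ℕ} (x : Diff N × Diff1) (f : Trig) :
    act x (MvPolynomial.C f) = 0 := by simp [act]

theorem act_totalD {N : ℕ} (x : Diff N × Diff1) (P : Loc N) :
    act x (totalD N P) = totalD N (act x P) := by
  induction P using MvPolynomial.induction_on with
  | C a => simp
  | add p q hp hq => simp only [map_add, hp, hq]
  | mul_X p i hp =>
    have hX : act x (totalD N (X i)) = totalD N (act x (X i)) := by
      rw [totalD_X, act_X, act_X, ← Function.iterate_succ_apply' (totalD N)]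
    simp only [Derivation.leibniz, map_add, smul_eq_mul, hp, hX]
    ring

theorem act_iterate {N : ℕ} (x : Diff N × Diff1) (k : ℕ) (P : Loc N) :
    act x ((totalD N)^[k] P) = (totalD N)^[k] (act x P) := by
  induction k with
  | zero => rfl
  | succ k ih => rw [Function.iterate_succ_apply', act_totalD, ih, Function.iterate_succ_apply']

theorem totalD_atQ {N : ℕ} (h : Fun N) :
    totalD N (atQ h) = ∑ ρ, X (ρ, 1) * atQ (pderiv ρ h) := by
  induction h using MvPolynomial.induction_on with
  | C a =>
    have : (atQ (MvPolynomial.C a) : Loc N) = algebraMap ℂ _ a := by simp [atQ]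
    rw [this, Derivation.map_algebraMap]; simp
  | add p q hp hq => simp only [map_add, hp, hq, mul_add, Finset.sum_add_distrib]
  | mul_X p i hp =>
    have hX : (atQ (X i) : Loc N) = X (i, 0) := by simp [atQ]
    have h1 (ρ : Fin N) : (X (ρ, 1) : Loc N) * atQ (pderiv ρ (p * X i)) =
        (if ρ = i then atQ p * X (ρ, 1) else 0) + X (i, 0) * (X (ρ, 1) * atQ (pderiv ρ p)) := by
      rw [Derivation.leibniz, map_add, smul_eq_mul, smul_eq_mul, map_mul, map_mul, hX, pderiv_X]
      by_cases h : ρ = i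
      · subst h; simp; ring
      · simp [h]; ring
    rw [Finset.sum_congr rfl fun ρ _ => h1 ρ, Finset.sum_add_distrib, ← Finset.mul_sum, ← hp,
      Finset.sum_ite_eq' Finset.univ i, if_pos (Finset.mem_univ i), map_mul, Derivation.leibniz, hX,
      totalD_X]
    simp only [smul_eq_mul]

theorem act_atQ {N : ℕ} (x : Diff N × Diff1) (h : Fun N) :
    act x (atQ h) = atQ (x.1 h) - MvPolynomial.C (fcoef x.2) * totalD N (atQ h) := by
  have hX (i : Fin N) : (atQ (X i) : Loc N) = X (i, 0) := by simp [atQ]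
  induction h using MvPolynomial.induction_on with
  | C a =>
    have : (atQ (MvPolynomial.C a) : Loc N) = algebraMap ℂ _ a := by simp [atQ]
    have h2 : (algebraMap ℂ (Loc N) a) = MvPolynomial.C (algebraMap ℂ Trig a) := rfl
    have h3 : x.1 (MvPolynomial.C a) = 0 := x.1.map_algebraMap a
    rw [this, Derivation.map_algebraMap, h2, act_C, h3]; simp
  | add p q hp hq => simp only [map_add, hp, hq]; ring
  | mul_X p i hp =>
    simp only [map_mul, Derivation.leibniz, hp, map_add, smul_eq_mul, hX, totalD_X, act_X_zero,
      deltaQ, comp]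
    ring

theorem act_add {N : ℕ} (x y : Diff N × Diff1) : act (x + y) = act x + act y := by
  refine MvPolynomial.derivation_ext fun i => ?_
  have h : deltaQ (x + y) i.1 = deltaQ x i.1 + deltaQ y i.1 := by
    simp [deltaQ, comp, fcoef_add]; ring
  rw [Derivation.add_apply, act_X, act_X, act_X, h, iterate_map_add]

theorem act_smul {N : ℕ} (c : ℂ) (x : Diff N × Diff1) (P : Loc N) :
    act (c • x) P = c • act x P := by
  have h (μ : Fin N) : deltaQ (c • x) μ = c • deltaQ x μ := by
    simp only [deltaQ, comp, Prod.smul_fst, Prod.smul_snd, Derivation.smul_apply, map_smul,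
      fcoef_smul, smul_sub]
    congr 1
    rw [Algebra.smul_def, Algebra.smul_def, map_mul, mul_assoc]
    rfl
  induction P using MvPolynomial.induction_on with
  | C a => simp
  | add p q hp hq => simp only [map_add, hp, hq, smul_add]
  | mul_X p i hp =>
    simp only [Derivation.leibniz, hp, smul_eq_mul, act_X, h, smul_add, mul_smul_comm]
    congr 2
    have : ∀ (k : ℕ) (Q : Loc N), (totalD N)^[k] (c • Q) = c • (totalD N)^[k] Q := by
      intro k Q
      induction k with
      | zero => rfl
      | succ k ih => rw [Function.iterate_succ_apply', ih, Derivation.map_smul,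
          Function.iterate_succ_apply']
    rw [this, mul_smul_comm]

theorem act_lie {N : ℕ} (x y : Diff N × Diff1) (P : Loc N) :
    act ⁅x, y⁆ P = act x (act y P) - act y (act x P) := by
  have h (μ : Fin N) : deltaQ ⁅x, y⁆ μ = act x (deltaQ y μ) - act y (deltaQ x μ) := by
    have e1 : (⁅x, y⁆ : Diff N × Diff1).1 = ⁅x.1, y.1⁆ := rfl
    have e2 : (⁅x, y⁆ : Diff N × Diff1).2 = ⁅x.2, y.2⁆ := rfl
    have h1 (z : Diff N × Diff1) : act z (X (μ, 1)) = totalD N (deltaQ z μ) := by simp [act_X]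
    simp only [deltaQ, comp, e1, e2, Derivation.commutator_apply, fcoef_lie, map_sub, map_mul,
      Derivation.leibniz, act_atQ, act_C, h1, smul_eq_mul, totalD_C, totalD_X]
    ring
  induction P using MvPolynomial.induction_on with
  | C a => simp
  | add p q hp hq => simp only [map_add, hp, hq]; ring
  | mul_X p i hp =>
    have hX : act ⁅x, y⁆ (X i) = act x (act y (X i)) - act y (act x (X i)) := by
      rw [act_X, act_X, act_X, act_iterate, act_iterate, h, iterate_map_sub]
    simp only [Derivation.leibniz, map_add, smul_eq_mul, hp, hX]
    ring

/-- The action of `(ξ, f)` on local functionals. -/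
def actObs {N : ℕ} (x : Diff N × Diff1) : Obs N →ₗ[ℂ] Obs N :=
  Submodule.mapQ _ _ ((act x).restrictScalars ℂ).toLinearMap (by
    rintro _ ⟨P, rfl⟩
    exact ⟨act x P, (act_totalD x P).symm⟩)

theorem actObs_integral {N : ℕ} (x : Diff N × Diff1) (P : Loc N) :
    actObs x (integral P) = integral (act x P) := rfl

theorem integral_surjective {N : ℕ} : Function.Surjective (integral (N := N)) :=
  Submodule.mkQ_surjective _

instance instLieRingModuleObs (N : ℕ) : LieRingModule (Diff N × Diff1) (Obs N) where
  bracket x m := actObs x m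
  add_lie x y m := by
    obtain ⟨P, rfl⟩ := integral_surjective m
    simp only [actObs_integral, act_add, Derivation.add_apply, map_add]
  lie_add x m m' := map_add _ _ _
  leibniz_lie x y m := by
    obtain ⟨P, rfl⟩ := integral_surjective m
    simp only [actObs_integral, act_lie, map_sub]; abel

theorem lie_integral {N : ℕ} (x : Diff N × Diff1) (P : Loc N) :
    ⁅x, integral P⁆ = integral (act x P) := rfl

instance instLieModuleObs (N : ℕ) : LieModule ℂ (Diff N × Diff1) (Obs N) where
  smul_lie c x m := by
    obtain ⟨P, rfl⟩ := integral_surjective m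
    rw [lie_integral, lie_integral, act_smul, map_smul]
  lie_smul c x m := by
    obtain ⟨P, rfl⟩ := integral_surjective m
    rw [← map_smul, lie_integral, lie_integral, ← map_smul]
    congr 1
    exact ((act x).restrictScalars ℂ).map_smul c P

/-! ### The cocycles and the algebra `DRO(N)` -/

/-- The density `q'^ρ ∂_ρ∂_ν ξ^μ(q) ∂_μ η^ν(q)`. -/
def dens1 {N : ℕ} (x y : Diff N × Diff1) : Loc N :=
  ∑ ρ, ∑ μ, ∑ ν, X (ρ, 1) * atQ (pderiv ρ (pderiv ν (comp x.1 μ))) * atQ (pderiv μ (comp y.1 ν))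

/-- The density `q'^ρ ∂_ρ∂_μ ξ^μ(q) ∂_ν η^ν(q)`. -/
def dens2 {N : ℕ} (x y : Diff N × Diff1) : Loc N :=
  ∑ ρ, X (ρ, 1) * atQ (pderiv ρ (divergence x.1)) * atQ (divergence y.1)

/-- The density `f''(t) ∂_μ η^μ(q) - g''(t) ∂_μ ξ^μ(q)`. -/
def dens3 {N : ℕ} (x y : Diff N × Diff1) : Loc N :=
  MvPolynomial.C (dt (dt (fcoef x.2))) * atQ (divergence y.1)
    - MvPolynomial.C (dt (dt (fcoef y.2))) * atQ (divergence x.1)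

/-- The density `f'(t) ∂_μ η^μ(q) - g'(t) ∂_μ ξ^μ(q)`. -/
def densA {N : ℕ} (x y : Diff N × Diff1) : Loc N :=
  MvPolynomial.C (dt (fcoef x.2)) * atQ (divergence y.1)
    - MvPolynomial.C (dt (fcoef y.2)) * atQ (divergence x.1)

/-- The density `f''(t) g'(t) - f'(t) g(t)`. -/
def dens4 {N : ℕ} (x y : Diff N × Diff1) : Loc N :=
  MvPolynomial.C (dt (dt (fcoef x.2)) * dt (fcoef y.2) - dt (fcoef x.2) * fcoef y.2)

/-- `∂_ν ξ^μ(q)`, as a matrix of densities. -/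
def jacQ {N : ℕ} (x : Diff N × Diff1) : Matrix (Fin N) (Fin N) (Loc N) :=
  Matrix.of fun μ ν => atQ (pderiv ν (comp x.1 μ))

/-- `∂_μ ξ^μ(q)`. -/
def divQ {N : ℕ} (x : Diff N × Diff1) : Loc N := atQ (divergence x.1)

/-- Entrywise time derivative. -/
def matD {N : ℕ} (M : Matrix (Fin N) (Fin N) (Loc N)) : Matrix (Fin N) (Fin N) (Loc N) :=
  M.map (totalD N)

/-- Entrywise action. -/
def matAct {N : ℕ} (x : Diff N × Diff1) (M : Matrix (Fin N) (Fin N) (Loc N)) :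
    Matrix (Fin N) (Fin N) (Loc N) := M.map (act x)

section
variable {N : ℕ}

theorem matD_mul (A B : Matrix (Fin N) (Fin N) (Loc N)) :
    matD (A * B) = matD A * B + A * matD B := by
  refine Matrix.ext fun i j => ?_
  simp only [matD, Matrix.map_apply, Matrix.mul_apply, Matrix.add_apply, map_sum,
    Derivation.leibniz, smul_eq_mul, ← Finset.sum_add_distrib]
  exact Finset.sum_congr rfl fun _ _ => by ring

theorem matD_add (A B : Matrix (Fin N) (Fin N) (Loc N)) : matD (A + B) = matD A + matD B := by
  refine Matrix.ext fun i j => ?_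
  simp [matD]

theorem matD_sub (A B : Matrix (Fin N) (Fin N) (Loc N)) : matD (A - B) = matD A - matD B := by
  refine Matrix.ext fun i j => ?_
  simp [matD]

theorem matD_smul (f : Loc N) (A : Matrix (Fin N) (Fin N) (Loc N)) :
    matD (f • A) = totalD N f • A + f • matD A := by
  refine Matrix.ext fun i j => ?_
  simp [matD]; ring

theorem trace_matD (A : Matrix (Fin N) (Fin N) (Loc N)) :
    (matD A).trace = totalD N A.trace := by simp [matD, Matrix.trace]

theorem matAct_matD (x : Diff N × Diff1) (A : Matrix (Fin N) (Fin N) (Loc N)) :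
    matAct x (matD A) = matD (matAct x A) := by
  refine Matrix.ext fun i j => ?_
  simp [matD, matAct, act_totalD]

theorem act_trace_mul (x : Diff N × Diff1) (A B : Matrix (Fin N) (Fin N) (Loc N)) :
    act x (A * B).trace = (matAct x A * B).trace + (A * matAct x B).trace := by
  simp only [matAct, Matrix.trace, Matrix.diag, Matrix.mul_apply, map_sum, Derivation.leibniz,
    smul_eq_mul, Matrix.map_apply, ← Finset.sum_add_distrib]
  exact Finset.sum_congr rfl fun _ _ => Finset.sum_congr rfl fun _ _ => by ring

theorem dens1_eq (x y : Diff N × Diff1) : dens1 x y = (matD (jacQ x) * jacQ y).trace := by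
  simp only [dens1, Matrix.trace, Matrix.diag, Matrix.mul_apply, matD, Matrix.map_apply, jacQ,
    Matrix.of_apply, totalD_atQ, Finset.sum_mul]
  rw [Finset.sum_comm]
  exact Finset.sum_congr rfl fun _ _ => Finset.sum_comm

theorem dens2_eq (x y : Diff N × Diff1) : dens2 x y = totalD N (divQ x) * divQ y := by
  simp only [dens2, divQ, totalD_atQ, Finset.sum_mul]

theorem pderiv_diff (ξ : Diff N) (ν : Fin N) (h : Fun N) :
    pderiv ν (ξ h) = ξ (pderiv ν h) + ∑ σ, pderiv ν (comp ξ σ) * pderiv σ h := by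
  have key : ⁅(pderiv ν : Diff N), ξ⁆ = ∑ σ, pderiv ν (comp ξ σ) • (pderiv σ : Diff N) := by
    refine MvPolynomial.derivation_ext fun i => ?_
    have h0 : (∑ σ, pderiv ν (comp ξ σ) • (pderiv σ : Diff N)) (X i)
        = ∑ σ, pderiv ν (comp ξ σ) * pderiv σ (X i) := by
      rw [← Derivation.coeFnAddMonoidHom_apply, map_sum, Finset.sum_apply]
      rfl
    have h1 : ξ (pderiv ν (X i : Fun N)) = 0 := by
      rw [pderiv_X]
      by_cases hh : i = ν
      · subst hh; simp
      · simp [hh]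
    rw [h0, Derivation.commutator_apply, h1, sub_zero, Finset.sum_eq_single i]
    · simp [comp]
    · intro b _ hb; simp [pderiv_X, Pi.single_eq_of_ne' hb]
    · simp
  have h2 := congrArg (fun d : Diff N => d h) key
  have h0 : (∑ σ, pderiv ν (comp ξ σ) • (pderiv σ : Diff N)) h
        = ∑ σ, pderiv ν (comp ξ σ) * pderiv σ h := by
      rw [← Derivation.coeFnAddMonoidHom_apply, map_sum, Finset.sum_apply]
      rfl
  simp only [Derivation.commutator_apply, h0] at h2
  rw [← h2]; ring

theorem divergence_lie (ξ η : Diff N) :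
    divergence ⁅ξ, η⁆ = ξ (divergence η) - η (divergence ξ) := by
  have hc (μ : Fin N) : comp ⁅ξ, η⁆ μ = ξ (comp η μ) - η (comp ξ μ) :=
    Derivation.commutator_apply ..
  simp only [divergence, hc, map_sub, pderiv_diff, map_sum, Finset.sum_sub_distrib,
    Finset.sum_add_distrib]
  rw [Finset.sum_comm (f := fun μ σ => pderiv μ (comp η σ) * pderiv σ (comp ξ μ))]
  simp only [mul_comm (pderiv _ (comp ξ _))]
  ring

theorem divQ_lie (x y : Diff N × Diff1) : divQ ⁅x, y⁆ = act x (divQ y) - act y (divQ x)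
    + MvPolynomial.C (fcoef x.2) * totalD N (divQ y)
    - MvPolynomial.C (fcoef y.2) * totalD N (divQ x) := by
  have e1 : (⁅x, y⁆ : Diff N × Diff1).1 = ⁅x.1, y.1⁆ := rfl
  rw [divQ, e1, divergence_lie, divQ, divQ, act_atQ, act_atQ, map_sub]; ring

theorem jacQ_lie (x y : Diff N × Diff1) : jacQ ⁅x, y⁆ = matAct x (jacQ y) - matAct y (jacQ x)
    + (MvPolynomial.C (fcoef x.2) : Loc N) • matD (jacQ y)
    - (MvPolynomial.C (fcoef y.2) : Loc N) • matD (jacQ x)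
    + jacQ y * jacQ x - jacQ x * jacQ y := by
  refine Matrix.ext fun μ ν => ?_
  have hc : comp (⁅x, y⁆ : Diff N × Diff1).1 μ = x.1 (comp y.1 μ) - y.1 (comp x.1 μ) :=
    Derivation.commutator_apply ..
  simp only [jacQ, matAct, matD, Matrix.add_apply, Matrix.sub_apply, Matrix.smul_apply,
    Matrix.map_apply, Matrix.of_apply, Matrix.mul_apply, hc, act_atQ, pderiv_diff, map_sub, map_add,
    map_sum, map_mul, smul_eq_mul, mul_comm (atQ (pderiv ν (comp x.1 _))),
    mul_comm (atQ (pderiv ν (comp y.1 _)))]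
  ring

theorem fcoefQ_lie (x y : Diff N × Diff1) : fcoef (⁅x, y⁆ : Diff N × Diff1).2
    = fcoef x.2 * dt (fcoef y.2) - fcoef y.2 * dt (fcoef x.2) := fcoef_lie _ _

theorem comp_add (ξ η : Diff N) (μ : Fin N) : comp (ξ + η) μ = comp ξ μ + comp η μ := rfl

theorem comp_smul (c : ℂ) (ξ : Diff N) (μ : Fin N) : comp (c • ξ) μ = c • comp ξ μ := rfl

theorem divergence_add (ξ η : Diff N) : divergence (ξ + η) = divergence ξ + divergence η := by
  simp [divergence, comp_add, Finset.sum_add_distrib]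

theorem divergence_smul (c : ℂ) (ξ : Diff N) : divergence (c • ξ) = c • divergence ξ := by
  simp [divergence, comp_smul, Finset.smul_sum]

theorem C_smul_trig (c : ℂ) (f : Trig) : (MvPolynomial.C (c • f) : Loc N) = c • MvPolynomial.C f := by
  rw [Algebra.smul_def, Algebra.smul_def, map_mul]; rfl

theorem trace_cyc (A B C : Matrix (Fin N) (Fin N) (Loc N)) :
    (A * (B * C)).trace = (B * (C * A)).trace := by
  rw [Matrix.trace_mul_comm, Matrix.mul_assoc]

/-- The 2-cochain `(x, y) ↦ ∫ dt w(x, y)` defined by a bilinear density `w`. -/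
def cochain (w : Diff N × Diff1 → Diff N × Diff1 → Loc N)
    (h₁ : ∀ x x' y, w (x + x') y = w x y + w x' y) (h₂ : ∀ (c : ℂ) x y, w (c • x) y = c • w x y)
    (h₃ : ∀ x y y', w x (y + y') = w x y + w x y') (h₄ : ∀ (c : ℂ) x y, w x (c • y) = c • w x y)
    (h : ∀ x, integral (w x x) = 0) :
    LieModule.Cohomology.twoCochain ℂ (Diff N × Diff1) (Obs N) :=
  ⟨(LinearMap.mk₂ ℂ w h₁ h₂ h₃ h₄).compr₂ integral, h⟩

/-- A density whose coboundary is a total derivative defines a 2-cocycle. -/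
def cocycleOf (w : Diff N × Diff1 → Diff N × Diff1 → Loc N)
    (h₁ : ∀ x x' y, w (x + x') y = w x y + w x' y) (h₂ : ∀ (c : ℂ) x y, w (c • x) y = c • w x y)
    (h₃ : ∀ x y y', w x (y + y') = w x y + w x y') (h₄ : ∀ (c : ℂ) x y, w x (c • y) = c • w x y)
    (h : ∀ x, ∃ Q, w x x = totalD N Q)
    (hd : ∀ x y z, ∃ Q, act x (w y z) - act y (w x z) + act z (w x y) - w ⁅x, y⁆ z
      + w ⁅x, z⁆ y - w ⁅y, z⁆ x = totalD N Q) :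
    LieModule.Cohomology.twoCocycle ℂ (Diff N × Diff1) (Obs N) :=
  ⟨cochain w h₁ h₂ h₃ h₄ fun x => by
    obtain ⟨Q, hQ⟩ := h x
    exact integral_eq_zero hQ, by
    rw [LieModule.Cohomology.mem_twoCocycle_iff]
    refine LinearMap.ext fun x => LinearMap.ext fun y => LinearMap.ext fun z => ?_
    rw [LieModule.Cohomology.d₂₃_apply]
    obtain ⟨Q, hQ⟩ := hd x y z
    have := integral_eq_zero hQ
    simp only [map_sub, map_add] at this
    exact this⟩

/-- The cocycle `∫ dt q'^ρ ∂_ρ∂_ν ξ^μ(q) ∂_μ η^ν(q)`. -/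
def cocycle1 (N : ℕ) : LieModule.Cohomology.twoCocycle ℂ (Diff N × Diff1) (Obs N) :=
  cocycleOf dens1
    (fun x x' y => by
      simp only [dens1, Prod.fst_add, comp_add, map_add, mul_add, add_mul, Finset.sum_add_distrib])
    (fun c x y => by
      simp only [dens1, Prod.smul_fst, comp_smul, Derivation.map_smul, map_smul, Finset.smul_sum,
        mul_smul_comm, smul_mul_assoc])
    (fun x x' y => by
      simp only [dens1, Prod.fst_add, comp_add, map_add, mul_add, Finset.sum_add_distrib])
    (fun c x y => by
      simp only [dens1, Prod.smul_fst, comp_smul, Derivation.map_smul, map_smul, Finset.smul_sum,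
        mul_smul_comm])
    (fun x => ⟨(2⁻¹ : ℂ) • (jacQ x * jacQ x).trace, by
      rw [Derivation.map_smul, ← trace_matD, matD_mul, Matrix.trace_add,
        Matrix.trace_mul_comm (jacQ x), ← two_smul ℂ, smul_smul, dens1_eq]
      norm_num⟩)
    (fun x y z => ⟨(jacQ y * matAct x (jacQ z)).trace - (jacQ x * matAct y (jacQ z)).trace
        + (jacQ x * matAct z (jacQ y)).trace
        - MvPolynomial.C (fcoef x.2) * (matD (jacQ y) * jacQ z).trace
        + MvPolynomial.C (fcoef x.2) * (matD (jacQ z) * jacQ y).trace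
        + MvPolynomial.C (fcoef y.2) * (matD (jacQ x) * jacQ z).trace
        - MvPolynomial.C (fcoef y.2) * (matD (jacQ z) * jacQ x).trace
        + MvPolynomial.C (fcoef z.2) * (matD (jacQ y) * jacQ x).trace
        - MvPolynomial.C (fcoef z.2) * (matD (jacQ x) * jacQ y).trace
        + 2 * (jacQ x * (jacQ y * jacQ z)).trace - 2 * (jacQ x * (jacQ z * jacQ y)).trace, by
      have two : totalD N 2 = 0 := by
        have h := (totalD N).map_algebraMap (2 : ℂ)
        rwa [map_ofNat] at h
      simp only [dens1_eq, jacQ_lie, act_trace_mul, matAct_matD, map_add, map_sub,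
        Derivation.leibniz, smul_eq_mul, totalD_C, ← trace_matD, two, mul_zero, add_zero,
        matD_add, matD_sub, matD_mul, matD_smul, add_mul, sub_mul, mul_add,
        Matrix.trace_add, Matrix.trace_sub, smul_mul_assoc, Matrix.trace_smul, Matrix.mul_assoc]
      generalize jacQ x = A
      generalize jacQ y = B
      generalize jacQ z = C
      rw [Matrix.trace_mul_comm B (matD (matAct x C)), Matrix.trace_mul_comm A (matD (matAct y C)),
        Matrix.trace_mul_comm A (matD (matAct z B)), Matrix.trace_mul_comm (matD C) (matD B),
        Matrix.trace_mul_comm (matD C) (matD A), Matrix.trace_mul_comm (matD B) (matD A),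
        trace_cyc B (matD A) C, trace_cyc A (matD B) C, trace_cyc C (matD A) B,
        trace_cyc A (matD C) B, trace_cyc C (matD B) A, trace_cyc B (matD C) A,
        trace_cyc A B (matD C), trace_cyc B (matD C) A, trace_cyc A C (matD B),
        trace_cyc C (matD B) A]
      ring⟩)

/-- The cocycle `∫ dt q'^ρ ∂_ρ∂_μ ξ^μ(q) ∂_ν η^ν(q)`. -/
def cocycle2 (N : ℕ) : LieModule.Cohomology.twoCocycle ℂ (Diff N × Diff1) (Obs N) :=
  cocycleOf dens2
    (fun x x' y => by
      simp only [dens2, Prod.fst_add, divergence_add, map_add, mul_add, add_mul,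
        Finset.sum_add_distrib])
    (fun c x y => by
      simp only [dens2, Prod.smul_fst, divergence_smul, Derivation.map_smul, map_smul,
        Finset.smul_sum, mul_smul_comm, smul_mul_assoc])
    (fun x x' y => by
      simp only [dens2, Prod.fst_add, divergence_add, map_add, mul_add, Finset.sum_add_distrib])
    (fun c x y => by
      simp only [dens2, Prod.smul_fst, divergence_smul, map_smul, Finset.smul_sum, mul_smul_comm])
    (fun x => ⟨(2⁻¹ : ℂ) • (divQ x * divQ x), by
      rw [Derivation.map_smul, Derivation.leibniz, ← two_smul ℂ, smul_smul, dens2_eq, smul_eq_mul]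
      norm_num [mul_comm]⟩)
    (fun x y z => ⟨divQ y * act x (divQ z) - divQ x * act y (divQ z) + divQ x * act z (divQ y)
        - MvPolynomial.C (fcoef x.2) * totalD N (divQ y) * divQ z
        + MvPolynomial.C (fcoef x.2) * totalD N (divQ z) * divQ y
        + MvPolynomial.C (fcoef y.2) * totalD N (divQ x) * divQ z
        - MvPolynomial.C (fcoef y.2) * totalD N (divQ z) * divQ x
        + MvPolynomial.C (fcoef z.2) * totalD N (divQ y) * divQ x
        - MvPolynomial.C (fcoef z.2) * totalD N (divQ x) * divQ y, by
      simp only [dens2_eq, divQ_lie, map_add, map_sub, Derivation.leibniz, smul_eq_mul, act_totalD,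
        totalD_C]
      ring⟩)

/-- The cocycle `∫ dt (f'' ∂_μ η^μ(q) - g'' ∂_μ ξ^μ(q))`. -/
def cocycle3 (N : ℕ) : LieModule.Cohomology.twoCocycle ℂ (Diff N × Diff1) (Obs N) :=
  cocycleOf dens3
    (fun x x' y => by
      simp only [dens3, Prod.fst_add, Prod.snd_add, divergence_add, fcoef_add, map_add]; ring)
    (fun c x y => by
      simp only [dens3, Prod.smul_fst, Prod.smul_snd, divergence_smul, fcoef_smul, map_smul,
        Derivation.map_smul, C_smul_trig, mul_smul_comm, smul_mul_assoc, smul_sub])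
    (fun x x' y => by
      simp only [dens3, Prod.fst_add, Prod.snd_add, divergence_add, fcoef_add, map_add]; ring)
    (fun c x y => by
      simp only [dens3, Prod.smul_fst, Prod.smul_snd, divergence_smul, fcoef_smul, map_smul,
        Derivation.map_smul, C_smul_trig, mul_smul_comm, smul_mul_assoc, smul_sub])
    (fun x => ⟨0, by rw [map_zero]; exact sub_self _⟩)
    (fun x y z => ⟨MvPolynomial.C (fcoef z.2 * dt (dt (fcoef y.2)) - fcoef y.2 * dt (dt (fcoef z.2))) * divQ x
        - MvPolynomial.C (fcoef z.2 * dt (dt (fcoef x.2)) - fcoef x.2 * dt (dt (fcoef z.2))) * divQ y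
        + MvPolynomial.C (fcoef y.2 * dt (dt (fcoef x.2)) - fcoef x.2 * dt (dt (fcoef y.2))) * divQ z, by
      have h (x y : Diff N × Diff1) : dens3 x y = MvPolynomial.C (dt (dt (fcoef x.2))) * divQ y
        - MvPolynomial.C (dt (dt (fcoef y.2))) * divQ x := rfl
      simp only [h, divQ_lie, fcoefQ_lie, map_add, map_sub, map_mul, Derivation.leibniz,
        smul_eq_mul, act_C, totalD_C]
      ring⟩)

/-- The cocycle `∫ dt (f' ∂_μ η^μ(q) - g' ∂_μ ξ^μ(q))`. -/
def cocycleA (N : ℕ) : LieModule.Cohomology.twoCocycle ℂ (Diff N × Diff1) (Obs N) :=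
  cocycleOf densA
    (fun x x' y => by
      simp only [densA, Prod.fst_add, Prod.snd_add, divergence_add, fcoef_add, map_add]; ring)
    (fun c x y => by
      simp only [densA, Prod.smul_fst, Prod.smul_snd, divergence_smul, fcoef_smul, map_smul,
        Derivation.map_smul, C_smul_trig, mul_smul_comm, smul_mul_assoc, smul_sub])
    (fun x x' y => by
      simp only [densA, Prod.fst_add, Prod.snd_add, divergence_add, fcoef_add, map_add]; ring)
    (fun c x y => by
      simp only [densA, Prod.smul_fst, Prod.smul_snd, divergence_smul, fcoef_smul, map_smul,
        Derivation.map_smul, C_smul_trig, mul_smul_comm, smul_mul_assoc, smul_sub])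
    (fun x => ⟨0, by rw [map_zero]; exact sub_self _⟩)
    (fun x y z => ⟨MvPolynomial.C (fcoef z.2 * dt (fcoef y.2) - fcoef y.2 * dt (fcoef z.2)) * divQ x
        - MvPolynomial.C (fcoef z.2 * dt (fcoef x.2) - fcoef x.2 * dt (fcoef z.2)) * divQ y
        + MvPolynomial.C (fcoef y.2 * dt (fcoef x.2) - fcoef x.2 * dt (fcoef y.2)) * divQ z, by
      have h (x y : Diff N × Diff1) : densA x y = MvPolynomial.C (dt (fcoef x.2)) * divQ y
        - MvPolynomial.C (dt (fcoef y.2)) * divQ x := rfl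
      simp only [h, divQ_lie, fcoefQ_lie, map_add, map_sub, map_mul, Derivation.leibniz,
        smul_eq_mul, act_C, totalD_C]
      ring⟩)

/-- The cocycle `∫ dt (f'' g' - f' g)`. -/
def cocycle4 (N : ℕ) : LieModule.Cohomology.twoCocycle ℂ (Diff N × Diff1) (Obs N) :=
  cocycleOf dens4
    (fun x x' y => by
      simp only [dens4, Prod.snd_add, fcoef_add, map_add, map_sub, map_mul]; ring)
    (fun c x y => by
      simp only [dens4, Prod.smul_snd, fcoef_smul, Derivation.map_smul, ← C_smul_trig,
        smul_mul_assoc, smul_sub])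
    (fun x x' y => by
      simp only [dens4, Prod.snd_add, fcoef_add, map_add, map_sub, map_mul]; ring)
    (fun c x y => by
      simp only [dens4, Prod.smul_snd, fcoef_smul, Derivation.map_smul, ← C_smul_trig,
        mul_smul_comm, smul_sub])
    (fun x => ⟨(2⁻¹ : ℂ) • (MvPolynomial.C (dt (fcoef x.2) * dt (fcoef x.2) - fcoef x.2 * fcoef x.2)), by
      have h2 : (dt (dt (fcoef x.2) * dt (fcoef x.2) - fcoef x.2 * fcoef x.2))
        = (2 : ℂ) • (dt (dt (fcoef x.2)) * dt (fcoef x.2) - dt (fcoef x.2) * fcoef x.2) := by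
        rw [map_sub, Derivation.leibniz, Derivation.leibniz, smul_eq_mul, smul_eq_mul, two_smul]
        ring
      rw [Derivation.map_smul, totalD_C, h2, ← C_smul_trig, smul_smul, dens4]
      norm_num⟩)
    (fun x y z => ⟨MvPolynomial.C (fcoef x.2 * (dt (fcoef y.2) * dt (dt (fcoef z.2))
          - dt (fcoef z.2) * dt (dt (fcoef y.2)))
        + fcoef y.2 * (dt (fcoef z.2) * dt (dt (fcoef x.2))
          - dt (fcoef x.2) * dt (dt (fcoef z.2)))
        + fcoef z.2 * (dt (fcoef x.2) * dt (dt (fcoef y.2))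
          - dt (fcoef y.2) * dt (dt (fcoef x.2)))), by
      simp only [dens4, fcoefQ_lie, act_C, totalD_C, map_add, map_sub, map_mul, Derivation.leibniz,
        smul_eq_mul]
      ring⟩)

end

/-- The cocycle of `DRO(N)`. On `x = (ξ, f)` and `y = (η, g)` its value is
`(1/2πi) ∫ dt q'^ρ (c₁ ∂_ρ∂_ν ξ^μ ∂_μ η^ν + c₂ ∂_ρ∂_μ ξ^μ ∂_ν η^ν)
+ (1/4πi) ∫ dt ((c₃ f'' - i a₃ f') ∂_μ η^μ - (c₃ g'' - i a₃ g') ∂_μ ξ^μ)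
+ (c₄/24πi) ∫ dt (f'' g' - f' g)`. -/
def cocycle (N : ℕ) (c₁ c₂ c₃ a₃ c₄ : ℂ) :
    LieModule.Cohomology.twoCocycle ℂ (Diff N × Diff1) (Obs N) :=
  (1 / (2 * Real.pi * Complex.I) : ℂ) • (c₁ • cocycle1 N + c₂ • cocycle2 N)
    + (1 / (4 * Real.pi * Complex.I) : ℂ) • (c₃ • cocycle3 N + (-Complex.I * a₃) • cocycleA N)
    + (c₄ / (24 * Real.pi * Complex.I) : ℂ) • cocycle4 N

/-- The Lie algebra `DRO(N)` with abelian charges `c₁, c₂, c₃, c₄` and parameter `a₃`: the abelian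
extension of `diff(N) ⊕ diff(1)` by `Obs(N)` with bracket
`[(x, m), (y, m')] = ([x, y], cocycle x y + x·m' - y·m)`. -/
abbrev DROAlg (N : ℕ) (c₁ c₂ c₃ a₃ c₄ : ℂ) : Type :=
  LieAlgebra.ofTwoCocycle (cocycle N c₁ c₂ c₃ a₃ c₄)

section
variable {N : ℕ} {c₁ c₂ c₃ a₃ c₄ : ℂ}

/-- The generator `𝓛_ξ` of `DRO(N)`. -/
def genL (ξ : Diff N) : DROAlg N c₁ c₂ c₃ a₃ c₄ := LieAlgebra.ofTwoCocycle.mk ((ξ, 0), 0)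

/-- The generator `L_f` of `DRO(N)`. -/
def genR (f : Diff1) : DROAlg N c₁ c₂ c₃ a₃ c₄ := LieAlgebra.ofTwoCocycle.mk ((0, f), 0)

/-- A local functional, as an element of `DRO(N)`. -/
def genO (m : Obs N) : DROAlg N c₁ c₂ c₃ a₃ c₄ := LieAlgebra.ofTwoCocycle.mk (0, m)

end

/-! ### Jets and the Fock space -/

/-- Multi-indices `m = (m_0, …, m_{N-1})` of length `|m| ≤ p`. -/
abbrev MultiIdx (N p : ℕ) : Type := {m : Fin N → Fin (p + 1) // ∑ μ, (m μ : ℕ) ≤ p}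

/-- A multi-index as a function into `ℕ`. -/
def MultiIdx.val {N p : ℕ} (m : MultiIdx N p) (μ : Fin N) : ℕ := m.1 μ

/-- Labels `(α, m)` of the components of `p`-jets; `ι` labels a basis of `V`. -/
abbrev JetIdx (N p : ℕ) (ι : Type*) : Type _ := ι × MultiIdx N p

/-- The statistics of the jet fields. -/
inductive Stat : Type
  | boson : Stat
  | fermion : Stat

/-- The sign `±`: upper for bosons, lower for fermions. -/
def Stat.sign : Stat → ℂ
  | .boson => 1
  | .fermion => -1

/-- The Fourier modes `q̂^μ(n)`, `p̂_μ(n)`, `φ̂_A(n)`, `π̂^A(n)` of the fields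
(`F(t) = ∑ₙ F̂(n) e^{-int}`), where `A` runs over the set of labels of jet components. -/
inductive Mode (N : ℕ) (A : Type*) : Type _
  | q (μ : Fin N) (n : ℤ) : Mode N A
  | p (μ : Fin N) (n : ℤ) : Mode N A
  | phi (a : A) (n : ℤ) : Mode N A
  | pi (a : A) (n : ℤ) : Mode N A

section
variable {N : ℕ} {A : Type*}

/-- The modes of the jet fields and their momenta. -/
def Mode.IsJet : Mode N A → Prop
  | .q _ _ => False
  | .p _ _ => False
  | .phi _ _ => True
  | .pi _ _ => True

open Classical in
/-- The sign in the graded commutator `x y - sign • y x`: it is `-1` if `x` and `y` are both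
fermionic, and `1` otherwise. -/
def commSign (st : Stat) (x y : Mode N A) : ℂ := if x.IsJet ∧ y.IsJet then st.sign else 1

open Classical in
/-- The value of the graded commutator of two modes. These are the Fourier coefficients of
`[p_μ(s), q^ν(t)] = δ_μ^ν δ(s - t)` and `[π^A(s), φ_B(t)] = ∓[φ_B(t), π^A(s)] = δ^A_B δ(s - t)`,
with `δ(t) = (1/2π) ∑ₙ e^{-int}`. -/
def commValue (st : Stat) : Mode N A → Mode N A → ℂ
  | .p μ m, .q ν n => if μ = ν ∧ m + n = 0 then 1 / (2 * Real.pi) else 0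
  | .q ν n, .p μ m => if μ = ν ∧ m + n = 0 then -(1 / (2 * Real.pi)) else 0
  | .pi a m, .phi b n => if a = b ∧ m + n = 0 then 1 / (2 * Real.pi) else 0
  | .phi b n, .pi a m => if a = b ∧ m + n = 0 then -st.sign * (1 / (2 * Real.pi)) else 0
  | _, _ => 0

/-- The graded commutation relations. -/
inductive CommRel (N : ℕ) (A : Type*) (st : Stat) :
    FreeAlgebra ℂ (Mode N A) → FreeAlgebra ℂ (Mode N A) → Prop
  | comm (x y : Mode N A) : CommRel N A st
      (FreeAlgebra.ι ℂ x * FreeAlgebra.ι ℂ y)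
      (commSign st x y • (FreeAlgebra.ι ℂ y * FreeAlgebra.ι ℂ x)
        + algebraMap ℂ _ (commValue st x y))

/-- The enveloping algebra of the graded Heisenberg algebra of the modes. -/
abbrev ModeAlg (N : ℕ) (A : Type*) (st : Stat) : Type _ := RingQuot (CommRel N A st)

/-- A mode as an element of the enveloping algebra. -/
def modeElt (st : Stat) (x : Mode N A) : ModeAlg N A st :=
  RingQuot.mkAlgHom ℂ (CommRel N A st) (FreeAlgebra.ι ℂ x)

/-- The modes that annihilate the vacuum: the negative modes of all fields, and the zero modes of
the momenta. -/
def Mode.Annihilates : Mode N A → Prop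
  | .q _ n => n < 0
  | .p _ n => n ≤ 0
  | .phi _ n => n < 0
  | .pi _ n => n ≤ 0

/-- The left ideal generated by the modes that annihilate the vacuum. -/
def vacuumIdeal (N : ℕ) (A : Type*) (st : Stat) :
    Submodule (ModeAlg N A st) (ModeAlg N A st) :=
  Submodule.span _ {u | ∃ x : Mode N A, x.Annihilates ∧ u = modeElt st x}

/-- The Fock space; the vacuum is the class of `1`. -/
abbrev Fock (N : ℕ) (A : Type*) (st : Stat) : Type _ := ModeAlg N A st ⧸ vacuumIdeal N A st

/-- The operator on Fock space defined by a mode. -/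
def modeOp (st : Stat) (x : Mode N A) : Module.End ℂ (Fock N A st) :=
  Algebra.lsmul ℂ ℂ (Fock N A st) (modeElt st x)

end

/-! ### Operator-valued Fourier series -/

/-- An operator-valued Fourier series `X(t) = ∑ₙ X(n) e^{-int}`, given by its coefficients. -/
abbrev Series (F : Type*) [AddCommGroup F] [Module ℂ F] : Type _ := ℤ → Module.End ℂ F

section
variable {F : Type*} [AddCommGroup F] [Module ℂ F]

/-- A family of operators is locally finite if only finitely many of its members are non-zero on
any given vector. -/
def LocFin {κ : Type*} (u : κ → Module.End ℂ F) : Prop :=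
  ∀ v, (Function.support fun k => u k v).Finite

open Classical in
/-- The sum of a locally finite family of operators (and `0` for all other families). -/
def locSum {κ : Type*} (u : κ → Module.End ℂ F) : Module.End ℂ F :=
  if h : LocFin u then
    { toFun := fun v => ∑ᶠ k, u k v
      map_add' := fun v w => by
        simp only [map_add]; exact finsum_add_distrib (h v) (h w)
      map_smul' := fun c v => by
        simp only [map_smul, RingHom.id_apply]; exact (smul_finsum' c (h v)).symm }
  else 0

namespace Series

/-- The constant series `c`. -/
def const (c : ℂ) : Series F := fun k => if k = 0 then c • 1 else 0

/-- The time derivative. -/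
def ddt (X : Series F) : Series F := fun n => (-Complex.I * n) • X n

/-- The terms of the `k`-th coefficient of the product `X(t) Y(t)`. -/
def mulTerm (X Y : Series F) (k : ℤ) : ℤ → Module.End ℂ F := fun n => X n * Y (k - n)

/-- The product `X(t) Y(t)`. -/
def mul (X Y : Series F) : Series F := fun k => locSum (mulTerm X Y k)

/-- The product `X(t) Y(t)` exists. -/
def MulExists (X Y : Series F) : Prop := ∀ k, LocFin (mulTerm X Y k)

/-- The terms of the `k`-th coefficient of `P_>(t) X(t) + s X(t) P_≤(t)`, where `P_>` and `P_≤` are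
the parts of `P` of positive and of non-positive frequency. -/
def normTerm (s : ℂ) (P X : Series F) (k : ℤ) : ℤ → Module.End ℂ F := fun n =>
  if 0 < n then P n * X (k - n) else s • (X (k - n) * P n)

/-- The normal-ordered product `P_>(t) X(t) + s X(t) P_≤(t)`. -/
def norm (s : ℂ) (P X : Series F) : Series F := fun k => locSum (normTerm s P X k)

/-- The normal-ordered product `P_>(t) X(t) + s X(t) P_≤(t)` exists. -/
def NormExists (s : ℂ) (P X : Series F) : Prop := ∀ k, LocFin (normTerm s P X k)

/-- The product `f(t) X(t)` with a trigonometric polynomial `f`. -/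
def trigMul (f : Trig) (X : Series F) : Series F :=
  fun k => f.coeff.sum fun m c => c • X (k + m)

/-- The integral `∫ dt X(t)` over the circle. -/
def integral (X : Series F) : Module.End ℂ F := (2 * Real.pi : ℂ) • X 0

end Series

end

/-! ### The fields on Fock space -/

section
variable {N : ℕ} {A : Type*} (st : Stat)

/-- The field `q^μ(t)`. -/
def qF (μ : Fin N) : Series (Fock N A st) := fun n => modeOp st (.q μ n)

/-- The field `p_μ(t)`. -/
def pF (μ : Fin N) : Series (Fock N A st) := fun n => modeOp st (.p μ n)

/-- The field `φ_A(t)`. -/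
def phiF (a : A) : Series (Fock N A st) := fun n => modeOp st (.phi a n)

/-- The field `π^A(t)`. -/
def piF (a : A) : Series (Fock N A st) := fun n => modeOp st (.pi a n)

/-- The product of the fields `d^k q^μ(t)/dt^k` over a list of pairs `(μ, k)`. -/
def qWord : List (Fin N × ℕ) → Series (Fock N A st)
  | [] => Series.const 1
  | i :: l => Series.mul (Series.ddt^[i.2] (qF st i.1)) (qWord l)

/-- The operator field `P(t, q(t), q'(t), …)` of a local density `P`. (All modes of the `q^μ`
commute, so the order of the factors of a monomial does not matter.) -/
def locF (P : Loc N) : Series (Fock N A st) :=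
  ∑ s ∈ P.support, Series.trigMul (MvPolynomial.coeff s P) (qWord st (Finsupp.toMultiset s).toList)

/-- The operator field `h(q(t))` of a function `h` on spacetime. -/
def funF (h : Fun N) : Series (Fock N A st) := locF st (atQ h)

end

/-! ### The matrices `T^m_n(ξ)` -/

/-- The multi-index binomial coefficient `n! / (m! (n - m)!)`, zero unless `m ≤ n`. -/
def multiChoose {N : ℕ} (n m : Fin N → ℕ) : ℕ := ∏ μ, (n μ).choose (m μ)

/-- The partial derivative `∂_m = ∂_0^{m_0} ⋯ ∂_{N-1}^{m_{N-1}}`. -/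
def partialD {N : ℕ} (m : Fin N → ℕ) : Module.End ℂ (Fun N) :=
  (List.ofFn fun μ => ((pderiv μ : Diff N).toLinearMap : Module.End ℂ (Fun N)) ^ m μ).prod

section
variable {N : ℕ} {ι : Type*} [Fintype ι] [DecidableEq ι]

/-- The image `ϱ(T^μ_ν)` of the basis element `T^μ_ν` of `gl(N)`, the matrix unit with brackets
`[T^μ_ν, T^σ_τ] = δ^σ_ν T^μ_τ - δ^μ_τ T^σ_ν`. -/
def rhoT (ϱ : Matrix (Fin N) (Fin N) ℂ →ₗ⁅ℂ⁆ Matrix ι ι ℂ) (μ ν : Fin N) : Matrix ι ι ℂ :=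
  ϱ (Matrix.single μ ν 1)

/-- The matrix `T^m_n(ξ)`; the entry in row `β` and column `α` is `T^m_n(ξ)^α_β`, so that the field
transforms as `φ_{β,n} ↦ -∑ T^m_n(ξ)^α_β φ_{α,m}`. It vanishes if `|m| > |n|`. -/
def Tmat (ϱ : Matrix (Fin N) (Fin N) ℂ →ₗ⁅ℂ⁆ Matrix ι ι ℂ) (ξ : Diff N) (n m : Fin N → ℕ) :
    Matrix ι ι (Fun N) :=
  (∑ μ, ∑ ν, ((multiChoose n m : Fun N) * partialD (n - m + Pi.single ν 1) (comp ξ μ)) •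
      (rhoT ϱ ν μ).map MvPolynomial.C)
  + ∑ μ, if 1 ≤ m μ ∧ m - Pi.single μ 1 ≠ n then
      ((multiChoose n (m - Pi.single μ 1) : Fun N) *
        partialD (n - (m - Pi.single μ 1)) (comp ξ μ)) • (1 : Matrix ι ι (Fun N))
    else 0

/-- The numbers `k₀, k₁, k₂` of the representation `ϱ`:
`tr T^μ_ν = k₀ δ^μ_ν` and `tr T^μ_ν T^σ_τ = k₁ δ^μ_τ δ^σ_ν + k₂ δ^μ_ν δ^σ_τ`. -/
def IsTraceData (ϱ : Matrix (Fin N) (Fin N) ℂ →ₗ⁅ℂ⁆ Matrix ι ι ℂ) (k₀ k₁ k₂ : ℂ) : Prop :=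
  (∀ μ ν, (rhoT ϱ μ ν).trace = if μ = ν then k₀ else 0) ∧
  ∀ μ ν σ τ, (rhoT ϱ μ ν * rhoT ϱ σ τ).trace =
    (if μ = τ ∧ σ = ν then k₁ else 0) + (if μ = ν ∧ σ = τ then k₂ else 0)

/-- The binomial coefficient with a possibly negative lower entry (where it is zero). -/
def binom (n : ℕ) (k : ℤ) : ℂ := if 0 ≤ k then (n.choose k.toNat : ℂ) else 0

/-! ### The operators -/

variable (p : ℕ) (st : Stat) (ϱ : Matrix (Fin N) (Fin N) ℂ →ₗ⁅ℂ⁆ Matrix ι ι ℂ) (lam w : ℂ)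

/-- The field `T(ξ(q(t)), t) = ∓ ∑_{|m| ≤ |n| ≤ p} :π^{,n}(t) T^m_n(ξ(q(t))) φ_{,m}(t):`. -/
def TF (ξ : Diff N) : Series (Fock N (JetIdx N p ι) st) :=
  (-st.sign) • ∑ n : MultiIdx N p, ∑ m : MultiIdx N p, ∑ α, ∑ β,
    Series.norm st.sign (piF st (β, n))
      (Series.mul (funF st (Tmat ϱ ξ n.val m.val β α)) (phiF st (α, m)))

/-- The operator `𝓛_ξ = ∫ dt (:ξ^μ(q(t)) p_μ(t): + T(ξ(q(t)), t))`. -/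
def opL (ξ : Diff N) : Module.End ℂ (Fock N (JetIdx N p ι) st) :=
  Series.integral (∑ μ, Series.norm 1 (pF st μ) (funF st (comp ξ μ)) + TF p st ϱ ξ)

/-- The field `L'(t)`. -/
def reparPrime (N p : ℕ) (ι : Type*) [Fintype ι] (st : Stat) (lam w : ℂ) :
    Series (Fock N (JetIdx N p ι) st) :=
  st.sign • (∑ a : JetIdx N p ι,
      (-Series.norm st.sign (piF st a) (Series.ddt (phiF st a))
        + lam • Series.ddt (Series.norm st.sign (piF st a) (phiF st a))
        + (Complex.I * w) • Series.norm st.sign (piF st a) (phiF st a)))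
    + Series.const (st.sign * binom (N + p) p * Fintype.card ι *
        ((lam - lam ^ 2 - w + w ^ 2) / (4 * Real.pi * Complex.I)))

/-- The field `L(t) = -:q'^μ(t) p_μ(t): + L'(t)`. -/
def repar (N p : ℕ) (ι : Type*) [Fintype ι] (st : Stat) (lam w : ℂ) :
    Series (Fock N (JetIdx N p ι) st) :=
  -∑ μ, Series.norm 1 (pF st μ) (Series.ddt (qF st μ)) + reparPrime N p ι st lam w

/-- The operator `L_f = ∫ dt f(t) L(t)`. -/
def opR (N p : ℕ) (ι : Type*) [Fintype ι] (st : Stat) (lam w : ℂ) (f : Diff1) :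
    Module.End ℂ (Fock N (JetIdx N p ι) st) :=
  Series.integral (Series.trigMul (fcoef f) (repar N p ι st lam w))

/-- The operator `∫ dt P(t, q(t), q'(t), …)`. -/
def opO (p : ℕ) (ι : Type*) (st : Stat) (P : Loc N) :
    Module.End ℂ (Fock N (JetIdx N p ι) st) :=
  Series.integral (locF st P)

end

/-- All infinite sums that occur in the operators are locally finite. -/
def OperatorsExist (N p : ℕ) (ι : Type*) (st : Stat) : Prop :=
  (∀ (i : Fin N × ℕ) (l : List (Fin N × ℕ)), Series.MulExists
    (Series.ddt^[i.2] (qF st i.1) : Series (Fock N (JetIdx N p ι) st)) (qWord st l)) ∧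
  (∀ (h : Fun N) (μ : Fin N), Series.NormExists 1
    (pF st μ : Series (Fock N (JetIdx N p ι) st)) (funF st h)) ∧
  (∀ μ : Fin N, Series.NormExists 1
    (pF st μ : Series (Fock N (JetIdx N p ι) st)) (Series.ddt (qF st μ))) ∧
  (∀ (h : Fun N) (a : JetIdx N p ι), Series.MulExists (funF st h) (phiF st a)) ∧
  (∀ (h : Fun N) (a b : JetIdx N p ι), Series.NormExists st.sign
    (piF st b) (Series.mul (funF st h) (phiF st a))) ∧
  (∀ a : JetIdx N p ι, Series.NormExists st.sign
    (piF st a : Series (Fock N (JetIdx N p ι) st)) (phiF st a)) ∧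
  (∀ a : JetIdx N p ι, Series.NormExists st.sign
    (piF st a : Series (Fock N (JetIdx N p ι) st)) (Series.ddt (phiF st a)))

end

end DRO

/-! The pair `(ξ, f)` acts on the fields `u = (q, φ)` by a vector field on the space of modes: `q`
moves by `ξ(q) - f q'`, and `φ` by `(-T(ξ) + i w f - λ f') φ - f φ'`. Up to an additive constant,
the operators of the theorem are the normal-ordered quantizations `∑ᵢ :Xᵢ ∂/∂uᵢ:` of these vector
fields.

Two such operators commute to the quantization of the commutator of the vector fields plus an
anomaly (`ModeRep.hasSum_anomaly`). The anomaly is the one-loop sum of the products `∂Xᵢ/∂uⱼ ·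
∂Yⱼ/∂uᵢ` over pairs of modes on opposite sides of the normal-ordering cut. The vector fields
themselves close because `T(ξ)` describes the Lie derivative on `p`-jets (`partialD_lieDeriv`); the
representation property of the Lie derivative therefore passes to jets (`jetT_lie`, `jetMat_lie`).

The linearized vector fields are first-order operators `a + b d/dt` whose symbols depend on `q`
alone. For a fixed difference `r` of the two frequencies the loop sum is finite and gives a
polynomial in `r` (`hasSum_cutDiff`), that is, time derivatives. So the anomaly is the integral of a
local density (`ModeRep.hasSum_loopDensity`). The block that couples `q` to `φ` is triangular and
does not contribute to the loop.

Modulo total derivatives, the `q`-block gives the charges `1, 0, 1, 1, 2N`. The jet block involves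
only the dimension of the space of jets, the traces of `T(ξ)`, and the traces of products of two
such matrices. As `T(ξ)` is triangular in the order of the jet, only its degree-preserving part
enters; that part is `∂_ν ξ^μ` times the action of the matrix units of `gl(N)` on `V` tensored with
homogeneous jets. The traces then reduce to `k₀, k₁, k₂` and to sums of multi-index binomials
(`sum_multiChoose`, `sum_jetT`, `sum_jetT_mul`). What remains besides the cocycle is a multiple of
`∫ f' g`. It is a coboundary, and the constant term of `L(t)` removes it (`integral_anomaly`,
`ModeRep.rep_lie`).

All infinite sums are treated as unconditional sums in the topology of pointwise convergence. The
argument is carried out for any representation `ModeRep` of the modes by fields bounded below; Fock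
space enters only through `fockRep`. The numbers `k₀, k₁, k₂` exist because the trace and the trace
form of a representation of `gl(N)` are invariant (`exists_isTraceData`). -/

namespace DRO

noncomputable section

/-! ### Locally finite sums as sums in the topology of pointwise convergence -/

section
variable {F : Type*} [AddCommGroup F] [Module ℂ F]

/-- The topology of pointwise convergence on operators, for the discrete topology on `F`. -/
@[reducible] def pointwiseTopology (F : Type*) [AddCommGroup F] [Module ℂ F] :
    TopologicalSpace (Module.End ℂ F) :=
  TopologicalSpace.induced (fun u => (u : F → F)) (@Pi.topologicalSpace F (fun _ => F) fun _ => ⊥)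

attribute [local instance] pointwiseTopology

instance instIsTopologicalAddGroupEnd : IsTopologicalAddGroup (Module.End ℂ F) := by
  let _ : TopologicalSpace F := ⊥
  have : DiscreteTopology F := ⟨rfl⟩
  exact topologicalAddGroup_induced (LinearMap.ltoFun ℂ F F ℂ)

instance instT2SpaceEnd : T2Space (Module.End ℂ F) := by
  let _ : TopologicalSpace F := ⊥
  have : DiscreteTopology F := ⟨rfl⟩
  exact T2Space.of_injective_continuous (f := fun u : Module.End ℂ F => (u : F → F))
    DFunLike.coe_injective continuous_induced_dom

/-- The topology is induced from a product of copies of the discrete space `F`, so partial sums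
converge exactly when they do so on each vector separately. -/
theorem hasSum_end_iff {κ : Type*} {u : κ → Module.End ℂ F} {S : Module.End ℂ F} :
    HasSum u S ↔ ∀ v, @HasSum F κ _ ⊥ (fun k => u k v) (S v) (SummationFilter.unconditional κ) := by
  let _ : TopologicalSpace F := ⊥
  have : DiscreteTopology F := ⟨rfl⟩
  rw [HasSum, Filter.Tendsto, nhds_induced, ← Filter.map_le_iff_le_comap]
  change Filter.Tendsto _ _ (nhds _) ↔ _
  rw [Filter.tendsto_map'_iff, tendsto_pi_nhds]
  refine forall_congr' fun v => ?_
  simp only [HasSum, Function.comp_def, LinearMap.sum_apply]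

/-- This makes uniqueness of sums, reindexing and Fubini for `HasSum` available for `locSum`. On
each vector the sum is finite, hence converges in the discrete topology. -/
theorem LocFin.hasSum {κ : Type*} {u : κ → Module.End ℂ F} (h : LocFin u) :
    HasSum u (locSum u) := by
  let _ : TopologicalSpace F := ⊥
  have : DiscreteTopology F := ⟨rfl⟩
  rw [hasSum_end_iff]
  intro v
  have e : locSum u v = ∑ k ∈ (h v).toFinset, u k v := by
    rw [locSum, dif_pos h]
    exact finsum_eq_sum _ (h v)
  rw [e]
  exact hasSum_sum_of_ne_finset_zero fun k hk => by simpa using hk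

/-- In a discrete group a summable family has finite support. -/
theorem _root_.HasSum.locFin {κ : Type*} {u : κ → Module.End ℂ F} {S : Module.End ℂ F} (h : HasSum u S) :
    LocFin u := by
  let _ : TopologicalSpace F := ⊥
  have : DiscreteTopology F := ⟨rfl⟩
  intro v
  exact Summable.hasFiniteSupport_of_discreteTopology _ ⟨_, hasSum_end_iff.1 h v⟩

/-- Every linear map of `F` is continuous because `F` is discrete. Composition is used below only
through such separate continuity, never as a jointly continuous operation. -/
theorem continuous_mulLeft_end (a : Module.End ℂ F) : Continuous (AddMonoidHom.mulLeft a) := by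
  let _ : TopologicalSpace F := ⊥
  have : DiscreteTopology F := ⟨rfl⟩
  refine continuous_induced_rng.2 (continuous_pi fun v => ?_)
  have h : Continuous fun u : Module.End ℂ F => u v :=
    (continuous_apply v).comp continuous_induced_dom
  exact (continuous_of_discreteTopology (f := fun w : F => a w)).comp h

theorem continuous_mulRight_end (a : Module.End ℂ F) : Continuous (AddMonoidHom.mulRight a) := by
  let _ : TopologicalSpace F := ⊥
  have : DiscreteTopology F := ⟨rfl⟩
  refine continuous_induced_rng.2 (continuous_pi fun v => ?_)
  exact (continuous_apply (a v)).comp continuous_induced_dom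

theorem _root_.HasSum.end_mul_left {κ : Type*} {u : κ → Module.End ℂ F} {S : Module.End ℂ F}
    (h : HasSum u S) (a : Module.End ℂ F) : HasSum (fun k => a * u k) (a * S) :=
  h.map (AddMonoidHom.mulLeft a) (continuous_mulLeft_end a)

theorem _root_.HasSum.end_mul_right {κ : Type*} {u : κ → Module.End ℂ F} {S : Module.End ℂ F}
    (h : HasSum u S) (a : Module.End ℂ F) : HasSum (fun k => u k * a) (S * a) :=
  h.map (AddMonoidHom.mulRight a) (continuous_mulRight_end a)

theorem _root_.HasSum.end_smul {κ : Type*} {u : κ → Module.End ℂ F} {S : Module.End ℂ F}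
    (h : HasSum u S) (c : ℂ) : HasSum (fun k => c • u k) (c • S) := by
  have := h.end_mul_left (c • 1)
  simpa using this

/-- Commutants are closed: multiplication by `a` on either side passes through the sum. -/
theorem _root_.HasSum.end_commute {κ : Type*} {u : κ → Module.End ℂ F} {S a : Module.End ℂ F}
    (h : HasSum u S) (hc : ∀ k, a * u k = u k * a) : a * S = S * a := by
  have h1 := h.end_mul_left a
  simp only [hc] at h1
  exact h1.unique (h.end_mul_right a)

theorem LocFin.of_subset {κ : Type*} {u : κ → Module.End ℂ F}
    (h : ∀ v, ∃ t : Set κ, t.Finite ∧ ∀ k, k ∉ t → u k v = 0) : LocFin u := fun v => by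
  obtain ⟨t, ht, hk⟩ := h v
  exact ht.subset fun k hk' => by_contra fun h' => hk' (hk k h')

/-- A sum over a product with a finite index set. -/
theorem hasSum_prod_finite {ι κ : Type*} [Fintype ι] {u : ι × κ → Module.End ℂ F}
    {g : ι → Module.End ℂ F} (h : ∀ i, HasSum (fun k => u (i, k)) (g i)) :
    HasSum u (∑ i, g i) := by
  have hu : LocFin u := LocFin.of_subset fun v =>
    ⟨⋃ i, (fun k => (i, k)) '' (Function.support fun k => u (i, k) v),
      Set.finite_iUnion fun i => ((h i).locFin v).image _, fun ⟨i, k⟩ hk => by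
        by_contra h'
        exact hk (Set.mem_iUnion.2 ⟨i, ⟨k, h', rfl⟩⟩)⟩
  have h1 := hu.hasSum.prod_fiberwise h
  have h2 := h1.unique (hasSum_fintype g)
  rw [← h2]
  exact hu.hasSum

/-- If `u i` and, for each `i`, `w j (u i v)` are locally finite, then so are the products. -/
theorem _root_.HasSum.end_mul {κ κ' : Type*} {u : κ → Module.End ℂ F} {w : κ' → Module.End ℂ F}
    {S S' : Module.End ℂ F} (h : HasSum u S) (h' : HasSum w S') :
    HasSum (fun x : κ × κ' => u x.1 * w x.2) (S * S') := by
  have hl : LocFin fun x : κ × κ' => u x.1 * w x.2 := LocFin.of_subset fun v =>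
    ⟨⋃ j ∈ (Function.support fun k => w k v),
      (fun i => (i, j)) '' (Function.support fun k => u k (w j v)),
      (h'.locFin v).biUnion fun j _ => ((h.locFin _).image _), fun ⟨i, j⟩ hk => by
        by_contra hne
        refine hk (Set.mem_iUnion₂.2 ⟨j, ?_, ⟨i, hne, rfl⟩⟩)
        intro h0
        exact hne (by simp only [Module.End.mul_apply, h0, map_zero])⟩
  have h1 := hl.hasSum.prod_fiberwise fun i => h'.end_mul_left (u i)
  have h2 := h1.unique (h.end_mul_right S')
  rw [← h2]
  exact hl.hasSum

/-! ### Fields bounded below -/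

namespace Series

/-- The modes of sufficiently negative index annihilate any given vector. -/
def Bdd (X : Series F) : Prop := ∀ v, ∃ M : ℤ, ∀ n < M, X n v = 0

theorem Bdd.zero : Bdd (0 : Series F) := fun _ => ⟨0, fun _ _ => rfl⟩

theorem Bdd.add {X Y : Series F} (hX : Bdd X) (hY : Bdd Y) : Bdd (X + Y) := fun v => by
  obtain ⟨a, ha⟩ := hX v
  obtain ⟨b, hb⟩ := hY v
  exact ⟨min a b, fun n hn => by
    simp [ha n (by omega), hb n (by omega)]⟩

theorem Bdd.smul {X : Series F} (hX : Bdd X) (c : ℂ) : Bdd (c • X) := fun v => by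
  obtain ⟨a, ha⟩ := hX v
  exact ⟨a, fun n hn => by simp [ha n hn]⟩

theorem Bdd.ddt {X : Series F} (hX : Bdd X) : Bdd X.ddt := fun v => by
  obtain ⟨a, ha⟩ := hX v
  exact ⟨a, fun n hn => by simp [Series.ddt, ha n hn]⟩

/-- A common bound for finitely many vectors. -/
theorem Bdd.uniform {X : Series F} (hX : Bdd X) {t : Set F} (ht : t.Finite) :
    ∃ M : ℤ, ∀ v ∈ t, ∀ n < M, X n v = 0 := by
  choose M hM using hX
  obtain ⟨b, hb⟩ := (ht.image M).bddBelow
  exact ⟨b, fun v hv n hn => hM v n (lt_of_lt_of_le hn (hb ⟨v, hv, rfl⟩))⟩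

/-- Large `n` are cut off because `Y (k - n)` kills the vector; very negative `n` are cut off only
after `X n` has been moved to the right, which is where commutation is needed. -/
theorem mulExists_of_commute {X Y : Series F} (hX : Bdd X) (hY : Bdd Y)
    (hc : ∀ m n, X m * Y n = Y n * X m) : MulExists X Y := fun k => LocFin.of_subset fun v => by
  obtain ⟨a, ha⟩ := hX v
  obtain ⟨b, hb⟩ := hY v
  refine ⟨Set.Icc a (k - b), Set.finite_Icc _ _, fun n hn => ?_⟩
  simp only [Set.mem_Icc, not_and_or, not_le] at hn
  rcases hn with h | h
  · simp only [mulTerm, hc, Module.End.mul_apply, ha n h, map_zero]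
  · simp only [mulTerm, Module.End.mul_apply, hb (k - n) (by omega), map_zero]

theorem mul_bdd_of_commute {X Y : Series F} (hX : Bdd X) (hY : Bdd Y)
    (hc : ∀ m n, X m * Y n = Y n * X m) : Bdd (mul X Y) := fun v => by
  obtain ⟨a, ha⟩ := hX v
  obtain ⟨b, hb⟩ := hY v
  refine ⟨a + b, fun k hk => ?_⟩
  let _ : TopologicalSpace F := ⊥
  have : DiscreteTopology F := ⟨rfl⟩
  have h := hasSum_end_iff.1 ((mulExists_of_commute hX hY hc) k).hasSum v
  have h0 : (fun n => mulTerm X Y k n v) = fun _ => 0 := by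
    funext n
    by_cases hn : n < a
    · simp only [mulTerm, hc, Module.End.mul_apply, ha n hn, map_zero]
    · simp only [mulTerm, Module.End.mul_apply, hb (k - n) (by omega), map_zero]
  rw [h0] at h
  exact h.unique hasSum_zero

/-- Normal ordering replaces commutation: for `n > 0` the factor `X (k - n)` acts first and bounds
`n` above, and for `n ≤ 0` the factor `P n` acts first and bounds `n` below. -/
theorem normExists_of_bdd (s : ℂ) {P X : Series F} (hP : Bdd P) (hX : Bdd X) :
    NormExists s P X := fun k => LocFin.of_subset fun v => by
  obtain ⟨a, ha⟩ := hX v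
  obtain ⟨b, hb⟩ := hP v
  refine ⟨Set.Icc (min b 1) (max 0 (k - a)), Set.finite_Icc _ _, fun n hn => ?_⟩
  simp only [Set.mem_Icc, not_and_or, not_le] at hn
  rw [normTerm]
  split_ifs with h0
  · rw [Module.End.mul_apply, ha (k - n) (by omega), map_zero]
  · rw [LinearMap.smul_apply, Module.End.mul_apply, hb n (by omega), map_zero, smul_zero]

theorem MulExists.hasSum {X Y : Series F} (h : MulExists X Y) (k : ℤ) :
    HasSum (fun n => X n * Y (k - n)) (mul X Y k) := (h k).hasSum

theorem NormExists.hasSum {s : ℂ} {X Y : Series F} (h : NormExists s X Y) (k : ℤ) :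
    HasSum (normTerm s X Y k) (norm s X Y k) := (h k).hasSum

end Series

end

/-! ### The modes on Fock space -/

section
variable {N : ℕ} {A : Type*} (st : Stat)

theorem Stat.sign_mul_sign : st.sign * st.sign = 1 := by cases st <;> simp [Stat.sign]

theorem modeElt_mul (x y : Mode N A) : modeElt st x * modeElt st y
    = commSign st x y • (modeElt st y * modeElt st x) + algebraMap ℂ _ (commValue st x y) := by
  have h := RingQuot.mkAlgHom_rel ℂ (CommRel.comm (st := st) x y)
  simpa [modeElt] using h

theorem modeOp_mul (x y : Mode N A) : modeOp st x * modeOp st y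
    = commSign st x y • (modeOp st y * modeOp st x) + commValue st x y • 1 := by
  unfold modeOp
  rw [← map_mul, modeElt_mul, map_add, map_smul, map_mul, AlgHom.commutes]
  rfl

/-- The species of a mode: the mode with its frequency removed. -/
def fieldOf (N : ℕ) (A : Type*) : (Fin N ⊕ Fin N) ⊕ (A ⊕ A) → ℤ → Mode N A
  | .inl (.inl μ), n => .q μ n
  | .inl (.inr μ), n => .p μ n
  | .inr (.inl a), n => .phi a n
  | .inr (.inr a), n => .pi a n

theorem exists_fieldOf (x : Mode N A) : ∃ c n, x = fieldOf N A c n := by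
  cases x with
  | q μ n => exact ⟨.inl (.inl μ), n, rfl⟩
  | p μ n => exact ⟨.inl (.inr μ), n, rfl⟩
  | phi a n => exact ⟨.inr (.inl a), n, rfl⟩
  | pi a n => exact ⟨.inr (.inr a), n, rfl⟩

theorem annihilates_fieldOf (c : (Fin N ⊕ Fin N) ⊕ (A ⊕ A)) {n : ℤ} (hn : n < 0) :
    (fieldOf N A c n).Annihilates := by
  rcases c with (c | c) | (c | c)
  · exact hn
  · exact hn.le
  · exact hn
  · exact hn.le

theorem commValue_fieldOf (c d : (Fin N ⊕ Fin N) ⊕ (A ⊕ A)) {m n : ℤ} (h : m + n ≠ 0) :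
    commValue st (fieldOf N A c m) (fieldOf N A d n) = 0 := by
  have h' : n + m ≠ 0 := by omega
  rcases c with (c | c) | (c | c) <;> rcases d with (d | d) | (d | d) <;>
    simp [fieldOf, commValue, h, h']

/-- Every species of modes is bounded below on `v`. -/
def BddAt (v : Fock N A st) : Prop :=
  ∀ c, ∃ M : ℤ, ∀ n < M, modeOp st (fieldOf N A c n) v = 0

/-- A mode of frequency `n < -m` has no contraction with a mode of frequency `m`, so up to a sign it
moves past it and reaches `v`. -/
theorem BddAt.mode {v : Fock N A st} (hv : BddAt st v) (x : Mode N A) :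
    BddAt st (modeOp st x v) := fun c => by
  obtain ⟨d, m, rfl⟩ := exists_fieldOf x
  obtain ⟨M, hM⟩ := hv c
  refine ⟨min M (-m), fun n hn => ?_⟩
  rw [← Module.End.mul_apply, modeOp_mul, commValue_fieldOf st c d (by omega),
    zero_smul ℂ (1 : Module.End ℂ (Fock N A st)), add_zero, LinearMap.smul_apply,
    Module.End.mul_apply, hM n (by omega), map_zero]
  exact smul_zero (A := Fock N A st) _

theorem bddAt_of_mul (a : FreeAlgebra ℂ (Mode N A)) (v : Fock N A st) (hv : BddAt st v) :
    BddAt st (RingQuot.mkAlgHom ℂ (CommRel N A st) a • v) := by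
  induction a using FreeAlgebra.induction generalizing v with
  | grade0 r =>
    intro c
    obtain ⟨M, hM⟩ := hv c
    refine ⟨M, fun n hn => ?_⟩
    rw [AlgHom.commutes, algebraMap_smul, map_smul, hM n hn]
    exact smul_zero (A := Fock N A st) r
  | grade1 x => exact hv.mode st x
  | mul a b ha hb => rw [map_mul, mul_smul]; exact ha _ (hb _ hv)
  | add a b ha hb =>
    intro c
    obtain ⟨M, hM⟩ := ha _ hv c
    obtain ⟨M', hM'⟩ := hb _ hv c
    refine ⟨min M M', fun n hn => ?_⟩
    rw [map_add, add_smul, map_add, hM n (by omega), hM' n (by omega), add_zero]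

/-- The vacuum is killed by all negative modes, and the property survives the application of any
element of the mode algebra. -/
theorem bddAt (v : Fock N A st) : BddAt st v := by
  obtain ⟨u, rfl⟩ := Submodule.mkQ_surjective _ v
  obtain ⟨a, rfl⟩ := RingQuot.mkAlgHom_surjective ℂ (CommRel N A st) u
  have h1 : BddAt st (Submodule.mkQ (vacuumIdeal N A st) 1) := fun c =>
    ⟨0, fun n hn => by
      change modeElt st (fieldOf N A c n) • Submodule.mkQ (vacuumIdeal N A st) 1 = 0
      rw [← map_smul, smul_eq_mul, mul_one, Submodule.mkQ_apply, Submodule.Quotient.mk_eq_zero]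
      exact Submodule.subset_span ⟨_, annihilates_fieldOf c hn, rfl⟩⟩
  have h2 := bddAt_of_mul st a _ h1
  rwa [← map_smul, smul_eq_mul, mul_one] at h2

theorem bdd_fieldOf (c : (Fin N ⊕ Fin N) ⊕ (A ⊕ A)) :
    Series.Bdd fun n => modeOp st (fieldOf N A c n) := fun v => bddAt st v c

theorem bdd_qF (μ : Fin N) : Series.Bdd (qF st μ : Series (Fock N A st)) :=
  bdd_fieldOf st (.inl (.inl μ))

theorem bdd_pF (μ : Fin N) : Series.Bdd (pF st μ : Series (Fock N A st)) :=
  bdd_fieldOf st (.inl (.inr μ))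

theorem bdd_phiF (a : A) : Series.Bdd (phiF st a : Series (Fock N A st)) :=
  bdd_fieldOf st (.inr (.inl a))

theorem bdd_piF (a : A) : Series.Bdd (piF st a : Series (Fock N A st)) :=
  bdd_fieldOf st (.inr (.inr a))

end

attribute [local instance] pointwiseTopology

/-! ### Representations of the mode algebra -/

/-- The sign `ε` of a pair of field species; the species in `A` have statistics `σ`. -/
def pairSign {N : ℕ} {A : Type*} (σ : ℂ) : Fin N ⊕ A → Fin N ⊕ A → ℂ
  | .inr _, .inr _ => σ
  | _, _ => 1

open Classical in
/-- Fields `u = (q, φ)` and their momenta on a space `F`, bounded below and with the graded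
commutation relations of the mode algebra. -/
structure ModeRep (N : ℕ) (A : Type*) (F : Type*) [AddCommGroup F] [Module ℂ F] (σ : ℂ) where
  u : Fin N ⊕ A → Series F
  mom : Fin N ⊕ A → Series F
  bdd_u : ∀ I, (u I).Bdd
  bdd_mom : ∀ I, (mom I).Bdd
  u_mul_u : ∀ I J m n, u I m * u J n = pairSign σ I J • (u J n * u I m)
  mom_mul_mom : ∀ I J m n, mom I m * mom J n = pairSign σ I J • (mom J n * mom I m)
  mom_mul_u : ∀ I J m n, mom I m * u J n = pairSign σ I J • (u J n * mom I m)
    + (if I = J ∧ m + n = 0 then (1 / (2 * Real.pi) : ℂ) else 0) • 1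

namespace ModeRep

variable {N : ℕ} {A F : Type*} [AddCommGroup F] [Module ℂ F] {σ : ℂ} (R : ModeRep N A F σ)

/-- The field `q^μ(t)`. -/
abbrev q (μ : Fin N) : Series F := R.u (.inl μ)

/-! ### The bicommutant of the modes of `q` and the fields built on it. -/

/-- The operators that commute with all operators commuting with the modes of the `q^μ`. -/
def bicomm : Subalgebra ℂ (Module.End ℂ F) :=
  Subalgebra.centralizer ℂ (Subalgebra.centralizer ℂ {a | ∃ μ n, a = R.q μ n} : Set (Module.End ℂ F))

theorem mem_bicomm {a : Module.End ℂ F} : a ∈ R.bicomm ↔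
    ∀ b, (∀ μ n, R.q μ n * b = b * R.q μ n) → b * a = a * b := by
  simp only [bicomm, Subalgebra.mem_centralizer_iff, SetLike.mem_coe, Set.mem_ofPred_eq]
  constructor
  · intro h b hb
    exact h b fun g ⟨μ, n, hg⟩ => by rw [hg]; exact hb μ n
  · intro h b hb
    exact h b fun μ n => hb _ ⟨μ, n, rfl⟩

theorem q_mem_bicomm (μ : Fin N) (n : ℤ) : R.q μ n ∈ R.bicomm :=
  R.mem_bicomm.2 fun _ hb => (hb μ n).symm

/-- The modes of `q` commute, so they lie in their own centralizer. Hence the bicommutant is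
contained in that centralizer and is commutative. -/
theorem bicomm_comm {a b : Module.End ℂ F} (ha : a ∈ R.bicomm) (hb : b ∈ R.bicomm) :
    a * b = b * a :=
  R.mem_bicomm.1 hb a fun μ n => R.mem_bicomm.1 ha _ fun ν m => by
    simpa [pairSign] using R.u_mul_u (.inl ν) (.inl μ) m n

/-- Closure under infinite sums is the reason for working with a bicommutant instead of the algebra
generated by the modes: products of fields are infinite sums of products of modes. -/
theorem hasSum_mem_bicomm {κ : Type*} {f : κ → Module.End ℂ F} {S : Module.End ℂ F}
    (h : HasSum f S) (hf : ∀ k, f k ∈ R.bicomm) : S ∈ R.bicomm :=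
  R.mem_bicomm.2 fun b hb => h.end_commute fun k => R.mem_bicomm.1 (hf k) b hb

/-- The fields bounded below whose modes commute with `bicomm`. -/
def cFields : Submodule ℂ (Series F) where
  carrier := {ψ | ψ.Bdd ∧ ∀ n, ∀ b ∈ R.bicomm, b * ψ n = ψ n * b}
  zero_mem' := ⟨Series.Bdd.zero, fun _ _ _ => by simp⟩
  add_mem' := fun hx hy => ⟨hx.1.add hy.1, fun n b hb => by
    simp only [Pi.add_apply, mul_add, add_mul, hx.2 n b hb, hy.2 n b hb]⟩
  smul_mem' := fun c _ hx => ⟨hx.1.smul c, fun n b hb => by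
    simp only [Pi.smul_apply, mul_smul_comm, smul_mul_assoc, hx.2 n b hb]⟩

/-- The fields bounded below with modes in `bicomm`. -/
def qFields : Submodule ℂ (Series F) where
  carrier := {X | X.Bdd ∧ ∀ n, X n ∈ R.bicomm}
  zero_mem' := ⟨Series.Bdd.zero, fun _ => R.bicomm.zero_mem⟩
  add_mem' := fun hx hy => ⟨hx.1.add hy.1, fun n => R.bicomm.add_mem (hx.2 n) (hy.2 n)⟩
  smul_mem' := fun c _ hx => ⟨hx.1.smul c, fun n => R.bicomm.smul_mem (hx.2 n) c⟩

theorem qFields_le : R.qFields ≤ R.cFields := fun _ hX =>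
  ⟨hX.1, fun n _ hb => R.bicomm_comm hb (hX.2 n)⟩

variable {R} in
theorem comm_modes {X ψ : Series F} (hX : X ∈ R.qFields) (hψ : ψ ∈ R.cFields) (m n : ℤ) :
    X m * ψ n = ψ n * X m := hψ.2 n _ (hX.2 m)

variable {R} in
theorem mulExists {X ψ : Series F} (hX : X ∈ R.qFields) (hψ : ψ ∈ R.cFields) :
    Series.MulExists X ψ := Series.mulExists_of_commute hX.1 hψ.1 (comm_modes hX hψ)

variable {R} in
theorem hasSum_mul {X ψ : Series F} (hX : X ∈ R.qFields) (hψ : ψ ∈ R.cFields) (k : ℤ) :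
    HasSum (fun n => X n * ψ (k - n)) (Series.mul X ψ k) := (mulExists hX hψ).hasSum k

variable {R} in
theorem mul_mem_cFields {X ψ : Series F} (hX : X ∈ R.qFields) (hψ : ψ ∈ R.cFields) :
    Series.mul X ψ ∈ R.cFields :=
  ⟨Series.mul_bdd_of_commute hX.1 hψ.1 (comm_modes hX hψ), fun k b hb =>
    (hasSum_mul hX hψ k).end_commute fun n => by
      rw [← mul_assoc, R.bicomm_comm hb (hX.2 n), mul_assoc, hψ.2 _ b hb, mul_assoc]⟩

variable {R} in
theorem mul_mem_qFields {X Y : Series F} (hX : X ∈ R.qFields) (hY : Y ∈ R.qFields) :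
    Series.mul X Y ∈ R.qFields :=
  ⟨(mul_mem_cFields hX (R.qFields_le hY)).1, fun k =>
    R.hasSum_mem_bicomm (hasSum_mul hX (R.qFields_le hY) k) fun n =>
      R.bicomm.mul_mem (hX.2 n) (hY.2 _)⟩

theorem const_mem (c : ℂ) : (Series.const c : Series F) ∈ R.qFields :=
  ⟨fun v => ⟨0, fun n hn => by simp [Series.const, hn.ne]⟩, fun n => by
    unfold Series.const
    split_ifs
    · exact R.bicomm.smul_mem R.bicomm.one_mem c
    · exact R.bicomm.zero_mem⟩

variable {R} in
-- Both sides are iterated sums of one locally finite double series. If the three factors vanish on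
-- `v` below `a`, `b`, `c`, only `n ≥ a`, `m ≥ b`, `n + m ≤ k - c` contribute.
theorem mul_assoc_fields {X Y ψ : Series F} (hX : X ∈ R.qFields) (hY : Y ∈ R.qFields)
    (hψ : ψ ∈ R.cFields) : Series.mul (Series.mul X Y) ψ = Series.mul X (Series.mul Y ψ) := by
  funext k
  have hl : LocFin fun x : ℤ × ℤ => X x.1 * (Y x.2 * ψ (k - x.1 - x.2)) :=
    LocFin.of_subset fun v => by
      obtain ⟨a, ha⟩ := hX.1 v
      obtain ⟨b, hb⟩ := hY.1 v
      obtain ⟨c, hc⟩ := hψ.1 v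
      refine ⟨Set.Icc a (k - c - b) ×ˢ Set.Icc b (k - c - a),
        (Set.finite_Icc _ _).prod (Set.finite_Icc _ _), fun ⟨n, m⟩ h => ?_⟩
      have hXY := R.bicomm_comm (hX.2 n) (hY.2 m)
      have hXψ := comm_modes hX hψ n (k - n - m)
      have hYψ := comm_modes hY hψ m (k - n - m)
      rcases lt_or_ge n a with h1 | h1
      · rw [hYψ, ← mul_assoc, hXψ, mul_assoc, hXY, Module.End.mul_apply, Module.End.mul_apply,
          ha n h1, map_zero, map_zero]
      rcases lt_or_ge m b with h2 | h2
      · rw [hYψ, Module.End.mul_apply, Module.End.mul_apply, hb m h2, map_zero, map_zero]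
      rw [Module.End.mul_apply, Module.End.mul_apply, hc (k - n - m), map_zero, map_zero]
      simp only [Set.mem_prod, Set.mem_Icc, not_and_or] at h
      omega
  have h1 : HasSum (fun n => X n * Series.mul Y ψ (k - n)) (locSum _) :=
    hl.hasSum.prod_fiberwise fun n => (hasSum_mul hY hψ (k - n)).end_mul_left (X n)
  -- The reindexing `(l, n) ↦ (n, l - n)` groups the double series by the total frequency `l` of the
  -- first two factors.
  let e : ℤ × ℤ ≃ ℤ × ℤ :=
    { toFun := fun x => (x.2, x.1 - x.2)
      invFun := fun x => (x.1 + x.2, x.1)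
      left_inv := fun x => by simp
      right_inv := fun x => by simp }
  have h2 := (e.hasSum_iff (f := fun x : ℤ × ℤ => X x.1 * (Y x.2 * ψ (k - x.1 - x.2)))).2 hl.hasSum
  have h3 : HasSum (fun l => Series.mul X Y l * ψ (k - l)) _ :=
    h2.prod_fiberwise fun l => by
      refine ((hasSum_mul hX (R.qFields_le hY) l).end_mul_right (ψ (k - l))).congr_fun ?_
      intro n
      simp only [e, Function.comp, Equiv.coe_fn_mk, mul_assoc]
      rw [show k - n - (l - n) = k - l by ring]
  exact ((hasSum_mul (mul_mem_qFields hX hY) hψ k).unique h3).trans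
    ((hasSum_mul hX (mul_mem_cFields hY hψ) k).unique h1).symm

variable {R} in
theorem mul_comm_fields {X Y : Series F} (hX : X ∈ R.qFields) (hY : Y ∈ R.qFields) :
    Series.mul X Y = Series.mul Y X := by
  funext k
  have h1 := hasSum_mul hX (R.qFields_le hY) k
  have h2 := ((Equiv.subLeft k).hasSum_iff).2 (hasSum_mul hY (R.qFields_le hX) k)
  refine h1.unique (h2.congr_fun fun n => ?_)
  simp only [Function.comp, Equiv.subLeft_apply, sub_sub_cancel]
  exact R.bicomm_comm (hX.2 n) (hY.2 _)

variable {R} in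
theorem mul_add_fields {X ψ χ : Series F} (hX : X ∈ R.qFields) (hψ : ψ ∈ R.cFields)
    (hχ : χ ∈ R.cFields) : Series.mul X (ψ + χ) = Series.mul X ψ + Series.mul X χ := by
  funext k
  refine (hasSum_mul hX (R.cFields.add_mem hψ hχ) k).unique
    (((hasSum_mul hX hψ k).add (hasSum_mul hX hχ k)).congr_fun fun n => ?_)
  simp only [Pi.add_apply, mul_add]

variable {R} in
theorem add_mul_fields {X Y ψ : Series F} (hX : X ∈ R.qFields) (hY : Y ∈ R.qFields)
    (hψ : ψ ∈ R.cFields) : Series.mul (X + Y) ψ = Series.mul X ψ + Series.mul Y ψ := by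
  funext k
  refine (hasSum_mul (R.qFields.add_mem hX hY) hψ k).unique
    (((hasSum_mul hX hψ k).add (hasSum_mul hY hψ k)).congr_fun fun n => ?_)
  simp only [Pi.add_apply, add_mul]

variable {R} in
theorem smul_mul_fields (c : ℂ) {X ψ : Series F} (hX : X ∈ R.qFields) (hψ : ψ ∈ R.cFields) :
    Series.mul (c • X) ψ = c • Series.mul X ψ := by
  funext k
  refine (hasSum_mul (R.qFields.smul_mem c hX) hψ k).unique
    (((hasSum_mul hX hψ k).end_smul c).congr_fun fun n => ?_)
  simp only [Pi.smul_apply, smul_mul_assoc]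

theorem const_mul_fields (c : ℂ) {ψ : Series F} (hψ : ψ ∈ R.cFields) :
    Series.mul (Series.const c) ψ = c • ψ := by
  funext k
  refine (hasSum_mul (R.const_mem c) hψ k).unique ?_
  have : (c • ψ) k = Series.const c 0 * ψ (k - 0) := by simp [Series.const]
  rw [this]
  exact hasSum_single 0 fun n hn => by simp [Series.const, hn]

variable {R} in
theorem ddt_mul_fields {X ψ : Series F} (hX : X ∈ R.qFields) (hψ : ψ ∈ R.cFields) :
    (Series.mul X ψ).ddt = Series.mul X.ddt ψ + Series.mul X ψ.ddt := by
  have hX' : X.ddt ∈ R.qFields := ⟨hX.1.ddt, fun n => R.bicomm.smul_mem (hX.2 n) _⟩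
  have hψ' : ψ.ddt ∈ R.cFields := ⟨hψ.1.ddt, fun n b hb => by
    simp only [Series.ddt, mul_smul_comm, smul_mul_assoc, hψ.2 n b hb]⟩
  funext k
  refine ((hasSum_mul hX hψ k).end_smul (-Complex.I * k)).unique
    (((hasSum_mul hX' hψ k).add (hasSum_mul hX hψ' k)).congr_fun fun n => ?_)
  simp only [Series.ddt, mul_smul_comm, smul_mul_assoc, ← add_smul]
  congr 1; push_cast; ring

/-! ### The ring of `q`-fields and its modules -/

instance instMulQFields : Mul R.qFields := ⟨fun X Y => ⟨_, mul_mem_qFields X.2 Y.2⟩⟩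

instance instOneQFields : One R.qFields := ⟨⟨_, R.const_mem 1⟩⟩

theorem coe_mul (X Y : R.qFields) : ((X * Y : R.qFields) : Series F) = Series.mul X Y := rfl

theorem coe_one : ((1 : R.qFields) : Series F) = Series.const 1 := rfl

instance instCommRingQFields : CommRing R.qFields :=
  { (inferInstance : AddCommGroup R.qFields), R.instMulQFields, R.instOneQFields with
    mul_assoc := fun X Y Z => Subtype.ext (mul_assoc_fields X.2 Y.2 (R.qFields_le Z.2))
    mul_comm := fun X Y => Subtype.ext (mul_comm_fields X.2 Y.2)
    one_mul := fun X => Subtype.ext ((R.const_mul_fields 1 (R.qFields_le X.2)).trans (one_smul ℂ _))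
    mul_one := fun X => Subtype.ext ((mul_comm_fields X.2 (R.const_mem 1)).trans
      ((R.const_mul_fields 1 (R.qFields_le X.2)).trans (one_smul ℂ _)))
    left_distrib := fun X Y Z => Subtype.ext
      (mul_add_fields X.2 (R.qFields_le Y.2) (R.qFields_le Z.2))
    right_distrib := fun X Y Z => Subtype.ext (add_mul_fields X.2 Y.2 (R.qFields_le Z.2))
    zero_mul := fun X => Subtype.ext (by
      have := smul_mul_fields 0 X.2 (R.qFields_le X.2)
      rw [zero_smul, zero_smul] at this
      exact this)
    mul_zero := fun X => Subtype.ext (by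
      have := smul_mul_fields 0 X.2 (R.qFields_le X.2)
      rw [zero_smul, zero_smul] at this
      exact (mul_comm_fields X.2 R.qFields.zero_mem).trans this) }

instance instAlgebraQFields : Algebra ℂ R.qFields :=
  Algebra.ofModule
    (fun c X Y => Subtype.ext (smul_mul_fields c X.2 (R.qFields_le Y.2)))
    (fun c X Y => by
      rw [mul_comm, mul_comm X]
      exact Subtype.ext (smul_mul_fields c Y.2 (R.qFields_le X.2)))

instance instSMulCFields : SMul R.qFields R.cFields := ⟨fun X ψ => ⟨_, mul_mem_cFields X.2 ψ.2⟩⟩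

theorem coe_smul (X : R.qFields) (ψ : R.cFields) :
    ((X • ψ : R.cFields) : Series F) = Series.mul X ψ := rfl

instance instModuleCFields : Module R.qFields R.cFields where
  one_smul ψ := Subtype.ext ((R.const_mul_fields 1 ψ.2).trans (one_smul ℂ _))
  mul_smul X Y ψ := Subtype.ext (mul_assoc_fields X.2 Y.2 ψ.2)
  smul_zero X := Subtype.ext (by
    have h := mul_add_fields X.2 R.cFields.zero_mem R.cFields.zero_mem
    rw [add_zero] at h
    exact left_eq_add.1 h)
  smul_add X ψ χ := Subtype.ext (mul_add_fields X.2 ψ.2 χ.2)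
  add_smul X Y ψ := Subtype.ext (add_mul_fields X.2 Y.2 ψ.2)
  zero_smul ψ := Subtype.ext (by
    have h := add_mul_fields R.qFields.zero_mem R.qFields.zero_mem ψ.2
    rw [add_zero] at h
    exact left_eq_add.1 h)

instance instIsScalarTowerCFields : IsScalarTower ℂ R.qFields R.cFields :=
  ⟨fun c X ψ => Subtype.ext (smul_mul_fields c X.2 ψ.2)⟩

/-- The time derivative of `q`-fields. -/
def dtQ : Derivation ℂ R.qFields R.qFields := Derivation.mk'
  { toFun := fun X => ⟨(X : Series F).ddt, X.2.1.ddt, fun n => R.bicomm.smul_mem (X.2.2 n) _⟩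
    map_add' := fun X Y => Subtype.ext (funext fun n => smul_add _ _ _)
    map_smul' := fun c X => Subtype.ext (funext fun n =>
      smul_comm (-Complex.I * (n : ℂ)) c ((X : Series F) n)) }
  (fun X Y => Subtype.ext ((ddt_mul_fields X.2 (R.qFields_le Y.2)).trans (by
    change _ = Series.mul (X : Series F) (Series.ddt Y) + Series.mul (Y : Series F) (Series.ddt X)
    rw [add_comm]
    congr 1
    exact mul_comm_fields ⟨X.2.1.ddt, fun n => R.bicomm.smul_mem (X.2.2 n) _⟩ Y.2)))

theorem coe_dtQ (X : R.qFields) : (R.dtQ X : Series F) = (X : Series F).ddt := rfl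

/-- The time derivative of fields in `cFields`. -/
def dtC : R.cFields →ₗ[ℂ] R.cFields where
  toFun ψ := ⟨(ψ : Series F).ddt, ψ.2.1.ddt, fun n b hb => by
    simp only [Series.ddt, mul_smul_comm, smul_mul_assoc, ψ.2.2 n b hb]⟩
  map_add' := fun X Y => Subtype.ext (funext fun n => smul_add _ _ _)
  map_smul' := fun c X => Subtype.ext (funext fun n =>
      smul_comm (-Complex.I * (n : ℂ)) c ((X : Series F) n))

theorem dtC_smul (X : R.qFields) (ψ : R.cFields) :
    R.dtC (X • ψ) = R.dtQ X • ψ + X • R.dtC ψ := Subtype.ext (ddt_mul_fields X.2 ψ.2)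

/-! ### Trigonometric polynomials and local densities as fields -/

/-- The field `e^{imt}`. -/
def expField (m : ℤ) : R.qFields :=
  ⟨fun k => if k + m = 0 then 1 else 0, fun v => ⟨-m, fun n hn => by
    simp [show n + m ≠ 0 by omega]⟩, fun n => by
    dsimp only
    split_ifs
    · exact R.bicomm.one_mem
    · exact R.bicomm.zero_mem⟩

/-- With the convention `∑ ψ(n) e^{-int}`, multiplication by `e^{imt}` lowers every frequency index
by `m`; a single term of the product series survives. -/
theorem expField_smul_apply (m : ℤ) (ψ : R.cFields) (k : ℤ) :
    ((R.expField m • ψ : R.cFields) : Series F) k = (ψ : Series F) (k + m) := by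
  refine (hasSum_mul (R.expField m).2 ψ.2 k).unique ?_
  have : (ψ : Series F) (k + m) = (R.expField m : Series F) (-m) * (ψ : Series F) (k - -m) := by
    simp [expField]
  rw [this]
  exact hasSum_single (-m) fun n hn => by simp [expField, show n + m ≠ 0 by omega]

theorem expField_mul_apply (m : ℤ) (X : R.qFields) (k : ℤ) :
    ((R.expField m * X : R.qFields) : Series F) k = (X : Series F) (k + m) :=
  R.expField_smul_apply m ⟨X, R.qFields_le X.2⟩ k

/-- Trigonometric polynomials as fields. -/
def trigHom : Trig →ₐ[ℂ] R.qFields := AddMonoidAlgebra.lift ℂ R.qFields ℤ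
  { toFun := fun m => R.expField m.toAdd
    map_one' := Subtype.ext (funext fun k => by
      simp [expField, coe_one, Series.const])
    map_mul' := fun m n => Subtype.ext (funext fun k => by
      rw [expField_mul_apply]
      simp only [expField, toAdd_mul, add_assoc]) }

theorem trigHom_T (m : ℤ) : R.trigHom (T m) = R.expField m := by
  rw [trigHom, LaurentPolynomial.T]
  exact (AddMonoidAlgebra.lift_single _ _ _).trans (one_smul ℂ _)

theorem trigHom_apply (f : Trig) : R.trigHom f = f.coeff.sum fun m c => c • R.expField m :=
  AddMonoidAlgebra.lift_apply _ _

theorem trigHom_smul (f : Trig) (ψ : R.cFields) :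
    ((R.trigHom f • ψ : R.cFields) : Series F) = Series.trigMul f ψ := by
  funext k
  rw [trigHom_apply, Finsupp.sum, Finset.sum_smul, Series.trigMul, Finsupp.sum,
    Submodule.coe_sum, Finset.sum_apply]
  refine Finset.sum_congr rfl fun m _ => ?_
  rw [smul_assoc, Submodule.coe_smul, Pi.smul_apply, expField_smul_apply]

theorem trigHom_apply_mode (f : Trig) (k : ℤ) :
    (R.trigHom f : Series F) k = f.coeff (-k) • 1 := by
  rw [trigHom_apply, Finsupp.sum, Submodule.coe_sum, Finset.sum_apply]
  rw [Finset.sum_eq_single (-k)]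
  · simp [expField]
  · intro m _ hm
    simp [expField, show k + m ≠ 0 by omega]
  · intro h
    simp [Finsupp.notMem_support_iff.1 h]

theorem dtQ_trigHom (f : Trig) : R.dtQ (R.trigHom f) = R.trigHom (dt f) := by
  induction f using LaurentPolynomial.induction_on' with
  | add p q hp hq => simp only [map_add, hp, hq]
  | C_mul_T m a =>
    rw [← LaurentPolynomial.smul_eq_C_mul, map_smul, Derivation.map_smul, Derivation.map_smul,
      map_smul, dt_T, ← LaurentPolynomial.smul_eq_C_mul, map_smul, trigHom_T]
    congr 1
    refine Subtype.ext (funext fun k => ?_)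
    simp only [coe_dtQ, Series.ddt, Submodule.coe_smul, Pi.smul_apply, expField]
    split_ifs with h
    · rw [show k = -m by omega]
      congr 1
      push_cast; ring
    · simp

/-- The field `d^k q^μ/dt^k` as an element of the ring of `q`-fields. -/
def qField (i : Fin N × ℕ) : R.qFields :=
  (R.dtQ)^[i.2] ⟨R.q i.1, R.bdd_u _, R.q_mem_bicomm i.1⟩

theorem coe_qField (i : Fin N × ℕ) : (R.qField i : Series F) = Series.ddt^[i.2] (R.q i.1) := by
  obtain ⟨μ, k⟩ := i
  induction k with
  | zero => rfl
  | succ k ih =>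
    rw [Function.iterate_succ_apply', ← ih, ← coe_dtQ, qField, qField, Function.iterate_succ_apply']

/-- Local densities as fields. -/
def locHom : Loc N →+* R.qFields := MvPolynomial.eval₂Hom R.trigHom.toRingHom R.qField

theorem locHom_C (f : Trig) : R.locHom (MvPolynomial.C f) = R.trigHom f :=
  MvPolynomial.eval₂Hom_C _ _ _

theorem locHom_X (i : Fin N × ℕ) : R.locHom (X i) = R.qField i :=
  MvPolynomial.eval₂Hom_X' _ _ _

theorem locHom_smul (c : ℂ) (P : Loc N) : R.locHom (c • P) = c • R.locHom P := by
  have h : (c • P : Loc N) = MvPolynomial.C (LaurentPolynomial.C c) * P := by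
    rw [← MvPolynomial.smul_eq_C_mul, LaurentPolynomial.C, AddMonoidAlgebra.singleZeroRingHom]
    exact (algebraMap_smul Trig c P).symm
  rw [h, map_mul, locHom_C, Algebra.smul_def]
  congr 1
  exact R.trigHom.commutes c

theorem locHom_totalD (P : Loc N) : R.locHom (totalD N P) = R.dtQ (R.locHom P) := by
  induction P using MvPolynomial.induction_on with
  | C f => rw [totalD_C, locHom_C, locHom_C, dtQ_trigHom]
  | add p q hp hq => simp only [map_add, hp, hq]
  | mul_X p i hp =>
    have hX : R.locHom (totalD N (X i)) = R.dtQ (R.locHom (X i)) := by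
      rw [totalD_X, locHom_X, locHom_X, qField, qField, Function.iterate_succ_apply']
    simp only [Derivation.leibniz, map_add, map_mul, smul_eq_mul, hp, hX]

theorem locHom_totalD_iterate (k : ℕ) (P : Loc N) :
    R.locHom ((totalD N)^[k] P) = R.dtQ^[k] (R.locHom P) := by
  induction k with
  | zero => rfl
  | succ k ih => rw [Function.iterate_succ_apply', Function.iterate_succ_apply', locHom_totalD, ih]

/-! ### Commutators with fields -/

/-- The commutator with `U` is a derivation, and it passes through the series that defines the
product. -/
theorem lie_smul_modes {U : Module.End ℂ F} {α α' : R.qFields} {ψ ψ' : R.cFields}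
    (hα : ∀ n, U * (α : Series F) n - (α : Series F) n * U = (α' : Series F) n)
    (hψ : ∀ n, U * (ψ : Series F) n - (ψ : Series F) n * U = (ψ' : Series F) n) (k : ℤ) :
    U * ((α • ψ : R.cFields) : Series F) k - ((α • ψ : R.cFields) : Series F) k * U
      = ((α' • ψ + α • ψ' : R.cFields) : Series F) k := by
  have h := hasSum_mul α.2 ψ.2 k
  refine ((h.end_mul_left U).sub (h.end_mul_right U)).unique
    (((hasSum_mul α'.2 ψ.2 k).add (hasSum_mul α.2 ψ'.2 k)).congr_fun fun n => ?_)
  rw [← hα, ← hψ]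
  noncomm_ring

theorem lie_mul_modes {U : Module.End ℂ F} {α α' β β' : R.qFields}
    (hα : ∀ n, U * (α : Series F) n - (α : Series F) n * U = (α' : Series F) n)
    (hβ : ∀ n, U * (β : Series F) n - (β : Series F) n * U = (β' : Series F) n) (k : ℤ) :
    U * ((α * β : R.qFields) : Series F) k - ((α * β : R.qFields) : Series F) k * U
      = ((α' * β + α * β' : R.qFields) : Series F) k :=
  R.lie_smul_modes (ψ := ⟨β, R.qFields_le β.2⟩) (ψ' := ⟨β', R.qFields_le β'.2⟩) hα hβ k

/-- The commutator with `U` is a derivation that commutes with `d/dt` and kills functions of `t`.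
Its values on the modes of `q` therefore determine it on all local densities. It is used both for
the momenta and for the operators of vector fields. -/
theorem lie_locHom {U : Module.End ℂ F} {d : Fin N → Loc N}
    (h : ∀ μ n, U * R.q μ n - R.q μ n * U = (R.locHom (d μ) : Series F) n) (P : Loc N) (n : ℤ) :
    U * (R.locHom P : Series F) n - (R.locHom P : Series F) n * U
      = (R.locHom (mkDerivation Trig (fun i : Fin N × ℕ => (totalD N)^[i.2] (d i.1)) P) :
          Series F) n := by
  induction P using MvPolynomial.induction_on generalizing n with
  | C f =>
    have h0 : mkDerivation Trig (fun i : Fin N × ℕ => (totalD N)^[i.2] (d i.1))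
        (MvPolynomial.C f) = 0 := Derivation.map_algebraMap _ f
    rw [h0, locHom_C, trigHom_apply_mode]
    simp
  | add p q hp hq =>
    simp only [map_add, Submodule.coe_add, Pi.add_apply, mul_add, add_mul, ← hp, ← hq]
    abel
  | mul_X p i hp =>
    have hX : ∀ n, U * (R.locHom (X i) : Series F) n - (R.locHom (X i) : Series F) n * U
        = (R.locHom ((totalD N)^[i.2] (d i.1)) : Series F) n := by
      obtain ⟨μ, k⟩ := i
      rw [locHom_X, locHom_totalD_iterate]
      induction k with
      | zero => exact h μ
      | succ k ih =>
        intro n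
        rw [Function.iterate_succ_apply', qField, Function.iterate_succ_apply', coe_dtQ, coe_dtQ,
          Series.ddt, Series.ddt, ← ih, smul_sub, mul_smul_comm, smul_mul_assoc]
        rfl
    rw [map_mul, R.lie_mul_modes hp hX n, Derivation.leibniz, mkDerivation_X, smul_eq_mul,
      smul_eq_mul, map_add, map_mul, map_mul, mul_comm (R.locHom (X i)), add_comm]

end ModeRep

/-! ### Commutators of normal-ordered vector fields -/

section
variable {F : Type*} [AddCommGroup F] [Module ℂ F]

/-- The members of sufficiently negative degree annihilate any given vector. -/
def BddDeg {κ : Type*} (deg : κ → ℤ) (f : κ → Module.End ℂ F) : Prop :=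
  ∀ v, ∃ M : ℤ, ∀ k, deg k < M → f k v = 0

theorem BddDeg.uniform {κ : Type*} {deg : κ → ℤ} {f : κ → Module.End ℂ F} (hf : BddDeg deg f)
    {t : Set F} (ht : t.Finite) : ∃ M : ℤ, ∀ v ∈ t, ∀ k, deg k < M → f k v = 0 := by
  choose M hM using hf
  obtain ⟨b, hb⟩ := (ht.image M).bddBelow
  exact ⟨b, fun v hv k hk => hM v k (lt_of_lt_of_le hk (hb ⟨v, hv, rfl⟩))⟩

theorem bddDeg_of_bdd {I : Type*} [Finite I] {X : I → Series F} (hX : ∀ i, (X i).Bdd) :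
    BddDeg (fun i : I × ℤ => i.2) fun i => X i.1 i.2 := fun v => by
  choose M hM using fun i => hX i v
  obtain ⟨b, hb⟩ := (Set.finite_range M).bddBelow
  exact ⟨b, fun k hk => hM k.1 k.2 (lt_of_lt_of_le hk (hb ⟨k.1, rfl⟩))⟩

end

/-! ### Signs and contractions in commutators of ordered products. -/

section
variable {B : Type*} [Ring B] [Algebra ℂ B]

theorem sign_cases {s : ℂ} (h : s * s = 1) : s = 1 ∨ s = -1 := mul_self_eq_one_iff.1 h

/-- Here `ε` is the sign for exchanging the two species, `s` the sign of the first species with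
itself, and `D` the contraction of `P` with `Y`. Once the signs are fixed, each claim is a
combination of the hypotheses in the free associative ring. -/
theorem normal_lie_aux {ε s : ℂ} (hε : ε * ε = 1) (hs : s * s = 1) {X Y P D : B}
    (hPY : P * Y = ε • (Y * P) + D) (hXY : X * Y = ε • (Y * X)) (hXD : X * D = (s * ε) • (D * X)) :
    X * P * Y - Y * (X * P) = X * D ∧ s • (P * X) * Y - Y * (s • (P * X)) = X * D := by
  rcases sign_cases hε with rfl | rfl <;> rcases sign_cases hs with rfl | rfl <;>
    simp only [one_smul, neg_smul, mul_one, mul_neg, neg_neg] at hPY hXY hXD ⊢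
  · exact ⟨by linear_combination (norm := noncomm_ring) X * hPY + hXY * P,
      by linear_combination (norm := noncomm_ring) P * hXY + hPY * X - hXD⟩
  · exact ⟨by linear_combination (norm := noncomm_ring) X * hPY + hXY * P,
      by linear_combination (norm := noncomm_ring) -P * hXY - hPY * X - hXD⟩
  · exact ⟨by linear_combination (norm := noncomm_ring) X * hPY - hXY * P,
      by linear_combination (norm := noncomm_ring) P * hXY - hPY * X - hXD⟩
  · exact ⟨by linear_combination (norm := noncomm_ring) X * hPY - hXY * P,
      by linear_combination (norm := noncomm_ring) -P * hXY + hPY * X - hXD⟩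

/-- When both momenta stand on the same side of their coefficients, the two simple contractions come
out already ordered. When the sides differ, ordering them leaves the double contraction `D * E`;
this is the source of the anomaly. -/
theorem normal_comm_aux {ε s t : ℂ} (hε : ε * ε = 1) (hs : s * s = 1) (ht : t * t = 1)
    {X Y P Q D E : B}
    (hPY : P * Y = ε • (Y * P) + D) (hQX : Q * X = ε • (X * Q) + E)
    (hXY : X * Y = ε • (Y * X)) (hPQ : P * Q = ε • (Q * P))
    (hXD : X * D = (s * ε) • (D * X)) (hYE : Y * E = (t * ε) • (E * Y)) :
    (X * P * (Y * Q) - Y * Q * (X * P) = X * D * Q - Y * E * P) ∧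
    (s • (P * X) * (t • (Q * Y)) - t • (Q * Y) * (s • (P * X))
      = t • (Q * (X * D)) - s • (P * (Y * E))) ∧
    (s • (P * X) * (Y * Q) - Y * Q * (s • (P * X))
      = X * D * Q - s • (P * (Y * E)) + s • (D * E)) := by
  refine ⟨?_, ?_, ?_⟩
  · linear_combination (norm := skip)
      X * hPY * Q - Y * hQX * P + ε • (hXY * (P * Q)) + Y * X * hPQ
    rcases sign_cases hε with rfl | rfl <;> simp only [one_smul, neg_smul] <;> noncomm_ring
  · linear_combination (norm := skip)
      (-(s * t * ε)) • (P * hQX * Y) + (s * t * ε) • (Q * hPY * X) + (s * t * ε) • (hPQ * (X * Y))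
        + (s * t) • (Q * P * hXY) - t • (Q * hXD) + s • (P * hYE)
    rcases sign_cases hε with rfl | rfl <;> rcases sign_cases hs with rfl | rfl <;>
      rcases sign_cases ht with rfl | rfl <;>
      simp only [one_smul, neg_smul, mul_one, mul_neg, neg_neg] <;> noncomm_ring
  · linear_combination (norm := skip)
      s • (P * hXY * Q) - s • (P * Y * hQX) + s • (hPY * (Q * X)) + (s * ε) • (Y * hPQ * X)
        + s • (D * hQX) - hXD * Q
    rcases sign_cases hε with rfl | rfl <;> rcases sign_cases hs with rfl | rfl <;>
      simp only [one_smul, neg_smul, mul_one, mul_neg, neg_neg] <;> noncomm_ring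

end

namespace ModeRep

variable {N : ℕ} {A F : Type*} [AddCommGroup F] [Module ℂ F] {σ : ℂ} (R : ModeRep N A F σ)

/-- The momentum conjugate to the mode `u_i`, normalized so that the commutator is `1`. -/
def P (i : (Fin N ⊕ A) × ℤ) : Module.End ℂ F := (2 * Real.pi : ℂ) • R.mom i.1 (-i.2)

open Classical in
theorem P_mul_u (i : (Fin N ⊕ A) × ℤ) (J : Fin N ⊕ A) (n : ℤ) :
    R.P i * R.u J n = pairSign σ i.1 J • (R.u J n * R.P i) + (if i = (J, n) then (1 : ℂ) else 0) • 1 := by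
  have hpi : (2 * Real.pi : ℂ) ≠ 0 := by simp [Real.pi_ne_zero]
  have h1 : (i.1 = J ∧ -i.2 + n = 0) ↔ i = (J, n) := by
    rw [Prod.ext_iff]
    exact and_congr_right fun _ => by dsimp only; omega
  rw [P, smul_mul_assoc, R.mom_mul_u, smul_add, mul_smul_comm, smul_comm (2 * Real.pi : ℂ),
    smul_smul _ _ (1 : Module.End ℂ F)]
  simp only [h1]
  congr 2
  split_ifs
  · field_simp
  · simp

theorem P_mul_P (i j : (Fin N ⊕ A) × ℤ) :
    R.P i * R.P j = pairSign σ i.1 j.1 • (R.P j * R.P i) := by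
  simp only [P, smul_mul_assoc, mul_smul_comm, R.mom_mul_mom i.1 j.1]
  rw [smul_comm (2 * Real.pi : ℂ) (pairSign σ _ _), smul_comm (2 * Real.pi : ℂ) (pairSign σ _ _)]

theorem bddDeg_P [Finite A] : BddDeg (fun i : (Fin N ⊕ A) × ℤ => -i.2) R.P := fun v => by
  obtain ⟨M, hM⟩ := bddDeg_of_bdd R.bdd_mom v
  exact ⟨M, fun i hi => by
    rw [P, LinearMap.smul_apply, hM (i.1, -i.2) hi, smul_zero]⟩

/-- The normal-ordered product of `P_i` and `Z`. -/
def normal (i : (Fin N ⊕ A) × ℤ) (Z : Module.End ℂ F) : Module.End ℂ F :=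
  if i.2 < 0 then pairSign σ i.1 i.1 • (R.P i * Z) else Z * R.P i

theorem normal_sub (i : (Fin N ⊕ A) × ℤ) (Z W : Module.End ℂ F) :
    R.normal i (Z - W) = R.normal i Z - R.normal i W := by
  unfold normal
  split_ifs
  · rw [mul_sub, smul_sub]
  · rw [sub_mul]

theorem hasSum_normal {κ : Type*} {f : κ → Module.End ℂ F} {S : Module.End ℂ F}
    (h : HasSum f S) (i : (Fin N ⊕ A) × ℤ) : HasSum (fun k => R.normal i (f k)) (R.normal i S) := by
  unfold normal
  split_ifs
  · exact (h.end_mul_left _).end_smul _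
  · exact h.end_mul_right _

theorem _root_.DRO.pairSign_mul_self (hσ : σ * σ = 1) (I J : Fin N ⊕ A) :
    pairSign σ I J * pairSign σ I J = 1 := by
  rcases I with I | I <;> rcases J with J | J <;> simp [pairSign, hσ]

theorem _root_.DRO.pairSign_comm (I J : Fin N ⊕ A) : pairSign σ I J = pairSign σ J I := by
  rcases I with I | I <;> rcases J with J | J <;> rfl

/-- The components `X` of a vector field, with matrix of derivatives `D i j = ∂X_j/∂u_i`. -/
structure IsVectorField (X : Fin N ⊕ A → Series F)
    (D : (Fin N ⊕ A) × ℤ → (Fin N ⊕ A) × ℤ → Module.End ℂ F) : Prop where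
  bdd : ∀ I, (X I).Bdd
  bdd_deriv : BddDeg (fun k : ((Fin N ⊕ A) × ℤ) × ((Fin N ⊕ A) × ℤ) => k.2.2 - k.1.2)
    fun k => D k.1 k.2
  P_mul : ∀ i j, R.P i * X j.1 j.2 = pairSign σ i.1 j.1 • (X j.1 j.2 * R.P i) + D i j

/-- The graded commutation relations between the components of a vector field and those, and the
derivatives, of another. -/
structure Compatible (σ : ℂ) (X Y : Fin N ⊕ A → Series F)
    (D : (Fin N ⊕ A) × ℤ → (Fin N ⊕ A) × ℤ → Module.End ℂ F) : Prop where
  comm : ∀ (i j : (Fin N ⊕ A) × ℤ), X i.1 i.2 * Y j.1 j.2 = pairSign σ i.1 j.1 • (Y j.1 j.2 * X i.1 i.2)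
  comm_deriv : ∀ (i j : (Fin N ⊕ A) × ℤ), X i.1 i.2 * D i j
    = (pairSign σ i.1 i.1 * pairSign σ i.1 j.1) • (D i j * X i.1 i.2)

/-- The terms of the anomaly. -/
def anomaly (σ : ℂ) (DX DY : (Fin N ⊕ A) × ℤ → (Fin N ⊕ A) × ℤ → Module.End ℂ F)
    (i j : (Fin N ⊕ A) × ℤ) : Module.End ℂ F :=
  if i.2 < 0 then (if j.2 < 0 then 0 else pairSign σ i.1 i.1 • (DY i j * DX j i))
  else if j.2 < 0 then -(pairSign σ j.1 j.1 • (DX j i * DY i j)) else 0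

variable {X Y Z : Fin N ⊕ A → Series F}
  {DX DY : (Fin N ⊕ A) × ℤ → (Fin N ⊕ A) × ℤ → Module.End ℂ F}

section
variable {R}

/-- Both orderings of `Xᵢ` and `Pᵢ` have the same commutator with `Yⱼ`, so the action on fields is
classical. -/
theorem normal_lie (hσ : σ * σ = 1) (hY : R.IsVectorField Y DY)
    (hXY : Compatible σ X Y DY) (i j : (Fin N ⊕ A) × ℤ) :
    R.normal i (X i.1 i.2) * Y j.1 j.2 - Y j.1 j.2 * R.normal i (X i.1 i.2) = X i.1 i.2 * DY i j := by
  have h := normal_lie_aux (pairSign_mul_self hσ i.1 j.1) (pairSign_mul_self hσ i.1 i.1)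
    (hY.P_mul i j) (hXY.comm i j) (hXY.comm_deriv i j)
  unfold normal
  split_ifs
  · exact h.2
  · exact h.1

theorem normal_comm (hσ : σ * σ = 1) (hX : R.IsVectorField X DX) (hY : R.IsVectorField Y DY)
    (hXY : Compatible σ X Y DY) (hYX : Compatible σ Y X DX) (i j : (Fin N ⊕ A) × ℤ) :
    R.normal i (X i.1 i.2) * R.normal j (Y j.1 j.2) - R.normal j (Y j.1 j.2) * R.normal i (X i.1 i.2)
      = R.normal j (X i.1 i.2 * DY i j) - R.normal i (Y j.1 j.2 * DX j i) + anomaly σ DX DY i j := by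
  have hs := pairSign_comm (σ := σ) i.1 j.1
  have hX1 := hX.P_mul j i
  have hY1 := hY.P_mul i j
  have h1 := hXY.comm i j
  have h2 := hYX.comm j i
  have h3 := hXY.comm_deriv i j
  have h4 := hYX.comm_deriv j i
  rw [← hs] at hX1 h2 h4
  have hP := R.P_mul_P i j
  have hP' := R.P_mul_P j i
  rw [← hs] at hP'
  have a := normal_comm_aux (pairSign_mul_self hσ i.1 j.1) (pairSign_mul_self hσ i.1 i.1)
    (pairSign_mul_self hσ j.1 j.1) hY1 hX1 h1 hP h3 h4
  have b := normal_comm_aux (pairSign_mul_self hσ i.1 j.1) (pairSign_mul_self hσ j.1 j.1)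
    (pairSign_mul_self hσ i.1 i.1) hX1 hY1 h2 hP' h4 h3
  unfold normal anomaly
  split_ifs
  · rw [a.2.1, add_zero]
  · exact a.2.2
  -- The second mixed case is the first one with the two vector fields exchanged, hence the opposite
  -- sign in `anomaly`.
  · rw [← neg_sub, b.2.2]; abel
  · rw [a.1, add_zero]

/-- This permits the simple contractions to be summed in either order. Its point is that `Xᵢ`, `Dᵢⱼ`
and, for `j ≥ 0`, `Pⱼ` each bound the indices from one side. -/
theorem locFin_normal_deriv [Finite A] (hX : ∀ I, (X I).Bdd)
    (hD : BddDeg (fun k : ((Fin N ⊕ A) × ℤ) × ((Fin N ⊕ A) × ℤ) => k.2.2 - k.1.2)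
      fun k => DY k.1 k.2)
    (hXD : ∀ i j, ∃ c : ℂ, X i.1 i.2 * DY i j = c • (DY i j * X i.1 i.2)) :
    LocFin fun x : ((Fin N ⊕ A) × ℤ) × ((Fin N ⊕ A) × ℤ) =>
      R.normal x.1 (X x.2.1 x.2.2 * DY x.2 x.1) := LocFin.of_subset fun v => by
  have hX' := bddDeg_of_bdd hX
  obtain ⟨mp, hmp⟩ := R.bddDeg_P v
  -- For `j ≥ 0` the momentum acts first, and only those `Pⱼ` with `j ≤ -mp` fail to kill `v`. So
  -- the remaining factors act on a finite set of vectors, on which the bounds `mx` and `md` hold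
  -- uniformly.
  have hW : (insert v (R.P '' (Set.univ ×ˢ Set.Icc 0 (-mp)) |>.image (fun a => a v))).Finite :=
    (((Set.finite_univ.prod (Set.finite_Icc _ _)).image _).image _).insert v
  obtain ⟨mx, hmx⟩ := hX'.uniform hW
  obtain ⟨md, hmd⟩ := hD.uniform hW
  have key : ∀ w ∈ insert v (R.P '' (Set.univ ×ˢ Set.Icc 0 (-mp)) |>.image (fun a => a v)),
      ∀ i j : (Fin N ⊕ A) × ℤ, (i.2 < mx ∨ j.2 - i.2 < md) → (X i.1 i.2 * DY i j) w = 0 := by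
    intro w hw i j h
    rcases h with h | h
    · obtain ⟨c, hc⟩ := hXD i j
      rw [hc, LinearMap.smul_apply, Module.End.mul_apply, hmx w hw i h, map_zero, smul_zero]
    · rw [Module.End.mul_apply, hmd w hw (i, j) h, map_zero]
  refine ⟨(Set.univ ×ˢ Set.Icc (min 0 (mx + md)) (max 0 (-mp))) ×ˢ
    (Set.univ ×ˢ Set.Icc mx (max 0 (-mp) - md)),
    (Set.finite_univ.prod (Set.finite_Icc _ _)).prod (Set.finite_univ.prod (Set.finite_Icc _ _)),
    fun ⟨j, i⟩ h => ?_⟩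
  simp only [Set.mem_prod, Set.mem_univ, true_and, Set.mem_Icc, not_and_or, not_le] at h
  unfold normal
  dsimp only
  split_ifs with hj
  · rw [LinearMap.smul_apply, Module.End.mul_apply, key v (Set.mem_insert _ _) i j (by omega),
      map_zero, smul_zero]
  · rw [Module.End.mul_apply]
    by_cases hj' : j.2 ≤ -mp
    · exact key _ (Set.mem_insert_of_mem _ ⟨_, ⟨j, ⟨trivial, not_lt.1 hj, hj'⟩, rfl⟩, rfl⟩) i j
        (by omega)
    · rw [hmp j (show -j.2 < mp by omega), map_zero]

/-- Normal-ordered vector fields represent the commutator of vector fields, up to the anomaly. -/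
theorem hasSum_anomaly [Finite A] (hσ : σ * σ = 1) (hX : R.IsVectorField X DX)
    (hY : R.IsVectorField Y DY) (hXY : Compatible σ X Y DY) (hYX : Compatible σ Y X DX)
    {OX OY OZ : Module.End ℂ F}
    (hOX : HasSum (fun i : (Fin N ⊕ A) × ℤ => R.normal i (X i.1 i.2)) OX)
    (hOY : HasSum (fun i : (Fin N ⊕ A) × ℤ => R.normal i (Y i.1 i.2)) OY)
    (hOZ : HasSum (fun i : (Fin N ⊕ A) × ℤ => R.normal i (Z i.1 i.2)) OZ)
    (hZ : ∀ I n, Z I n = OX * Y I n - Y I n * OX - (OY * X I n - X I n * OY)) :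
    HasSum (fun x : ((Fin N ⊕ A) × ℤ) × ((Fin N ⊕ A) × ℤ) => anomaly σ DX DY x.1 x.2)
      (OX * OY - OY * OX - OZ) := by
  have lie : ∀ {X Y : Fin N ⊕ A → Series F} {DY OX}, R.IsVectorField Y DY → Compatible σ X Y DY →
      HasSum (fun i : (Fin N ⊕ A) × ℤ => R.normal i (X i.1 i.2)) OX → ∀ j : (Fin N ⊕ A) × ℤ,
      HasSum (fun i : (Fin N ⊕ A) × ℤ => X i.1 i.2 * DY i j) (OX * Y j.1 j.2 - Y j.1 j.2 * OX) := by
    intro X Y DY OX hY hXY h j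
    refine ((h.end_mul_right _).sub (h.end_mul_left _)).congr_fun fun i => ?_
    exact (normal_lie hσ hY hXY i j).symm
  have l1 := locFin_normal_deriv (R := R) hX.bdd hY.bdd_deriv fun i j => ⟨_, hXY.comm_deriv i j⟩
  have l2 := locFin_normal_deriv (R := R) hY.bdd hX.bdd_deriv fun i j => ⟨_, hYX.comm_deriv i j⟩
  -- Summing over `i` first turns `∑ᵢ Xᵢ Dᵢⱼ` into the commutator of `OX` with `Yⱼ`; the sum over
  -- `j` is then a normal-ordered vector field. The difference of `s1` and `s2` is therefore `OZ`.
  have s1 := l1.hasSum.prod_fiberwise fun j => R.hasSum_normal (lie hY hXY hOX j) j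
  have s2 := l2.hasSum.prod_fiberwise fun j => R.hasSum_normal (lie hX hYX hOY j) j
  have hOZ' : OZ = _ := hOZ.unique ((s1.sub s2).congr_fun fun j => by
    rw [hZ, normal_sub])
  rw [hOZ']
  have c1 := hOX.end_mul hOY
  have c2 := ((Equiv.prodComm _ _).hasSum_iff).2 (hOY.end_mul hOX)
  have c3 := ((Equiv.prodComm _ _).hasSum_iff).2 l1.hasSum
  refine ((c1.sub c2).sub (c3.sub l2.hasSum)).congr_fun fun x => ?_
  have := normal_comm hσ hX hY hXY hYX x.1 x.2
  simp only [Function.comp, Equiv.prodComm_apply, Prod.fst_swap, Prod.snd_swap]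
  rw [this]; abel

end

end ModeRep

/-! ### The vector fields on jets -/

/-- The variation of the densities under a change of the mode `q̂^ν(m)`. -/
def modeDeriv {N : ℕ} (ν : Fin N) (m : ℤ) : Derivation Trig (Loc N) (Loc N) :=
  mkDerivation Trig fun i => (totalD N)^[i.2] (if i.1 = ν then MvPolynomial.C (T (-m)) else 0)

theorem modeDeriv_atQ {N : ℕ} (ν : Fin N) (m : ℤ) (h : Fun N) :
    modeDeriv ν m (atQ h) = MvPolynomial.C (T (-m)) * atQ (pderiv ν h) := by
  have hX (i : Fin N) : (atQ (X i) : Loc N) = X (i, 0) := by simp [atQ]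
  induction h using MvPolynomial.induction_on with
  | C a =>
    have : (atQ (MvPolynomial.C a) : Loc N) = algebraMap ℂ _ a := by simp [atQ]
    rw [this]
    have h2 : (algebraMap ℂ (Loc N) a) = algebraMap Trig (Loc N) (algebraMap ℂ Trig a) := rfl
    rw [h2, Derivation.map_algebraMap]; simp
  | add p q hp hq => simp only [map_add, hp, hq, mul_add]
  | mul_X p i hp =>
    have h1 : modeDeriv ν m (X (i, 0) : Loc N) = MvPolynomial.C (T (-m)) * atQ (pderiv ν (X i)) := by
      rw [modeDeriv, mkDerivation_X, pderiv_X]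
      by_cases h : i = ν
      · subst h; simp
      · simp [h]
    simp only [map_mul, Derivation.leibniz, map_add, smul_eq_mul, hX, hp, h1]
    ring

theorem modeDeriv_C_mul_X {N : ℕ} (ν μ : Fin N) (m : ℤ) (f : Trig) :
    modeDeriv ν m (MvPolynomial.C f * X (μ, 1)) = MvPolynomial.C (T (-m)) *
      ((-(Complex.I * m)) • if μ = ν then MvPolynomial.C f else 0) := by
  have h0 : modeDeriv ν m (MvPolynomial.C f : Loc N) = 0 := Derivation.map_algebraMap _ f
  rw [Derivation.leibniz, h0, smul_zero, add_zero, modeDeriv, mkDerivation_X, smul_eq_mul]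
  have hc : Complex.I * ((-m : ℤ) : ℂ) = -(Complex.I * m) := by push_cast; ring
  by_cases h : μ = ν
  · simp only [h, if_true, Function.iterate_one, totalD_C, dt_T, hc]
    rw [← LaurentPolynomial.smul_eq_C_mul, C_smul_trig, mul_smul_comm, mul_smul_comm,
      mul_comm (MvPolynomial.C f)]
  · simp [h]

namespace ModeRep

variable {N : ℕ} {A F : Type*} [AddCommGroup F] [Module ℂ F] {σ : ℂ} (R : ModeRep N A F σ)

/-- The field `φ_a(t)`. -/
def phi (a : A) : R.cFields := ⟨R.u (.inr a), R.bdd_u _, fun n _ hb =>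
  (R.mem_bicomm.1 hb _ fun μ m => by simpa [pairSign] using R.u_mul_u (.inl μ) (.inr a) m n).symm⟩

/-- The `q`-linear combinations of the `φ_a` and their time derivatives. -/
def jetFields : Submodule R.qFields R.cFields :=
  Submodule.span _ {ψ | ∃ a k, ψ = R.dtC^[k] (R.phi a)}

theorem dtC_iterate_mode (k : ℕ) (ψ : R.cFields) (n : ℤ) :
    (R.dtC^[k] ψ : Series F) n = (-Complex.I * n) ^ k • (ψ : Series F) n := by
  induction k with
  | zero => simp
  | succ k ih =>
    rw [Function.iterate_succ_apply']
    change (-Complex.I * n) • (R.dtC^[k] ψ : Series F) n = _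
    rw [ih, smul_smul, pow_succ']

theorem graded_smul {X : R.qFields} {ψ χ : R.cFields} {ε : ℂ}
    (h : ∀ m n, (χ : Series F) m * (ψ : Series F) n = ε • ((ψ : Series F) n * (χ : Series F) m))
    (m n : ℤ) : (χ : Series F) m * ((X • ψ : R.cFields) : Series F) n
      = ε • (((X • ψ : R.cFields) : Series F) n * (χ : Series F) m) := by
  have hs := hasSum_mul X.2 ψ.2 n
  refine (hs.end_mul_left _).unique (((hs.end_mul_right _).end_smul ε).congr_fun fun k => ?_)
  rw [← mul_assoc, ← comm_modes X.2 χ.2, mul_assoc, h, mul_smul_comm, mul_assoc]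

theorem graded_symm (hσ : σ * σ = 1) {a b : Module.End ℂ F} (h : a * b = σ • (b * a)) :
    b * a = σ • (a * b) := by rw [h, smul_smul, hσ, one_smul]

/-- Fields in `cFields` need not have exchange relations among themselves. On the span of the `φ`
and their derivatives the relations persist, because the coefficients are `q`-fields and commute
with everything in `cFields`. -/
theorem jetFields_graded (hσ : σ * σ = 1) {ψ χ : R.cFields} (hψ : ψ ∈ R.jetFields)
    (hχ : χ ∈ R.jetFields) (m n : ℤ) :
    (ψ : Series F) m * (χ : Series F) n = σ • ((χ : Series F) n * (ψ : Series F) m) := by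
  induction hψ, hχ using Submodule.span_induction₂ generalizing m n with
  | mem_mem x y hx hy =>
    obtain ⟨a, k, rfl⟩ := hx
    obtain ⟨b, l, rfl⟩ := hy
    have h : (R.phi a : Series F) m * (R.phi b : Series F) n
      = σ • ((R.phi b : Series F) n * (R.phi a : Series F) m) := R.u_mul_u (.inr a) (.inr b) m n
    rw [dtC_iterate_mode, dtC_iterate_mode, smul_mul_smul_comm, h, smul_mul_smul_comm,
      smul_comm σ, mul_comm (_ ^ k)]
  | zero_left y _ => simp
  | zero_right x _ => simp
  | add_left x y z _ _ _ hx hy => simp only [Submodule.coe_add, Pi.add_apply, add_mul, mul_add, hx, hy, smul_add]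
  | add_right x y z _ _ _ hx hy => simp only [Submodule.coe_add, Pi.add_apply, add_mul, mul_add, hx, hy, smul_add]
  | smul_left r x y _ _ h =>
    exact graded_symm hσ (R.graded_smul (fun m n => graded_symm hσ (h n m)) n m)
  | smul_right r x y _ _ h => exact R.graded_smul h m n

theorem dtC_mem_jetFields {ψ : R.cFields} (hψ : ψ ∈ R.jetFields) : R.dtC ψ ∈ R.jetFields := by
  induction hψ using Submodule.span_induction with
  | mem x hx =>
    obtain ⟨a, k, rfl⟩ := hx
    exact Submodule.subset_span ⟨a, k + 1, by rw [Function.iterate_succ_apply']⟩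
  | zero => rw [map_zero]; exact R.jetFields.zero_mem
  | add x y _ _ hx hy => rw [map_add]; exact R.jetFields.add_mem hx hy
  | smul c x hx h =>
    rw [dtC_smul]
    exact R.jetFields.add_mem (R.jetFields.smul_mem _ hx) (R.jetFields.smul_mem _ h)

theorem phi_mem (a : A) : R.phi a ∈ R.jetFields := Submodule.subset_span ⟨a, 0, rfl⟩

theorem locHom_C_T_mul (m : ℤ) (Q : Loc N) (n : ℤ) :
    (R.locHom (MvPolynomial.C (T (-m)) * Q) : Series F) n = (R.locHom Q : Series F) (n - m) := by
  rw [map_mul, locHom_C, trigHom_T, expField_mul_apply, sub_eq_add_neg]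

/-- A unit change of the mode `q̂^ν(m)` changes `q^ν(t)` by `e^{-imt}`; `lie_locHom` extends this to
all densities. -/
theorem lie_P_locHom (ν : Fin N) (m : ℤ) (Q : Loc N) (n : ℤ) :
    R.P (.inl ν, m) * (R.locHom Q : Series F) n - (R.locHom Q : Series F) n * R.P (.inl ν, m)
      = (R.locHom (modeDeriv ν m Q) : Series F) n := by
  refine R.lie_locHom (d := fun μ => if μ = ν then MvPolynomial.C (T (-m)) else 0) ?_ Q n
  intro μ n
  rw [R.P_mul_u]
  simp only [pairSign, one_smul, add_sub_cancel_left]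
  by_cases h : μ = ν
  · subst h
    rw [if_pos rfl, locHom_C, trigHom_T]
    simp only [expField, Prod.mk.injEq, true_and]
    by_cases h2 : m = n
    · subst h2; simp
    · rw [if_neg h2, if_neg (by omega), zero_smul]
  · rw [if_neg (by simpa using fun h' => absurd h'.symm h), if_neg h, zero_smul, map_zero]
    rfl

theorem lie_trigHom (U : Module.End ℂ F) (f : Trig) (n : ℤ) :
    U * (R.trigHom f : Series F) n - (R.trigHom f : Series F) n * U = ((0 : R.qFields) : Series F) n := by
  rw [trigHom_apply_mode]; simp

theorem P_mul_locHom (b : A) (m : ℤ) (Q : R.qFields) (n : ℤ) :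
    R.P (.inr b, m) * (Q : Series F) n = (Q : Series F) n * R.P (.inr b, m) :=
  R.mem_bicomm.1 (Q.2.2 n) _ fun μ k => by
    have := R.P_mul_u (.inr b, m) (.inl μ) k
    rw [this]
    simp [pairSign]

/-- The contraction with the mode `m` of `ψ` selects the single term `k = n - m` of the product
series. -/
theorem P_mul_smul {b : A} {m : ℤ} {ψ : R.cFields} {c : ℂ}
    (h : ∀ n, R.P (.inr b, m) * (ψ : Series F) n = σ • ((ψ : Series F) n * R.P (.inr b, m))
      + (if n = m then c else 0) • 1) (Q : R.qFields) (n : ℤ) :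
    R.P (.inr b, m) * ((Q • ψ : R.cFields) : Series F) n
      = σ • (((Q • ψ : R.cFields) : Series F) n * R.P (.inr b, m)) + c • (Q : Series F) (n - m) := by
  have hs := hasSum_mul Q.2 ψ.2 n
  have h1 : HasSum (fun k => (if n - k = m then c else 0) • (Q : Series F) k)
      (c • (Q : Series F) (n - m)) := by
    have : c • (Q : Series F) (n - m)
        = (if n - (n - m) = m then c else 0) • (Q : Series F) (n - m) := by simp
    rw [this]
    exact hasSum_single _ fun k hk => by rw [if_neg (by omega), zero_smul]
  refine (hs.end_mul_left _).unique ((((hs.end_mul_right _).end_smul σ).add h1).congr_fun fun k => ?_)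
  rw [← mul_assoc, P_mul_locHom, mul_assoc, h, mul_add, mul_smul_comm, mul_smul_comm, mul_one,
    mul_assoc]

theorem P_mul_phi [DecidableEq A] (a b : A) (m n : ℤ) :
    R.P (.inr b, m) * (R.phi a : Series F) n = σ • ((R.phi a : Series F) n * R.P (.inr b, m))
      + (if n = m then (if a = b then 1 else 0 : ℂ) else 0) • 1 := by
  have := R.P_mul_u (.inr b, m) (.inr a) n
  refine this.trans ?_
  congr 2
  simp only [Prod.mk.injEq, Sum.inr.injEq]
  by_cases h1 : a = b <;> by_cases h2 : n = m <;>
    simp [h1, h2, eq_comm (a := b), eq_comm (a := m)]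

theorem P_mul_dtC_phi [DecidableEq A] (a b : A) (m n : ℤ) :
    R.P (.inr b, m) * (R.dtC (R.phi a) : Series F) n
      = σ • ((R.dtC (R.phi a) : Series F) n * R.P (.inr b, m))
      + (if n = m then (if a = b then -Complex.I * m else 0 : ℂ) else 0) • 1 := by
  change R.P (.inr b, m) * ((-Complex.I * n) • (R.phi a : Series F) n)
    = σ • ((-Complex.I * n) • (R.phi a : Series F) n * R.P (.inr b, m)) + _
  rw [mul_smul_comm, P_mul_phi, smul_mul_assoc, smul_add, smul_comm σ, smul_smul _ _ (1 : Module.End ℂ F)]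
  congr 2
  split_ifs with h1 h2
  · rw [h1, mul_one]
  · rw [mul_zero]
  · rw [mul_zero]

/-! ### The variation of `(q, φ)` as a vector field on the space of modes. -/

section
variable [Fintype A] [DecidableEq A]

/-- The matrix of densities `M(q(t)) + g(t)`. -/
def _root_.DRO.jetMat (M : A → A → Fun N) (g : Trig) (a b : A) : Loc N :=
  atQ (M a b) + if a = b then MvPolynomial.C g else 0

/-- The field `∑ M_a^b φ_b - f dφ_a/dt`. -/
def jetVar (f : Trig) (M : A → A → Loc N) (a : A) : R.cFields :=
  ∑ b, R.locHom (M a b) • R.phi b - R.trigHom f • R.dtC (R.phi a)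

omit [DecidableEq A] in
theorem jetVar_mem (f : Trig) (M : A → A → Loc N) (a : A) : R.jetVar f M a ∈ R.jetFields :=
  R.jetFields.sub_mem (R.jetFields.sum_mem fun b _ => R.jetFields.smul_mem _ (R.phi_mem b))
    (R.jetFields.smul_mem _ (R.dtC_mem_jetFields (R.phi_mem a)))

/-- The variation of the fields `u = (q, φ)`. -/
def var (x : Diff N × Diff1) (M : A → A → Loc N) : Fin N ⊕ A → Series F
  | .inl μ => R.locHom (deltaQ x μ)
  | .inr a => R.jetVar (fcoef x.2) M a

/-- The derivatives of the variation: the `q`-dependent part. -/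
def derivZero (x : Diff N × Diff1) (M : A → A → Fun N) (g : Trig) : Fin N ⊕ A → Fin N ⊕ A → R.cFields
  | .inl ν, .inl μ => ⟨_, R.qFields_le (R.locHom (atQ (pderiv ν (comp x.1 μ)))).2⟩
  | .inr b, .inr a => ⟨_, R.qFields_le (R.locHom (jetMat M g a b)).2⟩
  | .inl ν, .inr a => ∑ b, R.locHom (atQ (pderiv ν (M a b))) • R.phi b
  | .inr _, .inl _ => 0

/-- The derivatives of the variation: the part linear in frequency. -/
def derivOne (f : Trig) (I J : Fin N ⊕ A) : R.cFields :=
  if I = J then ⟨_, R.qFields_le (R.trigHom (Complex.I • f)).2⟩ else 0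

/-- The derivative of the mode `j` of the variation with respect to the mode `i`. -/
def varDeriv (x : Diff N × Diff1) (M : A → A → Fun N) (g : Trig)
    (i j : (Fin N ⊕ A) × ℤ) : Module.End ℂ F :=
  (R.derivZero x M g i.1 j.1 : Series F) (j.2 - i.2)
    + (i.2 : ℂ) • (R.derivOne (fcoef x.2) i.1 j.1 : Series F) (j.2 - i.2)

theorem bddDeg_varDeriv (x : Diff N × Diff1) (M : A → A → Fun N) (g : Trig) :
    BddDeg (fun k : ((Fin N ⊕ A) × ℤ) × ((Fin N ⊕ A) × ℤ) => k.2.2 - k.1.2)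
      fun k => R.varDeriv x M g k.1 k.2 := fun v => by
  obtain ⟨a, ha⟩ := bddDeg_of_bdd
    (X := fun k : (Fin N ⊕ A) × (Fin N ⊕ A) => (R.derivZero x M g k.1 k.2 : Series F))
    (fun k => (R.derivZero x M g k.1 k.2).2.1) v
  obtain ⟨b, hb⟩ := bddDeg_of_bdd
    (X := fun k : (Fin N ⊕ A) × (Fin N ⊕ A) => (R.derivOne (fcoef x.2) k.1 k.2 : Series F))
    (fun k => (R.derivOne _ k.1 k.2).2.1) v
  refine ⟨min a b, fun ⟨i, j⟩ hk => ?_⟩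
  dsimp only at hk ha hb
  change R.varDeriv x M g i j v = 0
  rw [varDeriv, LinearMap.add_apply, LinearMap.smul_apply,
    ha ((i.1, j.1), j.2 - i.2) (by dsimp only; omega),
    hb ((i.1, j.1), j.2 - i.2) (by dsimp only; omega), smul_zero, add_zero]

/-- Contracting with a momentum differentiates with respect to the mode `m`. The factor `e^{-imt}`
makes the result depend on `n - m`, and a time derivative on the contracted field yields a further
factor `-i m`. Hence every block is affine in `m`. -/
theorem isVectorField_var (x : Diff N × Diff1) (M : A → A → Fun N) (g : Trig) :
    R.IsVectorField (R.var x (jetMat M g)) (R.varDeriv x M g) where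
  bdd I := by
    rcases I with μ | a
    · exact (R.locHom _).2.1
    · exact (R.jetVar _ _ a).2.1
  bdd_deriv := R.bddDeg_varDeriv x M g
  P_mul := by
    rintro ⟨ν | b, m⟩ ⟨μ | a, n⟩
    · have h := R.lie_P_locHom ν m (deltaQ x μ) n
      have e : modeDeriv ν m (deltaQ x μ) = MvPolynomial.C (T (-m)) * (atQ (pderiv ν (comp x.1 μ))
          - (-(Complex.I * m)) • if μ = ν then MvPolynomial.C (fcoef x.2) else 0) := by
        rw [deltaQ, map_sub, modeDeriv_C_mul_X, modeDeriv_atQ, ← mul_sub]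
      rw [e, locHom_C_T_mul] at h
      rw [← sub_eq_iff_eq_add']
      simp only [pairSign, one_smul, var]
      rw [h, map_sub, varDeriv, derivZero, derivOne, locHom_smul, Submodule.coe_sub,
        Pi.sub_apply, Submodule.coe_smul, Pi.smul_apply, neg_smul, sub_neg_eq_add]
      congr 1
      by_cases hμ : μ = ν
      · subst hμ
        simp only [if_true, locHom_C]
        rw [map_smul, Submodule.coe_smul, Pi.smul_apply, smul_smul, mul_comm]
      · rw [if_neg hμ, if_neg (by simpa using fun h' => hμ h'.symm), map_zero]
        simp
    -- In the variation of `φ`, only the coefficient matrix depends on `q`, and the function `g`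
    -- added to its diagonal does not.
    · have h1 : ∀ b n, R.P (.inl ν, m) * (R.phi b : Series F) n
          - (R.phi b : Series F) n * R.P (.inl ν, m) = ((0 : R.cFields) : Series F) n := by
        intro b n
        have := R.P_mul_u (.inl ν, m) (.inr b) n
        rw [sub_eq_iff_eq_add]
        refine this.trans ?_
        simp [pairSign]; rfl
      have h1' : ∀ n, R.P (.inl ν, m) * (R.dtC (R.phi a) : Series F) n
          - (R.dtC (R.phi a) : Series F) n * R.P (.inl ν, m) = ((0 : R.cFields) : Series F) n := by
        intro n
        change _ * ((-Complex.I * n) • (R.phi a : Series F) n)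
          - ((-Complex.I * n) • (R.phi a : Series F) n) * _ = _
        rw [mul_smul_comm, smul_mul_assoc, ← smul_sub, h1]
        exact smul_zero _
      have h2 : ∀ b n, R.P (.inl ν, m) * (R.locHom (jetMat M g a b) : Series F) n
          - (R.locHom (jetMat M g a b) : Series F) n * R.P (.inl ν, m)
          = ((R.expField (-m) * R.locHom (atQ (pderiv ν (M a b))) : R.qFields) : Series F) n := by
        intro b n
        have h3 : modeDeriv ν m (if a = b then MvPolynomial.C g else 0 : Loc N) = 0 := by
          split_ifs
          · exact Derivation.map_algebraMap _ g
          · exact map_zero _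
        rw [lie_P_locHom, jetMat, map_add, h3, add_zero, modeDeriv_atQ, map_mul, locHom_C, trigHom_T]
      rw [← sub_eq_iff_eq_add']
      simp only [pairSign, one_smul, var, jetVar, varDeriv, derivZero, derivOne, reduceCtorEq, if_false]
      rw [Submodule.coe_sub, Submodule.coe_sum, Pi.sub_apply, Finset.sum_apply, mul_sub, sub_mul,
        Finset.mul_sum, Finset.sum_mul, sub_sub_sub_comm, ← Finset.sum_sub_distrib,
        R.lie_smul_modes (R.lie_trigHom _ _) h1',
        Finset.sum_congr rfl fun b _ => R.lie_smul_modes (h2 b) (h1 b) n]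
      simp only [smul_zero, zero_smul, add_zero, mul_smul, expField_smul_apply, Submodule.coe_sum,
        Finset.sum_apply, sub_eq_add_neg n m]
      simp
    · simp only [pairSign, one_smul, var, varDeriv, derivZero, derivOne, reduceCtorEq, if_false]
      rw [P_mul_locHom]
      simp
    · simp only [pairSign, var, jetVar, varDeriv, derivZero, derivOne, Sum.inr.injEq]
      rw [Submodule.coe_sub, Submodule.coe_sum, Pi.sub_apply, Finset.sum_apply, mul_sub, sub_mul,
        Finset.mul_sum, Finset.sum_mul, smul_sub, Finset.smul_sum,
        R.P_mul_smul (R.P_mul_dtC_phi a b m),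
        Finset.sum_congr rfl fun b' _ => R.P_mul_smul (R.P_mul_phi b' b m) _ n,
        Finset.sum_add_distrib]
      simp only [ite_smul, one_smul, zero_smul, Finset.sum_ite_eq', Finset.mem_univ, if_true]
      rw [add_sub_add_comm]
      congr 1
      rw [sub_eq_add_neg]
      congr 1
      by_cases h : a = b
      · subst h
        simp only [if_true]
        rw [map_smul, Submodule.coe_smul, Pi.smul_apply, smul_smul, ← neg_smul]
        congr 1; ring
      · rw [if_neg h, if_neg (Ne.symm h)]
        simp

theorem compatible_var (hσ : σ * σ = 1) (x y : Diff N × Diff1) (M M' : A → A → Fun N) (g g' : Trig) :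
    Compatible σ (R.var x (jetMat M g)) (R.var y (jetMat M' g')) (R.varDeriv y M' g') where
  comm := by
    rintro ⟨μ | a, n⟩ ⟨ν | b, m⟩ <;> simp only [pairSign, one_smul, var]
    · exact comm_modes (R.locHom _).2 (R.qFields_le (R.locHom _).2) _ _
    · exact comm_modes (R.locHom _).2 (R.jetVar _ _ _).2 _ _
    · exact (comm_modes (R.locHom _).2 (R.jetVar _ _ _).2 _ _).symm
    · exact R.jetFields_graded hσ (R.jetVar_mem _ _ _) (R.jetVar_mem _ _ _) _ _
  comm_deriv := by
    rintro ⟨μ | a, n⟩ ⟨ν | b, m⟩ <;>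
      simp only [pairSign, one_smul, var, varDeriv, mul_one, hσ]
    · rw [mul_add, add_mul, mul_smul_comm, smul_mul_assoc,
        comm_modes (R.locHom _).2 (R.derivZero _ _ _ _ _).2,
        comm_modes (R.locHom _).2 (R.derivOne _ _ _).2]
    · rw [mul_add, add_mul, mul_smul_comm, smul_mul_assoc,
        comm_modes (R.locHom _).2 (R.derivZero _ _ _ _ _).2,
        comm_modes (R.locHom _).2 (R.derivOne _ _ _).2]
    -- The variation of `q` does not involve `φ`, so this block is zero and the sign required of it
    -- is immaterial.
    · simp [derivZero, derivOne]
    · simp only [derivZero, derivOne]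
      rw [mul_add, add_mul, mul_smul_comm, smul_mul_assoc]
      congr 1
      · exact (comm_modes (R.locHom _).2 (R.jetVar _ _ _).2 _ _).symm
      · split_ifs
        · rw [comm_modes (R.trigHom _).2 (R.jetVar _ _ _).2]
        · simp

end

end ModeRep

/-! ### The anomaly as a local functional -/

/-- The density of the one-loop anomaly of first-order operators `a + b d/dt` and
`a' + b' d/dt`, up to a constant factor. -/
def loopDensity {N : ℕ} (a b a' b' : Loc N) : Loc N :=
  Complex.I • (totalD N a * a')
    + (1 / 2 : ℂ) • ((totalD N (totalD N b) - Complex.I • totalD N b) * a')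
    - (1 / 2 : ℂ) • ((totalD N (totalD N a) + Complex.I • totalD N a) * b')
    + (Complex.I / 6) • ((totalD N (totalD N (totalD N b)) + totalD N b) * b')

theorem sum_range_cast (n : ℕ) : ∑ k ∈ Finset.range n, (k : ℂ) = n * (n - 1) / 2 := by
  induction n with
  | zero => simp
  | succ n ih => rw [Finset.sum_range_succ, ih]; push_cast; ring

theorem sum_range_cast_sq (n : ℕ) :
    ∑ k ∈ Finset.range n, (k : ℂ) ^ 2 = n * (n - 1) * (2 * n - 1) / 6 := by
  induction n with
  | zero => simp
  | succ n ih => rw [Finset.sum_range_succ, ih]; push_cast; ring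

/-- The difference of the indicators of negative frequency. -/
def cutDiff (n m : ℤ) : ℂ := (if n < 0 then 1 else 0) - (if m < 0 then 1 else 0)

section
variable {F : Type*} [AddCommGroup F] [Module ℂ F]

/-- The weight is nonzero only if `m` and `m + r` lie on opposite sides of zero, which happens for
`|r|` values of `m`. Power sums up to degree two then give polynomials in `r` of degree at most
three, the same for both signs of `r`. -/
theorem hasSum_cutDiff (r : ℤ) (X₀ X₁ X₂ X₃ : Module.End ℂ F) :
    HasSum (fun m : ℤ => cutDiff (m + r) m •
        (X₀ + (m : ℂ) • X₁ + ((m + r : ℤ) : ℂ) • X₂ + ((m : ℂ) * ((m + r : ℤ) : ℂ)) • X₃))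
      (-((r : ℂ) • X₀ - ((r : ℂ) * (r + 1) / 2) • X₁ + ((r : ℂ) * (r - 1) / 2) • X₂
        - (((r : ℂ) ^ 3 - r) / 6) • X₃)) := by
  obtain ⟨R, rfl | rfl⟩ := Int.eq_nat_or_neg r
  · have hinj : Function.Injective fun k : ℕ => -((k : ℤ) + 1) := fun a b h => by
      simp only [neg_inj, add_left_inj, Nat.cast_inj] at h; exact h
    have h := hasSum_sum_of_ne_finset_zero (L := .unconditional ℤ) (s := (Finset.range R).map ⟨_, hinj⟩)
      (f := fun m : ℤ => cutDiff (m + (R : ℤ)) m •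
        (X₀ + (m : ℂ) • X₁ + ((m + R : ℤ) : ℂ) • X₂ + ((m : ℂ) * ((m + R : ℤ) : ℂ)) • X₃)) ?_
    · convert h using 1
      rw [Finset.sum_map]
      have e : ∀ k ∈ Finset.range R, cutDiff (-((k : ℤ) + 1) + (R : ℤ)) (-((k : ℤ) + 1)) = -1 := by
        intro k hk
        have := Finset.mem_range.1 hk
        rw [cutDiff, if_neg (by omega), if_pos (by omega)]; ring
      simp only [Function.Embedding.coeFn_mk]
      rw [Finset.sum_congr rfl fun k hk => by rw [e k hk]]
      simp only [smul_add, Finset.sum_add_distrib, smul_smul, ← Finset.sum_smul]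
      have s0 : ∑ k ∈ Finset.range R, (-1 : ℂ) = -R := by simp
      have s1 : ∑ k ∈ Finset.range R, (-1 : ℂ) * ((-((k : ℤ) + 1) : ℤ) : ℂ) = R * (R + 1) / 2 := by
        push_cast
        rw [Finset.sum_congr rfl fun (k : ℕ) _ => show (-1 : ℂ) * -((k : ℂ) + 1) = k + 1 by ring,
          Finset.sum_add_distrib, sum_range_cast]
        simp; ring
      have s2 : ∑ k ∈ Finset.range R, (-1 : ℂ) * ((-((k : ℤ) + 1) + R : ℤ) : ℂ)
          = -(R * (R - 1) / 2) := by
        push_cast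
        rw [Finset.sum_congr rfl fun (k : ℕ) _ => show (-1 : ℂ) * (-((k : ℂ) + 1) + R) = k + (1 - R) by ring,
          Finset.sum_add_distrib, sum_range_cast]
        simp; ring
      have s3 : ∑ k ∈ Finset.range R,
          (-1 : ℂ) * (((-((k : ℤ) + 1) : ℤ) : ℂ) * ((-((k : ℤ) + 1) + R : ℤ) : ℂ))
          = ((R : ℂ) ^ 3 - R) / 6 := by
        push_cast
        rw [Finset.sum_congr rfl fun (k : ℕ) _ => show
          (-1 : ℂ) * (-((k : ℂ) + 1) * (-((k : ℂ) + 1) + R)) = -(k : ℂ) ^ 2 + (k * (R - 2) + (R - 1)) by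
            ring, Finset.sum_add_distrib, Finset.sum_add_distrib, Finset.sum_neg_distrib,
          sum_range_cast_sq, ← Finset.sum_mul, sum_range_cast]
        simp; ring
      simp only [Int.cast_natCast]
      rw [s0, s1, s2, s3]
      module
    · intro m hm
      have : ¬ (-(R : ℤ) ≤ m ∧ m < 0) := fun hm' => hm (Finset.mem_map.2
        ⟨(-m - 1).toNat, Finset.mem_range.2 (by omega), by
          simp only [Function.Embedding.coeFn_mk]; omega⟩)
      rw [cutDiff]
      split_ifs <;> first | omega | simp
  · have hinj : Function.Injective fun k : ℕ => (k : ℤ) := fun a b h => by simpa using h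
    have h := hasSum_sum_of_ne_finset_zero (L := .unconditional ℤ) (s := (Finset.range R).map ⟨_, hinj⟩)
      (f := fun m : ℤ => cutDiff (m + -(R : ℤ)) m •
        (X₀ + (m : ℂ) • X₁ + ((m + -R : ℤ) : ℂ) • X₂ + ((m : ℂ) * ((m + -R : ℤ) : ℂ)) • X₃)) ?_
    · convert h using 1
      rw [Finset.sum_map]
      have e : ∀ k ∈ Finset.range R, cutDiff ((k : ℤ) + -(R : ℤ)) k = 1 := by
        intro k hk
        have := Finset.mem_range.1 hk
        rw [cutDiff, if_pos (by omega), if_neg (by omega)]; ring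
      simp only [Function.Embedding.coeFn_mk]
      rw [Finset.sum_congr rfl fun k hk => by rw [e k hk]]
      simp only [one_smul, Finset.sum_add_distrib, ← Finset.sum_smul]
      have s1 : ∑ k ∈ Finset.range R, (((k : ℤ) : ℤ) : ℂ) = R * (R - 1) / 2 := by
        push_cast; exact sum_range_cast R
      have s2 : ∑ k ∈ Finset.range R, (((k : ℤ) + -R : ℤ) : ℂ)
          = -(R * (R + 1) / 2) := by
        push_cast
        rw [Finset.sum_add_distrib, sum_range_cast]
        simp; ring
      have s3 : ∑ k ∈ Finset.range R,
          ((((k : ℤ) : ℤ) : ℂ) * (((k : ℤ) + -R : ℤ) : ℂ))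
          = -(((R : ℂ) ^ 3 - R) / 6) := by
        push_cast
        rw [Finset.sum_congr rfl fun (k : ℕ) _ => show
          (k : ℂ) * ((k : ℂ) + -R) = (k : ℂ) ^ 2 + (k * (-R)) by
            ring, Finset.sum_add_distrib,
          sum_range_cast_sq, ← Finset.sum_mul, sum_range_cast]
        ring
      rw [s1, s2, s3, Finset.sum_const, Finset.card_range, ← Nat.cast_smul_eq_nsmul ℂ]
      push_cast
      module
    · intro m hm
      have : ¬ (0 ≤ m ∧ m < R) := fun hm' => hm (Finset.mem_map.2
        ⟨m.toNat, Finset.mem_range.2 (by omega), by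
          simp only [Function.Embedding.coeFn_mk]; omega⟩)
      rw [cutDiff]
      split_ifs <;> first | omega | simp

theorem mul_neg_apply_eq_zero {X Y : Series F} (hc : ∀ m n, X m * Y n = Y n * X m) {v : F} {M : ℤ}
    (hX : ∀ n < M, X n v = 0) (hY : ∀ n < M, Y n v = 0) {r : ℤ} (hr : r < M ∨ -r < M) :
    (X r * Y (-r)) v = 0 := by
  rcases hr with hr | hr
  · rw [hc, Module.End.mul_apply, hX r hr, map_zero]
  · rw [Module.End.mul_apply, hY _ hr, map_zero]

/-- On a given vector `r` is bounded on both sides, since the factors of frequencies `r` and `-r`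
commute and either one may act first. For bounded `r` the weight confines `m` to a finite range. -/
theorem locFin_loop {X Y X' Y' : Series F} (hX : X.Bdd) (hY : Y.Bdd) (hX' : X'.Bdd) (hY' : Y'.Bdd)
    (h₁ : ∀ m n, X m * X' n = X' n * X m) (h₂ : ∀ m n, X m * Y' n = Y' n * X m)
    (h₃ : ∀ m n, Y m * X' n = X' n * Y m) (h₄ : ∀ m n, Y m * Y' n = Y' n * Y m) :
    LocFin fun x : ℤ × ℤ => cutDiff (x.2 + x.1) x.2 •
      (X x.1 * X' (-x.1) + (x.2 : ℂ) • (Y x.1 * X' (-x.1))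
      + ((x.2 + x.1 : ℤ) : ℂ) • (X x.1 * Y' (-x.1))
      + ((x.2 : ℂ) * ((x.2 + x.1 : ℤ) : ℂ)) • (Y x.1 * Y' (-x.1))) := by
  refine LocFin.of_subset fun v => ?_
  obtain ⟨M₁, b₁⟩ := hX v
  obtain ⟨M₂, b₂⟩ := hY v
  obtain ⟨M₃, b₃⟩ := hX' v
  obtain ⟨M₄, b₄⟩ := hY' v
  obtain ⟨M, l₁, l₂, l₃, l₄, l₅⟩ : ∃ M : ℤ, M ≤ M₁ ∧ M ≤ M₂ ∧ M ≤ M₃ ∧ M ≤ M₄ ∧ M ≤ 0 :=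
    ⟨min M₁ (min M₂ (min M₃ (min M₄ 0))), by omega, by omega, by omega, by omega, by omega⟩
  refine ⟨Set.Icc M (-M) ×ˢ Set.Icc M (-M), (Set.finite_Icc _ _).prod (Set.finite_Icc _ _),
    fun ⟨r, m⟩ h => ?_⟩
  simp only [Set.mem_prod, Set.mem_Icc, not_and_or, not_le] at h
  dsimp only
  by_cases hr : r < M ∨ -r < M
  · simp only [LinearMap.smul_apply, LinearMap.add_apply]
    rw [mul_neg_apply_eq_zero h₁ (fun n hn => b₁ n (by omega)) (fun n hn => b₃ n (by omega)) hr,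
      mul_neg_apply_eq_zero h₃ (fun n hn => b₂ n (by omega)) (fun n hn => b₃ n (by omega)) hr,
      mul_neg_apply_eq_zero h₂ (fun n hn => b₁ n (by omega)) (fun n hn => b₄ n (by omega)) hr,
      mul_neg_apply_eq_zero h₄ (fun n hn => b₂ n (by omega)) (fun n hn => b₄ n (by omega)) hr]
    simp
  · have : cutDiff (m + r) m = 0 := by
      rw [cutDiff]; split_ifs <;> first | omega | simp
    rw [this, zero_smul, LinearMap.zero_apply]

/-- In the variables `r = n - m` and `m`, the operators depend on `r` only; the sum over `m` is
`hasSum_cutDiff`. -/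
theorem hasSum_loop_aux {X Y X' Y' : Series F} (hX : X.Bdd) (hY : Y.Bdd) (hX' : X'.Bdd) (hY' : Y'.Bdd)
    (h₁ : ∀ m n, X m * X' n = X' n * X m) (h₂ : ∀ m n, X m * Y' n = Y' n * X m)
    (h₃ : ∀ m n, Y m * X' n = X' n * Y m) (h₄ : ∀ m n, Y m * Y' n = Y' n * Y m)
    {S : Module.End ℂ F}
    (hS : HasSum (fun r : ℤ => (r : ℂ) • (X r * X' (-r)) - ((r : ℂ) * (r + 1) / 2) • (Y r * X' (-r))
        + ((r : ℂ) * (r - 1) / 2) • (X r * Y' (-r)) - (((r : ℂ) ^ 3 - r) / 6) • (Y r * Y' (-r))) S) :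
    HasSum (fun x : ℤ × ℤ => cutDiff x.1 x.2 •
        ((X (x.1 - x.2) + (x.2 : ℂ) • Y (x.1 - x.2)) * (X' (x.2 - x.1) + (x.1 : ℂ) • Y' (x.2 - x.1))))
      (-S) := by
  let e : ℤ × ℤ ≃ ℤ × ℤ :=
    { toFun := fun x => (x.2 + x.1, x.2)
      invFun := fun x => (x.1 - x.2, x.2)
      left_inv := fun x => by simp
      right_inv := fun x => by simp }
  have hl := (locFin_loop hX hY hX' hY' h₁ h₂ h₃ h₄).hasSum
  have hr := hl.prod_fiberwise fun r => hasSum_cutDiff r (X r * X' (-r)) (Y r * X' (-r))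
    (X r * Y' (-r)) (Y r * Y' (-r))
  rw [hS.neg.unique hr, ← e.hasSum_iff]
  refine hl.congr_fun fun x => ?_
  have e1 : x.2 + x.1 - x.2 = x.1 := by ring
  have e2 : x.2 - (x.2 + x.1) = -x.1 := by ring
  change cutDiff (x.2 + x.1) x.2 • ((X (x.2 + x.1 - x.2) + (x.2 : ℂ) • Y (x.2 + x.1 - x.2))
    * (X' (x.2 - (x.2 + x.1)) + ((x.2 + x.1 : ℤ) : ℂ) • Y' (x.2 - (x.2 + x.1)))) = _
  rw [e1, e2, mul_add, add_mul, add_mul, smul_mul_assoc, mul_smul_comm, smul_mul_smul_comm, add_assoc,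
    add_assoc, add_assoc]

end

/-! ### Loop sums as zero modes of local densities. -/

namespace ModeRep

variable {N : ℕ} {A F : Type*} [AddCommGroup F] [Module ℂ F] {σ : ℂ} (R : ModeRep N A F σ)

theorem locHom_totalD_mode (P : Loc N) (r : ℤ) :
    (R.locHom (totalD N P) : Series F) r = (-Complex.I * r) • (R.locHom P : Series F) r := by
  rw [locHom_totalD]; rfl

theorem hasSum_locHom_mul (P Q : Loc N) :
    HasSum (fun r => (R.locHom P : Series F) r * (R.locHom Q : Series F) (-r))
      ((R.locHom (P * Q) : Series F) 0) := by
  rw [map_mul]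
  simpa [coe_mul] using hasSum_mul (R.locHom P).2 (R.qFields_le (R.locHom Q).2) 0

/-- Multiplication of the mode `r` by `-i r` is `d/dt`, so polynomials in `r` are differential
operators on the first factor. Summing products of modes `r` and `-r` gives the zero mode of the
product of the fields. -/
theorem hasSum_loopDensity (a b a' b' : Loc N) :
    HasSum (fun r : ℤ => (r : ℂ) • ((R.locHom a : Series F) r * (R.locHom a' : Series F) (-r))
        - ((r : ℂ) * (r + 1) / 2) • ((R.locHom b : Series F) r * (R.locHom a' : Series F) (-r))
        + ((r : ℂ) * (r - 1) / 2) • ((R.locHom a : Series F) r * (R.locHom b' : Series F) (-r))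
        - (((r : ℂ) ^ 3 - r) / 6) • ((R.locHom b : Series F) r * (R.locHom b' : Series F) (-r)))
      ((R.locHom (loopDensity a b a' b') : Series F) 0) := by
  have hI : Complex.I * Complex.I = -1 := Complex.I_mul_I
  have h1 := (R.hasSum_locHom_mul (totalD N a) a').end_smul Complex.I
  have h2 := (R.hasSum_locHom_mul (totalD N (totalD N b) - Complex.I • totalD N b) a').end_smul (1 / 2)
  have h3 := (R.hasSum_locHom_mul (totalD N (totalD N a) + Complex.I • totalD N a) b').end_smul (1 / 2)
  have h4 := (R.hasSum_locHom_mul (totalD N (totalD N (totalD N b)) + totalD N b) b').end_smul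
    (Complex.I / 6)
  have e : (R.locHom (loopDensity a b a' b') : Series F) 0
      = Complex.I • (R.locHom (totalD N a * a') : Series F) 0
        + (1 / 2 : ℂ) • (R.locHom ((totalD N (totalD N b) - Complex.I • totalD N b) * a') : Series F) 0
        - (1 / 2 : ℂ) • (R.locHom ((totalD N (totalD N a) + Complex.I • totalD N a) * b') : Series F) 0
        + (Complex.I / 6) • (R.locHom ((totalD N (totalD N (totalD N b)) + totalD N b) * b') : Series F) 0 := by
    rw [loopDensity, map_add, map_sub, map_add, locHom_smul, locHom_smul, locHom_smul, locHom_smul]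
    rfl
  rw [e]
  refine (((h1.add h2).sub h3).add h4).congr_fun fun r => ?_
  simp only [map_add, map_sub, locHom_smul, Submodule.coe_add, Submodule.coe_sub, Submodule.coe_smul,
    Pi.add_apply, Pi.sub_apply, Pi.smul_apply, locHom_totalD_mode, smul_smul, ← add_smul, ← sub_smul,
    smul_mul_assoc]
  generalize (R.locHom a : Series F) r * (R.locHom a' : Series F) (-r) = W₁
  generalize (R.locHom b : Series F) r * (R.locHom a' : Series F) (-r) = W₂
  generalize (R.locHom a : Series F) r * (R.locHom b' : Series F) (-r) = W₃
  generalize (R.locHom b : Series F) r * (R.locHom b' : Series F) (-r) = W₄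
  generalize (r : ℂ) = z
  match_scalars
  · linear_combination z * hI
  · linear_combination -(z ^ 2 + z) / 2 * hI
  · linear_combination (z ^ 2 - z) / 2 * hI
  · linear_combination (z ^ 3 / 6 * (Complex.I ^ 2 - 1) + z / 6) * hI

theorem hasSum_loop (a b a' b' : Loc N) :
    HasSum (fun x : ℤ × ℤ => cutDiff x.1 x.2 •
        (((R.locHom a : Series F) (x.1 - x.2) + (x.2 : ℂ) • (R.locHom b : Series F) (x.1 - x.2))
          * ((R.locHom a' : Series F) (x.2 - x.1) + (x.1 : ℂ) • (R.locHom b' : Series F) (x.2 - x.1))))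
      (-(R.locHom (loopDensity a b a' b') : Series F) 0) := by
  refine hasSum_loop_aux (R.locHom a).2.1 (R.locHom b).2.1 (R.locHom a').2.1 (R.locHom b').2.1 ?_ ?_ ?_ ?_
    (R.hasSum_loopDensity a b a' b') <;>
  · intro m n
    exact comm_modes (R.locHom _).2 (R.qFields_le (R.locHom _).2) m n

end ModeRep

/-! ### The commutator of the operators of two vector fields -/

section
variable {N : ℕ} {A : Type*} [DecidableEq A]

/-- The zeroth-order coefficients of the linearized vector field. -/
def linZero (x : Diff N × Diff1) (M : A → A → Fun N) (g : Trig) : Fin N ⊕ A → Fin N ⊕ A → Loc N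
  | .inl ν, .inl μ => atQ (pderiv ν (comp x.1 μ))
  | .inr b, .inr a => jetMat M g a b
  | _, _ => 0

/-- The first-order coefficients of the linearized vector field. -/
def linOne (f : Trig) (I J : Fin N ⊕ A) : Loc N :=
  if I = J then MvPolynomial.C (Complex.I • f) else 0

/-- The density of the total anomaly. -/
def anomalyDensity [Fintype A] (σ : ℂ) (x y : Diff N × Diff1) (M M' : A → A → Fun N) (g g' : Trig) : Loc N :=
  -∑ k : (Fin N ⊕ A) × (Fin N ⊕ A), pairSign σ k.1 k.1 •
    loopDensity (linZero x M g k.2 k.1) (linOne (fcoef x.2) k.2 k.1)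
      (linZero y M' g' k.1 k.2) (linOne (fcoef y.2) k.1 k.2)

end

namespace ModeRep

variable {N : ℕ} {A F : Type*} [AddCommGroup F] [Module ℂ F] {σ : ℂ} (R : ModeRep N A F σ)

theorem hasSum_normal_norm (hσ : σ * σ = 1) {X : Series F} (hX : X.Bdd) (I : Fin N ⊕ A) :
    HasSum (fun n : ℤ => R.normal (I, n) (X n))
      ((2 * Real.pi * pairSign σ I I : ℂ) • Series.norm (pairSign σ I I) (R.mom I) X 0) := by
  have h := ((Series.normExists_of_bdd (pairSign σ I I) (R.bdd_mom I) hX).hasSum 0).end_smul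
    (2 * Real.pi * pairSign σ I I : ℂ)
  rw [← (Equiv.neg ℤ).hasSum_iff] at h
  refine h.congr_fun fun n => ?_
  simp only [Function.comp, Equiv.neg_apply, Series.normTerm, normal, P, zero_sub, neg_neg]
  by_cases hn : n < 0
  · rw [if_pos hn, if_pos (by omega), smul_mul_assoc, smul_smul, mul_comm]
  · rw [if_neg hn, if_neg (by omega), mul_smul_comm, smul_smul, mul_assoc, pairSign_mul_self hσ,
      mul_one]

variable [Fintype A] [DecidableEq A]

/-- The operator of a vector field. -/
def op (X : Fin N ⊕ A → Series F) : Module.End ℂ F :=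
  ∑ I, (2 * Real.pi * pairSign σ I I : ℂ) • Series.norm (pairSign σ I I) (R.mom I) (X I) 0

omit [DecidableEq A] in
theorem hasSum_op (hσ : σ * σ = 1) {X : Fin N ⊕ A → Series F} (hX : ∀ I, (X I).Bdd) :
    HasSum (fun i : (Fin N ⊕ A) × ℤ => R.normal i (X i.1 i.2)) (R.op X) :=
  hasSum_prod_finite fun I => R.hasSum_normal_norm hσ (hX I) I

/-- A loop that passes between `q` and `φ` contains the derivative of the `q`-variation with respect
to `φ`, which is zero. This is why `linZero` may omit the nonzero derivative of the `φ`-variation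
with respect to `q`. In the diagonal blocks all entries are `q`-fields and commute. -/
theorem anomaly_varDeriv (x y : Diff N × Diff1) (M M' : A → A → Fun N) (g g' : Trig)
    (I J : Fin N ⊕ A) (n m : ℤ) :
    anomaly σ (R.varDeriv x M g) (R.varDeriv y M' g') (I, n) (J, m)
      = pairSign σ I I • (cutDiff n m •
        (((R.locHom (linZero x M g J I) : Series F) (n - m)
            + (m : ℂ) • (R.locHom (linOne (fcoef x.2) J I) : Series F) (n - m))
          * ((R.locHom (linZero y M' g' I J) : Series F) (m - n)
            + (n : ℂ) • (R.locHom (linOne (fcoef y.2) I J) : Series F) (m - n)))) := by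
  have key : ∀ (s : ℂ) (D E : Module.End ℂ F), E * D = D * E →
      (if n < 0 then (if m < 0 then 0 else s • (E * D)) else if m < 0 then -(s • (D * E)) else 0)
        = s • (cutDiff n m • (D * E)) := by
    intro s D E h
    rw [cutDiff]
    split_ifs <;> simp [h]
  have hone : ∀ (f : Trig) (I J : Fin N ⊕ A), (R.derivOne f I J : Series F)
      = R.locHom (linOne f I J) := by
    intro f I J
    rw [derivOne, linOne]
    split_ifs
    · rw [locHom_C]
    · rw [map_zero]; rfl
  have comm4 : ∀ (P Q P' Q' : Loc N) (k l : ℤ) (c d : ℂ),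
      ((R.locHom P : Series F) k + c • (R.locHom Q : Series F) k)
        * ((R.locHom P' : Series F) l + d • (R.locHom Q' : Series F) l)
      = ((R.locHom P' : Series F) l + d • (R.locHom Q' : Series F) l)
        * ((R.locHom P : Series F) k + c • (R.locHom Q : Series F) k) := fun P Q P' Q' k l c d =>
    R.bicomm_comm
      (R.bicomm.add_mem ((R.locHom P).2.2 k) (R.bicomm.smul_mem ((R.locHom Q).2.2 k) c))
      (R.bicomm.add_mem ((R.locHom P').2.2 l) (R.bicomm.smul_mem ((R.locHom Q').2.2 l) d))
  rcases I with μ | a <;> rcases J with ν | b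
  · simp only [anomaly, varDeriv, hone]
    exact key _ _ _ (comm4 _ _ _ _ _ _ _ _)
  · simp [anomaly, varDeriv, hone, derivZero, linZero, linOne]
  · simp [anomaly, varDeriv, hone, derivZero, linZero, linOne]
  · simp only [anomaly, varDeriv, hone]
    exact key _ _ _ (comm4 _ _ _ _ _ _ _ _)

theorem hasSum_anomalyDensity (x y : Diff N × Diff1) (M M' : A → A → Fun N)
    (g g' : Trig) :
    HasSum (fun k : ((Fin N ⊕ A) × ℤ) × ((Fin N ⊕ A) × ℤ) =>
        anomaly σ (R.varDeriv x M g) (R.varDeriv y M' g') k.1 k.2)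
      ((R.locHom (anomalyDensity σ x y M M' g g') : Series F) 0) := by
  have h := hasSum_prod_finite (u := fun k : ((Fin N ⊕ A) × (Fin N ⊕ A)) × (ℤ × ℤ) =>
      anomaly σ (R.varDeriv x M g) (R.varDeriv y M' g') (k.1.1, k.2.1) (k.1.2, k.2.2))
    fun k => ((R.hasSum_loop (linZero x M g k.2 k.1) (linOne (fcoef x.2) k.2 k.1)
      (linZero y M' g' k.1 k.2) (linOne (fcoef y.2) k.1 k.2)).end_smul (pairSign σ k.1 k.1)).congr_fun
      fun l => R.anomaly_varDeriv x y M M' g g' k.1 k.2 l.1 l.2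
  rw [← (Equiv.prodProdProdComm (Fin N ⊕ A) ℤ (Fin N ⊕ A) ℤ).hasSum_iff] at h
  have h' : HasSum (fun k : ((Fin N ⊕ A) × ℤ) × ((Fin N ⊕ A) × ℤ) =>
    anomaly σ (R.varDeriv x M g) (R.varDeriv y M' g') k.1 k.2) _ := h
  convert h' using 1
  rw [anomalyDensity, map_neg, map_sum, Submodule.coe_neg, Submodule.coe_sum, Pi.neg_apply,
    Finset.sum_apply, ← Finset.sum_neg_distrib]
  exact Finset.sum_congr rfl fun k _ => by
    rw [locHom_smul, Submodule.coe_smul, Pi.smul_apply, smul_neg]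

theorem lie_op_u (hσ : σ * σ = 1) (x : Diff N × Diff1) (M : A → A → Fun N) (g : Trig)
    (J : Fin N ⊕ A) (m : ℤ) :
    R.op (R.var x (jetMat M g)) * R.u J m - R.u J m * R.op (R.var x (jetMat M g))
      = R.var x (jetMat M g) J m := by
  classical
  -- The coordinates themselves have the components of a vector field, with the identity as
  -- derivative matrix, so `normal_lie` applies and a single term survives.
  have hu : R.IsVectorField R.u fun i j => (if i = j then (1 : ℂ) else 0) • 1 :=
    { bdd := R.bdd_u
      bdd_deriv := fun v => ⟨0, fun ⟨i, j⟩ hk => by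
        have : i ≠ j := fun h => by subst h; simp at hk
        simp [this]⟩
      P_mul := fun i j => by convert R.P_mul_u i j.1 j.2 }
  have hc : Compatible σ (R.var x (jetMat M g)) R.u fun i j => (if i = j then (1 : ℂ) else 0) • 1 :=
    { comm := by
        rintro ⟨μ | a, n⟩ ⟨ν | b, m⟩ <;> simp only [pairSign, one_smul, var]
        · exact R.bicomm_comm ((R.locHom _).2.2 _) (R.q_mem_bicomm _ _)
        · exact comm_modes (R.locHom _).2 (R.phi b).2 _ _
        · exact ((R.jetVar _ _ _).2.2 _ _ (R.q_mem_bicomm _ _)).symm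
        · exact R.jetFields_graded hσ (R.jetVar_mem _ _ _) (R.phi_mem b) _ _
      comm_deriv := fun i j => by
        by_cases h : i = j
        · subst h; simp [pairSign_mul_self hσ]
        · simp [h] }
  have hs := R.hasSum_op hσ (R.isVectorField_var x M g).bdd
  have h1 := ((hs.end_mul_right (R.u J m)).sub (hs.end_mul_left (R.u J m))).congr_fun
    (g := fun i => R.var x (jetMat M g) i.1 i.2 * ((if i = (J, m) then (1 : ℂ) else 0) • 1))
    fun i => (normal_lie hσ hu hc i (J, m)).symm
  have h2 : HasSum (fun i : (Fin N ⊕ A) × ℤ =>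
      R.var x (jetMat M g) i.1 i.2 * ((if i = (J, m) then (1 : ℂ) else 0) • (1 : Module.End ℂ F)))
      (R.var x (jetMat M g) J m) := by
    have : R.var x (jetMat M g) J m = R.var x (jetMat M g) (J, m).1 (J, m).2
        * ((if (J, m) = (J, m) then (1 : ℂ) else 0) • (1 : Module.End ℂ F)) := by simp
    rw [this]
    exact hasSum_single _ fun i hi => by simp [hi]
  exact h1.unique h2

theorem lie_op_locHom (hσ : σ * σ = 1) (x : Diff N × Diff1) (M : A → A → Fun N) (g : Trig)
    (Q : Loc N) (n : ℤ) :
    R.op (R.var x (jetMat M g)) * (R.locHom Q : Series F) n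
      - (R.locHom Q : Series F) n * R.op (R.var x (jetMat M g)) = (R.locHom (act x Q) : Series F) n :=
  R.lie_locHom (fun μ n => R.lie_op_u hσ x M g (.inl μ) n) Q n

theorem lie_op_phi (hσ : σ * σ = 1) (x : Diff N × Diff1) (M : A → A → Fun N) (g : Trig)
    (a : A) (n : ℤ) :
    R.op (R.var x (jetMat M g)) * (R.phi a : Series F) n
      - (R.phi a : Series F) n * R.op (R.var x (jetMat M g))
      = (R.jetVar (fcoef x.2) (jetMat M g) a : Series F) n :=
  R.lie_op_u hσ x M g (.inr a) n

theorem lie_op_jetVar (hσ : σ * σ = 1) (x y : Diff N × Diff1) (M M' : A → A → Fun N) (g g' : Trig)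
    (a : A) (n : ℤ) :
    R.op (R.var x (jetMat M g)) * (R.jetVar (fcoef y.2) (jetMat M' g') a : Series F) n
      - (R.jetVar (fcoef y.2) (jetMat M' g') a : Series F) n * R.op (R.var x (jetMat M g))
      = ((∑ b, (R.locHom (act x (jetMat M' g' a b)) • R.phi b
            + R.locHom (jetMat M' g' a b) • R.jetVar (fcoef x.2) (jetMat M g) b)
          - R.trigHom (fcoef y.2) • R.dtC (R.jetVar (fcoef x.2) (jetMat M g) a) : R.cFields) :
          Series F) n := by
  have h1 : ∀ n, R.op (R.var x (jetMat M g)) * (R.dtC (R.phi a) : Series F) n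
      - (R.dtC (R.phi a) : Series F) n * R.op (R.var x (jetMat M g))
      = (R.dtC (R.jetVar (fcoef x.2) (jetMat M g) a) : Series F) n := by
    intro n
    change _ * ((-Complex.I * n) • (R.phi a : Series F) n)
      - ((-Complex.I * n) • (R.phi a : Series F) n) * _
      = (-Complex.I * n) • (R.jetVar (fcoef x.2) (jetMat M g) a : Series F) n
    rw [mul_smul_comm, smul_mul_assoc, ← smul_sub, lie_op_phi R hσ]
  conv_lhs => rw [jetVar]
  rw [Submodule.coe_sub, Submodule.coe_sum, Pi.sub_apply, Finset.sum_apply, mul_sub, sub_mul,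
    Finset.mul_sum, Finset.sum_mul, sub_sub_sub_comm, ← Finset.sum_sub_distrib,
    R.lie_smul_modes (R.lie_trigHom _ _) h1,
    Finset.sum_congr rfl fun b _ => R.lie_smul_modes (R.lie_op_locHom hσ x M g (jetMat M' g' a b))
      (R.lie_op_phi hσ x M g b) n]
  simp only [zero_smul, zero_add, Submodule.coe_sub, Submodule.coe_sum, Pi.sub_apply, Finset.sum_apply]

omit [Fintype A] [DecidableEq A] in
theorem qFields_sub_smul (P Q : R.qFields) (ψ : R.cFields) : (P - Q) • ψ = P • ψ - Q • ψ :=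
  sub_smul P Q ψ

omit [DecidableEq A] in
theorem dtC_jetVar (f : Trig) (M : A → A → Loc N) (a : A) :
    R.dtC (R.jetVar f M a) = ∑ b, (R.locHom (totalD N (M a b)) • R.phi b
      + R.locHom (M a b) • R.dtC (R.phi b))
      - (R.trigHom (dt f) • R.dtC (R.phi a) + R.trigHom f • R.dtC (R.dtC (R.phi a))) := by
  simp only [jetVar, map_sub, map_sum, dtC_smul, locHom_totalD, dtQ_trigHom]

/-- The hypothesis `hM` is the closure condition for the `φ`-components. Given it, the classical
commutator is the variation of `⁅x, y⁆`, and the anomaly is the only correction. -/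
theorem op_comm (hσ : σ * σ = 1) (x y : Diff N × Diff1) (M M' M'' : A → A → Fun N)
    (g g' g'' : Trig)
    (hM : ∀ a b, jetMat M'' g'' a b = act x (jetMat M' g' a b) - act y (jetMat M g a b)
      + ∑ c, (jetMat M' g' a c * jetMat M g c b - jetMat M g a c * jetMat M' g' c b)
      + MvPolynomial.C (fcoef x.2) * totalD N (jetMat M' g' a b)
      - MvPolynomial.C (fcoef y.2) * totalD N (jetMat M g a b)) :
    R.op (R.var x (jetMat M g)) * R.op (R.var y (jetMat M' g'))
      - R.op (R.var y (jetMat M' g')) * R.op (R.var x (jetMat M g))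
      = R.op (R.var ⁅x, y⁆ (jetMat M'' g''))
        + (R.locHom (anomalyDensity σ x y M M' g g') : Series F) 0 := by
  have h := hasSum_anomaly hσ (R.isVectorField_var x M g) (R.isVectorField_var y M' g')
    (R.compatible_var hσ x y M M' g g') (R.compatible_var hσ y x M' M g' g)
    (R.hasSum_op hσ (R.isVectorField_var x M g).bdd) (R.hasSum_op hσ (R.isVectorField_var y M' g').bdd)
    (R.hasSum_op hσ (R.isVectorField_var ⁅x, y⁆ M'' g'').bdd) ?_
  · rw [← h.unique (R.hasSum_anomalyDensity x y M M' g g')]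
    abel
  · rintro (μ | a) n
    -- The `q`-components close because `act` is an action on local densities.
    · have e : deltaQ ⁅x, y⁆ μ = act x (deltaQ y μ) - act y (deltaQ x μ) := by
        have := act_lie x y (X (μ, 0))
        rwa [act_X_zero, act_X_zero, act_X_zero] at this
      simp only [var]
      rw [lie_op_locHom R hσ, lie_op_locHom R hσ, e, map_sub]
      rfl
    · simp only [var]
      rw [lie_op_jetVar R hσ, lie_op_jetVar R hσ, ← Pi.sub_apply, ← Submodule.coe_sub]
      rw [dtC_jetVar, dtC_jetVar, fcoefQ_lie]
      conv_lhs => rw [jetVar]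
      have e : ∑ b, R.locHom (jetMat M'' g'' a b) • R.phi b
          = ∑ b, R.locHom (act x (jetMat M' g' a b)) • R.phi b
            - ∑ b, R.locHom (act y (jetMat M g a b)) • R.phi b
            + (∑ b, R.locHom (jetMat M' g' a b) • ∑ c, R.locHom (jetMat M g b c) • R.phi c
              - ∑ b, R.locHom (jetMat M g a b) • ∑ c, R.locHom (jetMat M' g' b c) • R.phi c)
            + R.trigHom (fcoef x.2) • ∑ b, R.locHom (totalD N (jetMat M' g' a b)) • R.phi b
            - R.trigHom (fcoef y.2) • ∑ b, R.locHom (totalD N (jetMat M g a b)) • R.phi b := by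
        simp only [hM, map_add, map_sub, map_sum, map_mul, locHom_C, add_smul, qFields_sub_smul,
          Finset.sum_smul, mul_smul, Finset.sum_add_distrib, Finset.sum_sub_distrib, Finset.smul_sum]
        rw [Finset.sum_comm (f := fun b c => R.locHom (jetMat M' g' a c) • R.locHom (jetMat M g c b) • R.phi b),
          Finset.sum_comm (f := fun b c => R.locHom (jetMat M g a c) • R.locHom (jetMat M' g' c b) • R.phi b)]
      rw [e]
      simp only [jetVar, smul_sub, smul_add, Finset.sum_add_distrib, Finset.sum_sub_distrib, map_sub,
        map_mul, qFields_sub_smul, mul_smul, Finset.smul_sum]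
      simp only [smul_comm (R.trigHom _) (R.locHom _),
        smul_comm (R.trigHom (fcoef y.2)) (R.trigHom (fcoef x.2))]
      abel_nf

end ModeRep

/-! ### Multi-index derivatives -/

section
variable {N : ℕ}

theorem multiIdx_induction {P : (Fin N → ℕ) → Prop} (zero : P 0)
    (step : ∀ n μ, P n → P (n + Pi.single μ 1)) (n : Fin N → ℕ) : P n := by
  induction h : ∑ μ, n μ generalizing n with
  | zero =>
    have : n = 0 := by
      ext μ
      simpa using (Finset.sum_eq_zero_iff.1 h) μ (Finset.mem_univ μ)
    exact this ▸ zero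
  | succ k ih =>
    obtain ⟨μ, -, hμ⟩ : ∃ μ ∈ Finset.univ, n μ ≠ 0 := by
      by_contra! hc
      rw [Finset.sum_eq_zero hc] at h
      omega
    have e : n = (n - Pi.single μ 1) + Pi.single μ 1 := by
      ext ν
      by_cases hν : ν = μ
      · subst hν; simp; omega
      · simp [hν]
    rw [e]
    refine step _ _ (ih _ ?_)
    rw [e] at h
    simp only [Pi.add_apply, Finset.sum_add_distrib, Finset.sum_pi_single', Finset.mem_univ,
      if_true] at h
    omega

theorem pderiv_commute (μ ν : Fin N) :
    Commute ((pderiv μ : Diff N).toLinearMap : Module.End ℂ (Fun N)) (pderiv ν : Diff N).toLinearMap := by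
  refine LinearMap.ext fun f => ?_
  have h : ⁅(pderiv μ : Diff N), (pderiv ν : Diff N)⁆ = 0 := by
    refine MvPolynomial.derivation_ext fun i => ?_
    rw [Derivation.commutator_apply, pderiv_X, pderiv_X, Pi.single_apply, Pi.single_apply]
    split_ifs <;> simp
  have := congrArg (fun D : Diff N => D f) h
  rw [Derivation.commutator_apply, Derivation.zero_apply, sub_eq_zero] at this
  exact this

/-- `partialD` is an ordered product; since its factors commute, an additional one can be pulled to
the front. -/
theorem prod_ofFn_pow_add_single {R : Type*} [Monoid R] {n : ℕ} (d : Fin n → R)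
    (hd : ∀ i j, Commute (d i) (d j)) (k : Fin n → ℕ) (j : Fin n) :
    (List.ofFn fun i => d i ^ (k + Pi.single j 1 : Fin n → ℕ) i).prod
      = d j * (List.ofFn fun i => d i ^ k i).prod := by
  induction n with
  | zero => exact j.elim0
  | succ n ih =>
    rw [List.ofFn_succ, List.ofFn_succ, List.prod_cons, List.prod_cons]
    cases j using Fin.cases with
    | zero =>
      have : ∀ i : Fin n, (k + Pi.single 0 1 : Fin (n + 1) → ℕ) i.succ = k i.succ := by
        intro i; simp
      simp only [this]
      simp [pow_succ', mul_assoc]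
    | succ j =>
      have h0 : (k + Pi.single j.succ 1 : Fin (n + 1) → ℕ) 0 = k 0 := by
        simp [(Fin.succ_ne_zero j).symm]
      have h1 : ∀ i : Fin n, (k + Pi.single j.succ 1 : Fin (n + 1) → ℕ) i.succ
          = ((fun i => k i.succ) + Pi.single j 1 : Fin n → ℕ) i := by
        intro i
        by_cases h : i = j
        · subst h; simp
        · simp [h]
      simp only [h0, h1]
      rw [ih (fun i => d i.succ) (fun i j => hd _ _) (fun i => k i.succ) j, ← mul_assoc,
        ← mul_assoc, ((hd j.succ 0).pow_right (k 0)).eq]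

@[simp] theorem partialD_zero : partialD (0 : Fin N → ℕ) = 1 := by
  simp [partialD]

theorem partialD_add_single (n : Fin N → ℕ) (μ : Fin N) (f : Fun N) :
    partialD (n + Pi.single μ 1) f = pderiv μ (partialD n f) := by
  rw [partialD, prod_ofFn_pow_add_single _ pderiv_commute]
  rfl

theorem partialD_pderiv (n : Fin N → ℕ) (μ : Fin N) (f : Fun N) :
    partialD n (pderiv μ f) = partialD (n + Pi.single μ 1) f := by
  rw [partialD_add_single]
  induction n using multiIdx_induction generalizing f with
  | zero => simp
  | step n ν ih =>
    rw [partialD_add_single, ih, partialD_add_single]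
    exact congrArg (fun D : Module.End ℂ (Fun N) => D (partialD n f)) (pderiv_commute ν μ).eq

theorem partialD_monomial (k : Fin N → ℕ) (s : Fin N →₀ ℕ) (c : ℂ) :
    partialD k (monomial s c)
      = monomial (s - Finsupp.equivFunOnFinite.symm k) (c * ∏ μ, ((s μ).descFactorial (k μ) : ℂ)) := by
  induction k using multiIdx_induction with
  | zero =>
    have : Finsupp.equivFunOnFinite.symm (0 : Fin N → ℕ) = 0 := by ext; simp
    simp [this]
  | step k μ ih =>
    rw [partialD_add_single, ih, pderiv_monomial]
    refine congrArg₂ (fun s c => monomial s c) ?_ ?_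
    · ext ν
      simp only [Finsupp.coe_tsub, Pi.sub_apply, Finsupp.equivFunOnFinite_symm_apply_apply,
        Pi.add_apply, Finsupp.single_apply, Pi.single_apply, eq_comm (a := μ)]
      omega
    · rw [← Finset.mul_prod_erase _ _ (Finset.mem_univ μ),
        ← Finset.mul_prod_erase _ _ (Finset.mem_univ μ)]
      have : ∀ ν ∈ Finset.univ.erase μ, ((s ν).descFactorial ((k + Pi.single μ 1 : Fin N → ℕ) ν) : ℂ)
          = (s ν).descFactorial (k ν) := by
        intro ν hν
        simp [Finset.ne_of_mem_erase hν]
      rw [Finset.prod_congr rfl this]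
      simp only [Finsupp.coe_tsub, Pi.sub_apply, Finsupp.equivFunOnFinite_symm_apply_apply,
        Pi.add_apply, Pi.single_eq_same, Nat.descFactorial_succ]
      push_cast
      ring

theorem multiChoose_eq_zero {n m : Fin N → ℕ} (h : ¬ m ≤ n) : multiChoose n m = 0 := by
  obtain ⟨μ, hμ⟩ := not_forall.1 h
  exact Finset.prod_eq_zero (Finset.mem_univ μ) (Nat.choose_eq_zero_of_lt (not_le.1 hμ))

theorem multiChoose_self (n : Fin N → ℕ) : multiChoose n n = 1 := by simp [multiChoose]

theorem multiChoose_add_single (n m : Fin N → ℕ) (μ : Fin N) :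
    multiChoose (n + Pi.single μ 1) m
      = multiChoose n m + if 1 ≤ m μ then multiChoose n (m - Pi.single μ 1) else 0 := by
  simp only [multiChoose, ← Finset.mul_prod_erase _ _ (Finset.mem_univ μ)]
  have h1 : ∀ ν ∈ Finset.univ.erase μ, ((n + Pi.single μ 1 : Fin N → ℕ) ν).choose (m ν) = (n ν).choose (m ν) := by
    intro ν hν; simp [Finset.ne_of_mem_erase hν]
  have h2 : ∀ ν ∈ Finset.univ.erase μ, (n ν).choose ((m - Pi.single μ 1 : Fin N → ℕ) ν) = (n ν).choose (m ν) := by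
    intro ν hν; simp [Finset.ne_of_mem_erase hν]
  rw [Finset.prod_congr rfl h1, Finset.prod_congr rfl h2]
  simp only [Pi.add_apply, Pi.sub_apply, Pi.single_eq_same]
  cases h : m μ with
  | zero => simp
  | succ k => simp [Nat.choose_succ_succ]; ring

/-- Induction on the order. Pascal's rule for `multiChoose` separates the terms in which the new
derivative falls on `f` from those in which it falls on `g`. -/
theorem partialD_mul (n : Fin N → ℕ) (f g : Fun N) :
    partialD n (f * g)
      = ∑ k ∈ Finset.Iic n, (multiChoose n k : Fun N) * (partialD (n - k) f * partialD k g) := by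
  induction n using multiIdx_induction generalizing f g with
  | zero =>
    rw [show Finset.Iic (0 : Fin N → ℕ) = {0} by ext k; simp]
    simp [multiChoose]
  | step n μ ih =>
    have hle : n ≤ n + Pi.single μ 1 := le_self_add
    have e1 : ∑ k ∈ Finset.Iic (n + Pi.single μ 1), (multiChoose n k : Fun N) *
          (partialD (n + Pi.single μ 1 - k) f * partialD k g)
        = ∑ k ∈ Finset.Iic n, (multiChoose n k : Fun N) *
          (partialD (n - k) (pderiv μ f) * partialD k g) := by
      symm
      refine Finset.sum_subset_zero_on_sdiff (Finset.Iic_subset_Iic.2 hle) ?_ ?_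
      · intro k hk
        rw [Finset.mem_sdiff, Finset.mem_Iic, Finset.mem_Iic] at hk
        rw [multiChoose_eq_zero hk.2]; simp
      · intro k hk
        have hk := Finset.mem_Iic.1 hk
        rw [partialD_pderiv, tsub_add_eq_add_tsub hk]
    -- The derivative on `g` shifts the summation index by one unit in direction `μ`.
    have e2 : ∑ k ∈ Finset.Iic (n + Pi.single μ 1),
          (((if 1 ≤ k μ then multiChoose n (k - Pi.single μ 1) else 0 : ℕ) : Fun N)) *
          (partialD (n + Pi.single μ 1 - k) f * partialD k g)
        = ∑ k ∈ Finset.Iic n, (multiChoose n k : Fun N) *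
          (partialD (n - k) f * partialD k (pderiv μ g)) := by
      symm
      refine Finset.sum_bij_ne_zero (fun k _ _ => k + Pi.single μ 1) ?_ ?_ ?_ ?_
      · intro k hk _
        exact Finset.mem_Iic.2 (add_le_add_left (Finset.mem_Iic.1 hk) _)
      · intro a _ _ b _ _ h
        exact add_right_cancel h
      · intro b hb h0
        have h1 : 1 ≤ b μ := by
          by_contra h1
          rw [if_neg h1] at h0
          simp at h0
        have hb' : Pi.single μ 1 ≤ b := by
          intro ν
          by_cases hν : ν = μ
          · subst hν; simpa using h1
          · simp [hν]
        have e : b - Pi.single μ 1 + Pi.single μ 1 = b := tsub_add_cancel_of_le hb'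
        refine ⟨b - Pi.single μ 1, Finset.mem_Iic.2 (tsub_le_iff_right.2 (Finset.mem_Iic.1 hb)), ?_, e⟩
        rw [if_pos h1] at h0
        rw [partialD_pderiv, e]
        convert h0 using 3
        rw [← add_tsub_add_eq_tsub_right n (Pi.single μ 1), e]
      · intro k hk _
        rw [partialD_pderiv, if_pos (by simp), add_tsub_cancel_right, add_tsub_add_eq_tsub_right]
    have h := pderiv μ (σ := Fin N) (R := ℂ) |>.leibniz f g
    rw [← partialD_pderiv, h, map_add, smul_eq_mul, smul_eq_mul, ih, mul_comm g, ih, ← e1, ← e2,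
      ← Finset.sum_add_distrib]
    refine Finset.sum_congr rfl fun k _ => ?_
    rw [multiChoose_add_single]
    push_cast
    ring

end

/-! ### The matrices of the action on jets -/

section
variable {N p : ℕ}

/-- `MultiIdx` has bounded entries, which is awkward for shifts of indices. The hypotheses compare
the two index sets only where the summand is nonzero. -/
theorem sum_multiIdx {M : Type*} [AddCommMonoid M] (g : (Fin N → ℕ) → M) (S : Finset (Fin N → ℕ))
    (h1 : ∀ k ∈ S, g k ≠ 0 → ∑ μ, k μ ≤ p) (h2 : ∀ k, ∑ μ, k μ ≤ p → g k ≠ 0 → k ∈ S) :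
    ∑ m : MultiIdx N p, g m.val = ∑ k ∈ S, g k := by
  refine Finset.sum_bij_ne_zero (fun m _ _ => m.val) (fun m _ h => h2 _ m.2 h) ?_ ?_ fun _ _ _ => rfl
  · intro a _ _ b _ _ h
    refine Subtype.ext (funext fun μ => Fin.ext ?_)
    exact congrFun h μ
  · intro k hk h0
    have hs := h1 k hk h0
    have hb : ∀ μ, k μ < p + 1 := fun μ => Nat.lt_succ_of_le
      ((Finset.single_le_sum (fun _ _ => Nat.zero_le _) (Finset.mem_univ μ)).trans hs)
    exact ⟨⟨fun μ => ⟨k μ, hb μ⟩, hs⟩, Finset.mem_univ _, h0, rfl⟩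

/-- Jets of polynomials separate coefficients. By induction on `|m|`, test with the monomial `x^m`
in the component `α`: derivatives `∂_l` with `l ≰ m` kill it, those with `l < m` have zero
coefficient by induction, and `∂_m x^m = m!` is nonzero. -/
theorem eq_zero_of_sum_partialD {ι : Type*} [Fintype ι] [DecidableEq ι] (B : JetIdx N p ι → Fun N)
    (h : ∀ φ : ι → Fun N, ∑ a : JetIdx N p ι, B a * partialD a.2.val (φ a.1) = 0) : B = 0 := by
  have key : ∀ (k : ℕ) (α : ι) (m : MultiIdx N p), ∑ μ, m.val μ = k → B (α, m) = 0 := by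
    intro k
    induction k using Nat.strong_induction_on with
    | _ k ih =>
      intro α m hm
      have h0 := h (Pi.single α (monomial (Finsupp.equivFunOnFinite.symm m.val) 1))
      rw [Finset.sum_eq_single (α, m)] at h0
      · simp only [Pi.single_eq_same, partialD_monomial, Finsupp.equivFunOnFinite_symm_apply_apply,
          tsub_self, one_mul, Nat.descFactorial_self] at h0
        rcases mul_eq_zero.1 h0 with h0 | h0
        · exact h0
        · rw [monomial_eq_zero, Finset.prod_eq_zero_iff] at h0
          obtain ⟨μ, -, hμ⟩ := h0
          exact absurd hμ (by exact_mod_cast (Nat.factorial_pos _).ne')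
      · rintro ⟨β, l⟩ - hne
        by_cases hβ : β = α
        · subst hβ
          simp only [Pi.single_eq_same, partialD_monomial]
          by_cases hl : l.val ≤ m.val
          · have hlt : ∑ μ, l.val μ < k := by
              rw [← hm]
              refine Finset.sum_lt_sum (fun μ _ => hl μ) ?_
              by_contra! hc
              refine hne (congrArg (Prod.mk β) (Subtype.ext (funext fun μ => Fin.ext ?_)))
              exact le_antisymm (hl μ) (hc μ (Finset.mem_univ μ))
            rw [ih _ hlt β l rfl, zero_mul]
          · obtain ⟨μ, hμ⟩ := not_forall.1 hl
            rw [Finset.prod_eq_zero (Finset.mem_univ μ), mul_zero, map_zero, mul_zero]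
            rw [Nat.descFactorial_eq_zero_iff_lt.2 (by simpa using hμ), Nat.cast_zero]
        · simp [Pi.single_eq_of_ne hβ]
      · simp
  exact funext fun a => key _ a.1 a.2 rfl

variable {ι : Type*} [Fintype ι] [DecidableEq ι]
  (ϱ : Matrix (Fin N) (Fin N) ℂ →ₗ⁅ℂ⁆ Matrix ι ι ℂ)

/-- The matrix of the action of a vector field on jets. -/
def jetT (ξ : Diff N) (a b : JetIdx N p ι) : Fun N := Tmat ϱ ξ a.2.val b.2.val a.1 b.1

/-- The Lie derivative of a `V`-valued function. -/
def lieDeriv (ξ : Diff N) (φ : ι → Fun N) (β : ι) : Fun N :=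
  ξ (φ β) + ∑ α, ∑ μ, ∑ ν, pderiv ν (comp ξ μ) * MvPolynomial.C (rhoT ϱ ν μ β α) * φ α

theorem derivation_sum_apply {κ : Type*} (S : Finset κ) (D : κ → Diff N) (f : Fun N) :
    (∑ i ∈ S, D i) f = ∑ i ∈ S, D i f := by
  rw [← Derivation.coeFnAddMonoidHom_apply, map_sum, Finset.sum_apply]
  rfl

theorem diff_apply (ξ : Diff N) (f : Fun N) : ξ f = ∑ μ, comp ξ μ * pderiv μ f := by
  have : ξ = ∑ μ, comp ξ μ • (pderiv μ : Diff N) := by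
    refine MvPolynomial.derivation_ext fun i => ?_
    rw [derivation_sum_apply]
    simp [pderiv_X, Pi.single_apply, comp]
  conv_lhs => rw [this]
  rw [derivation_sum_apply]
  rfl

theorem partialD_C_mul (c : ℂ) (f : Fun N) (k : Fin N → ℕ) :
    partialD k (MvPolynomial.C c * f) = MvPolynomial.C c * partialD k f := by
  rw [← MvPolynomial.smul_eq_C_mul, map_smul, MvPolynomial.smul_eq_C_mul]

/-- The diagonal part of the matrix `T^m_n(ξ)`. -/
def shiftTerm (ξ : Diff N) (n m : Fin N → ℕ) (μ : Fin N) : Fun N :=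
  if 1 ≤ m μ ∧ m - Pi.single μ 1 ≠ n then
    (multiChoose n (m - Pi.single μ 1) : Fun N) * partialD (n - (m - Pi.single μ 1)) (comp ξ μ)
  else 0

theorem Tmat_apply (ξ : Diff N) (n m : Fin N → ℕ) (β α : ι) : Tmat ϱ ξ n m β α
      = ∑ μ, ∑ ν, (multiChoose n m : Fun N) *
          partialD (n - m) (pderiv ν (comp ξ μ)) * MvPolynomial.C (rhoT ϱ ν μ β α)
        + if β = α then ∑ μ, shiftTerm ξ n m μ else 0 := by
  rw [Tmat, Matrix.add_apply, Matrix.sum_apply, Matrix.sum_apply]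
  congr 1
  · refine Finset.sum_congr rfl fun μ _ => ?_
    rw [Matrix.sum_apply]
    refine Finset.sum_congr rfl fun ν _ => ?_
    rw [partialD_pderiv]
    rfl
  · by_cases h : β = α
    · subst h
      rw [if_pos rfl]
      refine Finset.sum_congr rfl fun μ _ => ?_
      rw [shiftTerm]
      split_ifs <;> simp
    · rw [if_neg h]
      refine Finset.sum_eq_zero fun μ _ => ?_
      split_ifs <;> simp [h]

/-- This identity is the origin of the matrices `T^m_n(ξ)`. In the Leibniz expansion of `∂_n (ξ^μ
∂_μ φ)` the term with all derivatives on `∂_μ φ` is the transport term; the others give the scalar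
part and the expansion of `∂_ν ξ^μ ϱ(T^ν_μ) φ` gives the rest. No derivative of order above `|n|`
survives in the sum, so truncation at `p` is consistent. -/
theorem partialD_lieDeriv (ξ : Diff N) (φ : ι → Fun N) (a : JetIdx N p ι) :
    partialD a.2.val (lieDeriv ϱ ξ φ a.1) = ξ (partialD a.2.val (φ a.1))
      + ∑ b : JetIdx N p ι, jetT ϱ ξ a b * partialD b.2.val (φ b.1) := by
  obtain ⟨β, n⟩ := a
  have hn : ∀ k ≤ n.val, ∑ μ, k μ ≤ p := fun k hk =>
    (Finset.sum_le_sum fun μ _ => hk μ).trans n.2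
  have e1 : ∀ f : Fun N, partialD n.val (ξ f) = ξ (partialD n.val f) +
      ∑ m : MultiIdx N p, (∑ μ, shiftTerm ξ n.val m.val μ) * partialD m.val f := by
    intro f
    rw [diff_apply, map_sum, diff_apply]
    simp only [Finset.sum_mul]
    rw [Finset.sum_comm, ← Finset.sum_add_distrib]
    refine Finset.sum_congr rfl fun μ _ => ?_
    rw [partialD_mul, ← Finset.add_sum_erase _ _ (Finset.mem_Iic.2 (le_refl n.val))]
    congr 1
    · rw [multiChoose_self, tsub_self, partialD_zero, partialD_pderiv, partialD_add_single]
      simp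
    -- With `k` derivatives on `∂_μ φ` the jet index is `m = k + μ`; the condition `m - μ ≠ n` in
    -- `shiftTerm` excludes exactly the transport term `k = n`.
    · rw [sum_multiIdx (fun m => shiftTerm ξ n.val m μ * partialD m f)
        (((Finset.Iic n.val).erase n.val).map (addRightEmbedding (Pi.single μ 1)))]
      · rw [Finset.sum_map]
        refine Finset.sum_congr rfl fun k hk => ?_
        rw [Finset.mem_erase] at hk
        rw [addRightEmbedding_apply]
        rw [shiftTerm, add_tsub_cancel_right, if_pos ⟨by simp, hk.1⟩, partialD_pderiv, mul_assoc]
      · intro m hm _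
        obtain ⟨k, hk, rfl⟩ := Finset.mem_map.1 hm
        rw [Finset.mem_erase, Finset.mem_Iic] at hk
        have hlt : ∑ μ, k μ < ∑ μ, n.val μ := by
          refine Finset.sum_lt_sum (fun μ _ => hk.2 μ) ?_
          by_contra! hc
          exact hk.1 (le_antisymm hk.2 fun μ => hc μ (Finset.mem_univ μ))
        have := hlt.trans_le (hn _ le_rfl)
        simpa [Finset.sum_add_distrib] using this
      · intro m _ hm
        have hc : 1 ≤ m μ ∧ m - Pi.single μ 1 ≠ n.val := by
          by_contra hc
          exact hm (by rw [shiftTerm, if_neg hc, zero_mul])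
        rw [shiftTerm, if_pos hc] at hm
        have hle : m - Pi.single μ 1 ≤ n.val := by
          by_contra hle
          exact hm (by rw [multiChoose_eq_zero hle]; simp)
        refine Finset.mem_map.2 ⟨m - Pi.single μ 1,
          Finset.mem_erase.2 ⟨hc.2, Finset.mem_Iic.2 hle⟩, ?_⟩
        refine tsub_add_cancel_of_le fun ν => ?_
        by_cases hν : ν = μ
        · subst hν; simpa using hc.1
        · simp [hν]
  have e2 : ∀ f g : Fun N, partialD n.val (g * f) = ∑ m : MultiIdx N p,
      (multiChoose n.val m.val : Fun N) * (partialD (n.val - m.val) g * partialD m.val f) := by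
    intro f g
    rw [partialD_mul, ← sum_multiIdx (p := p) fun k => (multiChoose n.val k : Fun N) *
      (partialD (n.val - k) g * partialD k f)]
    · exact fun k hk _ => hn k (Finset.mem_Iic.1 hk)
    · intro k _ hk
      by_contra hle
      exact hk (by rw [multiChoose_eq_zero fun h => hle (Finset.mem_Iic.2 h)]; simp)
  have e4 : ∀ (g f : Fun N) (r : ℂ), partialD n.val (g * MvPolynomial.C r * f) = ∑ m : MultiIdx N p,
      (multiChoose n.val m.val : Fun N) * partialD (n.val - m.val) g * MvPolynomial.C r *
        partialD m.val f := by
    intro g f r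
    rw [mul_comm g, mul_assoc, partialD_C_mul, e2, Finset.mul_sum]
    exact Finset.sum_congr rfl fun m _ => by ring
  rw [lieDeriv, map_add, e1, add_assoc]
  congr 1
  rw [Fintype.sum_prod_type]
  simp only [jetT, Tmat_apply, add_mul, Finset.sum_add_distrib]
  rw [add_comm]
  congr 1
  · rw [map_sum]
    refine Finset.sum_congr rfl fun α _ => ?_
    rw [map_sum]
    simp only [map_sum, e4, Finset.sum_mul]
    rw [Finset.sum_congr rfl fun μ _ => Finset.sum_comm, Finset.sum_comm]
  · simp

theorem sum_mul_eq_sum {f g : JetIdx N p ι → Fun N}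
    (h : ∀ φ : ι → Fun N, ∑ a, f a * partialD a.2.val (φ a.1)
      = ∑ a, g a * partialD a.2.val (φ a.1)) : f = g := by
  refine sub_eq_zero.1 (eq_zero_of_sum_partialD (f - g) fun φ => ?_)
  simp only [Pi.sub_apply, sub_mul, Finset.sum_sub_distrib, h, sub_self]

/-! ### The Lie derivative represents the bracket of vector fields. -/

theorem rhoT_commutator (μ ν σ τ : Fin N) (β α : ι) :
    ∑ γ, (rhoT ϱ ν μ β γ * rhoT ϱ τ σ γ α - rhoT ϱ τ σ β γ * rhoT ϱ ν μ γ α)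
      = (if μ = τ then rhoT ϱ ν σ β α else 0) - if σ = ν then rhoT ϱ τ μ β α else 0 := by
  have h := ϱ.map_lie (Matrix.single ν μ 1) (Matrix.single τ σ 1)
  rw [Ring.lie_def, Ring.lie_def] at h
  have h' := congrFun (congrFun h β) α
  rw [Finset.sum_sub_distrib]
  refine Eq.trans ?_ (h'.symm.trans ?_)
  · rfl
  · rw [map_sub]
    by_cases h1 : μ = τ <;> by_cases h2 : σ = ν <;> simp [h1, h2, rhoT]

/-- The matrix `∂_ν ξ^μ ϱ(T^ν_μ)`. -/
def linT (ξ : Diff N) (β α : ι) : Fun N :=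
  ∑ μ, ∑ ν, pderiv ν (comp ξ μ) * MvPolynomial.C (rhoT ϱ ν μ β α)

/-- Second derivatives of the components occur only in the transport terms. The products of first
derivatives in `∂_ν ⁅ξ, η⁆^μ` match the commutator of the matrix units in `rhoT_commutator`. -/
theorem linT_lie (ξ η : Diff N) (β α : ι) : linT ϱ ⁅ξ, η⁆ β α
    = ξ (linT ϱ η β α) - η (linT ϱ ξ β α)
      + ∑ γ, (linT ϱ ξ β γ * linT ϱ η γ α - linT ϱ η β γ * linT ϱ ξ γ α) := by
  have h1 : ∀ (ξ : Diff N) (f : Fun N) (c : ℂ), ξ (f * MvPolynomial.C c) = ξ f * MvPolynomial.C c := by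
    intro ξ f c
    have : ξ (MvPolynomial.C c) = 0 := ξ.map_algebraMap c
    rw [Derivation.leibniz, this, smul_zero, zero_add, smul_eq_mul, mul_comm]
  have h2 : ∑ γ, (linT ϱ ξ β γ * linT ϱ η γ α - linT ϱ η β γ * linT ϱ ξ γ α)
      = ∑ μ, ∑ ν, ∑ σ, ∑ τ, pderiv ν (comp ξ μ) * pderiv τ (comp η σ) * MvPolynomial.C
        ((if μ = τ then rhoT ϱ ν σ β α else 0) - if σ = ν then rhoT ϱ τ μ β α else 0) := by
    have e : ∀ γ, linT ϱ ξ β γ * linT ϱ η γ α - linT ϱ η β γ * linT ϱ ξ γ α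
        = ∑ μ, ∑ ν, ∑ σ, ∑ τ, pderiv ν (comp ξ μ) * pderiv τ (comp η σ) * MvPolynomial.C
          (rhoT ϱ ν μ β γ * rhoT ϱ τ σ γ α - rhoT ϱ τ σ β γ * rhoT ϱ ν μ γ α) := by
      intro γ
      have e' : ∀ A B : Fin N → Fin N → Fun N, (∑ μ, ∑ ν, A μ ν) * (∑ σ, ∑ τ, B σ τ)
          = ∑ μ, ∑ ν, ∑ σ, ∑ τ, A μ ν * B σ τ := by
        intro A B
        simp only [Finset.sum_mul]
        simp only [Finset.mul_sum]
      rw [mul_comm (linT ϱ η β γ)]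
      simp only [linT]
      rw [e', e']
      simp only [← Finset.sum_sub_distrib]
      refine Finset.sum_congr rfl fun μ _ => Finset.sum_congr rfl fun ν _ =>
        Finset.sum_congr rfl fun σ _ => Finset.sum_congr rfl fun τ _ => ?_
      rw [map_sub, map_mul, map_mul]
      ring
    rw [Finset.sum_congr rfl fun γ _ => e γ]
    refine Finset.sum_comm.trans (Finset.sum_congr rfl fun μ _ => Finset.sum_comm.trans
      (Finset.sum_congr rfl fun ν _ => Finset.sum_comm.trans (Finset.sum_congr rfl fun σ _ =>
        Finset.sum_comm.trans (Finset.sum_congr rfl fun τ _ => ?_))))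
    rw [← Finset.mul_sum, ← map_sum, rhoT_commutator]
  have h2' : ∀ μ ν, ∑ σ, ∑ τ, pderiv ν (comp ξ μ) * pderiv τ (comp η σ) * MvPolynomial.C
        ((if μ = τ then rhoT ϱ ν σ β α else 0) - if σ = ν then rhoT ϱ τ μ β α else 0)
      = ∑ σ, pderiv ν (comp ξ μ) * pderiv μ (comp η σ) * MvPolynomial.C (rhoT ϱ ν σ β α)
        - ∑ τ, pderiv ν (comp ξ μ) * pderiv τ (comp η ν) * MvPolynomial.C (rhoT ϱ τ μ β α) := by
    intro μ ν
    simp only [map_sub, mul_sub, Finset.sum_sub_distrib, apply_ite MvPolynomial.C, map_zero,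
      mul_ite, mul_zero]
    congr 1
    · simp only [Finset.sum_ite_eq, Finset.mem_univ, if_true]
    · rw [Finset.sum_comm]
      simp only [Finset.sum_ite_eq', Finset.mem_univ, if_true]
  have h3 : ∀ ξ η : Diff N, ∑ μ, ∑ ν, (∑ ρ, pderiv ν (comp ξ ρ) * pderiv ρ (comp η μ)) *
      MvPolynomial.C (rhoT ϱ ν μ β α) = ∑ μ, ∑ ν, ∑ σ, pderiv ν (comp ξ μ) * pderiv μ (comp η σ) *
        MvPolynomial.C (rhoT ϱ ν σ β α) := by
    intro ξ η
    simp only [Finset.sum_mul]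
    rw [Finset.sum_comm, Finset.sum_congr rfl fun ν _ => Finset.sum_comm, Finset.sum_comm]
  have h4 : ∑ μ, ∑ ν, (∑ ρ, pderiv ν (comp η ρ) * pderiv ρ (comp ξ μ)) *
      MvPolynomial.C (rhoT ϱ ν μ β α) = ∑ μ, ∑ ν, ∑ τ, pderiv ν (comp ξ μ) * pderiv τ (comp η ν) *
        MvPolynomial.C (rhoT ϱ τ μ β α) := by
    simp only [Finset.sum_mul]
    refine Finset.sum_congr rfl fun μ _ => ?_
    rw [Finset.sum_comm]
    refine Finset.sum_congr rfl fun ν _ => Finset.sum_congr rfl fun τ _ => ?_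
    ring
  have h5 : ∀ μ ν, pderiv ν (comp ⁅ξ, η⁆ μ) = ξ (pderiv ν (comp η μ)) - η (pderiv ν (comp ξ μ))
      + (∑ ρ, pderiv ν (comp ξ ρ) * pderiv ρ (comp η μ))
      - ∑ ρ, pderiv ν (comp η ρ) * pderiv ρ (comp ξ μ) := by
    intro μ ν
    rw [comp, Derivation.commutator_apply, map_sub, pderiv_diff ξ ν (η (X μ)),
      pderiv_diff η ν (ξ (X μ))]
    change ξ (pderiv ν (comp η μ)) + ∑ ρ, pderiv ν (comp ξ ρ) * pderiv ρ (comp η μ)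
      - (η (pderiv ν (comp ξ μ)) + ∑ ρ, pderiv ν (comp η ρ) * pderiv ρ (comp ξ μ)) = _
    ring
  rw [h2]
  simp only [h2']
  simp only [linT, h5, map_sum, h1, add_mul, sub_mul, Finset.sum_add_distrib, Finset.sum_sub_distrib]
  rw [h3 ξ η, h4]
  ring

theorem lieDeriv_eq (ξ : Diff N) (φ : ι → Fun N) (β : ι) :
    lieDeriv ϱ ξ φ β = ξ (φ β) + ∑ α, linT ϱ ξ β α * φ α := by
  simp only [lieDeriv, linT, Finset.sum_mul]

theorem lieDeriv_lie (ξ η : Diff N) (φ : ι → Fun N) :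
    lieDeriv ϱ ⁅ξ, η⁆ φ = lieDeriv ϱ ξ (lieDeriv ϱ η φ) - lieDeriv ϱ η (lieDeriv ϱ ξ φ) := by
  funext β
  have h2 : ∀ ξ η : Diff N, lieDeriv ϱ ξ (lieDeriv ϱ η φ) β = ξ (η (φ β)) + ∑ α,
        (linT ϱ η β α * ξ (φ α) + linT ϱ ξ β α * η (φ α)
        + (ξ (linT ϱ η β α) + ∑ γ, linT ϱ ξ β γ * linT ϱ η γ α) * φ α) := by
    intro ξ η
    simp only [lieDeriv_eq, map_add, map_sum, Derivation.leibniz, smul_eq_mul, mul_add,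
      Finset.sum_add_distrib, add_mul, Finset.sum_mul, Finset.mul_sum]
    rw [Finset.sum_comm (f := fun b c => linT ϱ ξ β c * linT ϱ η c b * φ b)]
    simp only [mul_comm (φ _), mul_assoc]
    ring
  rw [Pi.sub_apply, h2, h2, lieDeriv_eq, Derivation.commutator_apply]
  simp only [linT_lie, add_mul, sub_mul, Finset.sum_add_distrib, Finset.sum_sub_distrib]
  ring

/-- Expanding the jet of `lieDeriv_lie` in two ways gives equal linear combinations of the
derivatives of an arbitrary `φ`, so the coefficients agree. -/
theorem jetT_lie (ξ η : Diff N) (a b : JetIdx N p ι) :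
    jetT ϱ ⁅ξ, η⁆ a b = ξ (jetT ϱ η a b) - η (jetT ϱ ξ a b)
      + ∑ c, (jetT ϱ ξ a c * jetT ϱ η c b - jetT ϱ η a c * jetT ϱ ξ c b) := by
  refine congrFun (sum_mul_eq_sum (f := fun b => jetT ϱ ⁅ξ, η⁆ a b) (g := fun b =>
    ξ (jetT ϱ η a b) - η (jetT ϱ ξ a b)
      + ∑ c, (jetT ϱ ξ a c * jetT ϱ η c b - jetT ϱ η a c * jetT ϱ ξ c b)) fun φ => ?_) b
  have h1 := partialD_lieDeriv ϱ ⁅ξ, η⁆ φ a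
  have h2 : ∀ ξ η : Diff N, partialD a.2.val (lieDeriv ϱ ξ (lieDeriv ϱ η φ) a.1)
      = ξ (η (partialD a.2.val (φ a.1))) + ∑ b : JetIdx N p ι,
        (jetT ϱ η a b * ξ (partialD b.2.val (φ b.1)) + jetT ϱ ξ a b * η (partialD b.2.val (φ b.1))
        + (ξ (jetT ϱ η a b) + ∑ c, jetT ϱ ξ a c * jetT ϱ η c b) * partialD b.2.val (φ b.1)) := by
    intro ξ η
    simp only [partialD_lieDeriv, map_add, map_sum, Derivation.leibniz, smul_eq_mul, mul_add,
      Finset.sum_add_distrib, add_mul, Finset.sum_mul, Finset.mul_sum]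
    rw [Finset.sum_comm (f := fun b c => jetT ϱ ξ a c * jetT ϱ η c b * partialD b.2.val (φ b.1))]
    simp only [mul_comm (partialD _ _), mul_assoc]
    ring
  rw [lieDeriv_lie, Pi.sub_apply, map_sub, h2, h2, Derivation.commutator_apply] at h1
  have h3 := eq_sub_of_add_eq' h1.symm
  rw [h3]
  simp only [add_mul, sub_mul, Finset.sum_add_distrib, Finset.sum_sub_distrib]
  ring

end

/-! ### Traces over jets -/

section
variable {N p : ℕ}

theorem exists_finset_sum_le (N p : ℕ) : ∃ S : Finset (Fin N → ℕ), ∀ n, n ∈ S ↔ ∑ μ, n μ ≤ p := by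
  classical
  refine ⟨Finset.univ.image (MultiIdx.val : MultiIdx N p → _), fun n => ?_⟩
  rw [Finset.mem_image]
  constructor
  · rintro ⟨m, -, rfl⟩
    exact m.2
  · intro h
    exact ⟨⟨fun μ => ⟨n μ, Nat.lt_succ_of_le
      ((Finset.single_le_sum (fun _ _ => Nat.zero_le _) (Finset.mem_univ μ)).trans h)⟩, h⟩,
      Finset.mem_univ _, rfl⟩

theorem sum_add_single (n : Fin N → ℕ) (μ : Fin N) :
    ∑ ν, (n + Pi.single μ 1 : Fin N → ℕ) ν = ∑ ν, n ν + 1 := by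
  simp [Finset.sum_add_distrib]

theorem exists_eq_add_single {n : Fin N → ℕ} {μ : Fin N} (h : 1 ≤ n μ) :
    ∃ k : Fin N → ℕ, n = k + Pi.single μ 1 := by
  refine ⟨n - Pi.single μ 1, (tsub_add_cancel_of_le fun ν => ?_).symm⟩
  by_cases hν : ν = μ
  · subst hν; simpa using h
  · simp [hν]

theorem exists_eq_add_single_of_le {k n : Fin N → ℕ} (h : k ≤ n) (hs : ∑ μ, n μ = ∑ μ, k μ + 1) :
    ∃ ν, k + Pi.single ν 1 = n := by
  obtain ⟨d, rfl⟩ := exists_add_of_le h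
  simp only [Pi.add_apply, Finset.sum_add_distrib, add_right_inj] at hs
  obtain ⟨ν, -, hν⟩ := Finset.exists_ne_zero_of_sum_ne_zero (hs.trans_ne one_ne_zero)
  obtain ⟨l, rfl⟩ := exists_eq_add_single (Nat.one_le_iff_ne_zero.2 hν)
  rw [sum_add_single, Nat.add_eq_right, Finset.sum_eq_zero_iff] at hs
  refine ⟨ν, ?_⟩
  have : l = 0 := funext fun μ => hs μ (Finset.mem_univ μ)
  rw [this, zero_add]

/-- Stars and bars: the slack `p - |n|` becomes an additional coordinate, so that the total is
exactly `p`. -/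
theorem card_multiIdx (N p : ℕ) : Fintype.card (MultiIdx N p) = (N + p).choose p := by
  have h := Finset.card_finsuppAntidiag_nat_eq_choose (s := (Finset.univ : Finset (Fin (N + 1)))) p
  rw [Finset.card_univ, Fintype.card_fin, show N + 1 + p - 1 = N + p by omega] at h
  rw [← h]
  refine Finset.card_bij (fun n _ => Finsupp.equivFunOnFinite.symm
    (Fin.cons (p - ∑ μ, n.val μ) n.val : Fin (N + 1) → ℕ)) ?_ ?_ ?_
  · intro n _
    rw [Finset.mem_finsuppAntidiag]
    refine ⟨?_, Finset.subset_univ _⟩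
    simp only [Finsupp.equivFunOnFinite_symm_apply_apply, Fin.sum_univ_succ, Fin.cons_zero,
      Fin.cons_succ]
    exact Nat.sub_add_cancel n.2
  · intro a _ b _ h
    have h' := Finsupp.equivFunOnFinite.symm.injective h
    exact Subtype.ext (funext fun μ => Fin.ext (congrFun (Fin.cons_injective2 h').2 μ))
  · intro f hf
    have hf := (Finset.mem_finsuppAntidiag.1 hf).1
    rw [Fin.sum_univ_succ] at hf
    refine ⟨⟨fun μ => ⟨f μ.succ, Nat.lt_succ_of_le ((Finset.single_le_sum
      (f := fun μ : Fin N => f μ.succ) (fun _ _ => Nat.zero_le _) (Finset.mem_univ μ)).trans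
      (by omega))⟩, by change ∑ μ : Fin N, f μ.succ ≤ p; omega⟩, Finset.mem_univ _, ?_⟩
    ext i
    rw [Finsupp.equivFunOnFinite_symm_apply_apply]
    cases i using Fin.cases with
    | zero =>
      rw [Fin.cons_zero]
      change p - ∑ μ : Fin N, f μ.succ = f 0
      omega
    | succ i => rfl

/-- A hockey-stick identity, proved by induction on `k` and on `p` with Pascal's rule for `n` and
for `N + p`. It supplies all binomial charges of the theorem. -/
theorem sum_multiChoose (p : ℕ) (k : Fin N → ℕ) :
    (∑ n : MultiIdx N p, multiChoose n.val k : ℕ)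
      = if ∑ μ, k μ ≤ p then (N + p).choose (p - ∑ μ, k μ) else 0 := by
  induction k using multiIdx_induction generalizing p with
  | zero => simp [multiChoose, card_multiIdx]
  | step k μ ih =>
    rw [sum_add_single]
    induction p with
    | zero =>
      rw [if_neg (by omega)]
      refine Finset.sum_eq_zero fun n _ => multiChoose_eq_zero fun h => ?_
      have := (Finset.sum_le_sum fun ν _ => h ν).trans n.2
      rw [sum_add_single] at this
      omega
    | succ p ihp =>
      obtain ⟨S, hS⟩ := exists_finset_sum_le N p
      -- Only `n` with `n_μ ≥ 1` contribute; they are `l + μ` with `|l| ≤ p`.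
      have e : (∑ n : MultiIdx N (p + 1), multiChoose n.val (k + Pi.single μ 1) : ℕ)
          = ∑ n : MultiIdx N p, multiChoose (n.val + Pi.single μ 1) (k + Pi.single μ 1) := by
        have h1 := sum_multiIdx (p := p + 1) (fun n => multiChoose n (k + Pi.single μ 1))
          (S.map (addRightEmbedding (Pi.single μ 1))) ?_ ?_
        have h2 := sum_multiIdx (p := p) (fun n => multiChoose (n + Pi.single μ 1) (k + Pi.single μ 1))
          S ?_ ?_
        · rw [h1, h2, Finset.sum_map]
          rfl
        · exact fun n hn _ => (hS n).1 hn
        · exact fun n hn _ => (hS n).2 hn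
        · intro n hn _
          obtain ⟨l, hl, rfl⟩ := Finset.mem_map.1 hn
          rw [addRightEmbedding_apply, sum_add_single]
          exact Nat.succ_le_succ ((hS l).1 hl)
        · intro n hn h0
          obtain ⟨l, rfl⟩ : ∃ l : Fin N → ℕ, n = l + Pi.single μ 1 := by
            refine exists_eq_add_single ?_
            have hle : k + Pi.single μ 1 ≤ n := by
              by_contra hle
              exact h0 (multiChoose_eq_zero hle)
            exact le_trans (by simp) (hle μ)
          rw [sum_add_single] at hn
          exact Finset.mem_map.2 ⟨l, (hS l).2 (by omega), rfl⟩
      rw [e]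
      simp only [multiChoose_add_single]
      rw [Finset.sum_add_distrib, ihp]
      simp only [Pi.add_apply, Pi.single_eq_same, le_add_iff_nonneg_left, zero_le, if_true,
        add_tsub_cancel_right, ih]
      rcases lt_trichotomy (∑ ν, k ν) p with h | h | h
      · obtain ⟨d, hd⟩ : ∃ d, p = ∑ ν, k ν + 1 + d := ⟨_, (Nat.add_sub_of_le h).symm⟩
        rw [if_pos (by omega), if_pos (by omega), if_pos (by omega),
          show p - (∑ ν, k ν + 1) = d by omega, show p - ∑ ν, k ν = d + 1 by omega,
          show p + 1 - (∑ ν, k ν + 1) = d + 1 by omega, ← add_assoc, Nat.choose_succ_succ]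
      · rw [if_neg (by omega), if_pos (by omega), if_pos (by omega), h]
        simp
      · rw [if_neg (by omega), if_neg (by omega), if_neg (by omega)]

theorem sum_multiIdx_coord (p : ℕ) (μ : Fin N) :
    (∑ n : MultiIdx N p, (n.val μ : ℂ)) = binom (N + p) (p - 1) := by
  have h := sum_multiChoose p (Pi.single μ 1)
  have e : ∀ n : MultiIdx N p, multiChoose n.val (Pi.single μ 1) = n.val μ := by
    intro n
    rw [multiChoose, Finset.prod_eq_single μ]
    · simp
    · intro ν _ hν; simp [hν]
    · simp
  simp only [e, Finset.sum_pi_single', Finset.mem_univ, if_true] at h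
  rw [← Nat.cast_sum, h, binom]
  by_cases hp : 1 ≤ p
  · rw [if_pos hp, if_pos (by omega)]
    congr 2
    omega
  · rw [if_neg hp, if_neg (by omega), Nat.cast_zero]

theorem binom_card (N p : ℕ) : binom (N + p) p = Fintype.card (MultiIdx N p) := by
  rw [card_multiIdx, binom, if_pos (by omega), Int.toNat_natCast]

/-- The product `n_μ n_ν` is a multi-index binomial if `μ ≠ ν`, while `n_μ² = 2 C(n_μ, 2) + n_μ`. -/
theorem sum_multiIdx_coord_mul (p : ℕ) (μ ν : Fin N) :
    (∑ n : MultiIdx N p, (n.val μ * n.val ν : ℂ))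
      = if μ = ν then 2 * binom (N + p) (p - 2) + binom (N + p) (p - 1) else binom (N + p) (p - 2) := by
  have h := sum_multiChoose p (Pi.single μ 1 + Pi.single ν 1)
  have hb : (((if 2 ≤ p then (N + p).choose (p - 2) else 0 : ℕ)) : ℂ) = binom (N + p) (p - 2) := by
    rw [binom]
    by_cases hp : 2 ≤ p
    · rw [if_pos hp, if_pos (by omega)]
      congr 2
      omega
    · rw [if_neg hp, if_neg (by omega), Nat.cast_zero]
  rw [sum_add_single] at h
  simp only [Finset.sum_pi_single', Finset.mem_univ, if_true] at h
  have h' := (congrArg (Nat.cast : ℕ → ℂ) h).trans hb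
  rw [Nat.cast_sum] at h'
  by_cases hμν : μ = ν
  · subst hμν
    have e : ∀ n : MultiIdx N p, (multiChoose n.val (Pi.single μ 1 + Pi.single μ 1) : ℂ)
        = (n.val μ * n.val μ - n.val μ) / 2 := by
      intro n
      rw [multiChoose, Finset.prod_eq_single μ]
      · simp only [Pi.add_apply, Pi.single_eq_same]
        rw [show 1 + 1 = 2 from rfl, Nat.cast_choose_two]
        ring
      · intro ν _ hν; simp [hν]
      · simp
    simp only [e] at h'
    rw [if_pos rfl, ← h', ← sum_multiIdx_coord p μ, Finset.mul_sum, ← Finset.sum_add_distrib]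
    exact Finset.sum_congr rfl fun n _ => by ring
  · have e : ∀ n : MultiIdx N p, multiChoose n.val (Pi.single μ 1 + Pi.single ν 1)
        = n.val μ * n.val ν := by
      intro n
      rw [multiChoose, ← Finset.mul_prod_erase _ _ (Finset.mem_univ μ), ← Finset.mul_prod_erase _ _
        (Finset.mem_erase.2 ⟨Ne.symm hμν, Finset.mem_univ ν⟩), Finset.prod_eq_one]
      · simp [hμν, Ne.symm hμν]
      · intro κ hκ
        rw [Finset.mem_erase, Finset.mem_erase] at hκ
        simp [hκ.1, hκ.2.1]
    rw [if_neg hμν, ← h']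
    exact Finset.sum_congr rfl fun n _ => by rw [e, Nat.cast_mul]

theorem binom_add_binom (N p : ℕ) :
    binom (N + p) (p - 2) + binom (N + p) (p - 1) = binom (N + p + 1) (p - 1) := by
  rcases p with _ | _ | p
  · simp [binom]
  · simp [binom]
  · have h1 : (((p + 1 + 1 : ℕ) : ℤ) - 2) = (p : ℕ) := by push_cast; ring
    have h2 : (((p + 1 + 1 : ℕ) : ℤ) - 1) = (p + 1 : ℕ) := by push_cast; ring
    rw [h1, h2]
    simp only [binom, Nat.cast_nonneg, if_true, Int.toNat_natCast, Nat.choose_succ_succ]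
    push_cast
    ring

/-! ### The degree-preserving part of the jet matrices. -/

/-- The action of the matrix unit `T^ν_μ` on homogeneous jets. -/
def shiftCoef (ν μ : Fin N) (n m : MultiIdx N p) : ℕ :=
  if m.val + Pi.single ν 1 = n.val + Pi.single μ 1 then n.val ν else 0

/-- For `|m| = |n|` exactly one derivative falls on `ξ^μ`. If the term is nonzero, `m - μ = n - ν`
for a unique `ν`, and the binomial is `n_ν`. -/
theorem shiftTerm_eq (ξ : Diff N) (n m : MultiIdx N p) (h : ∑ μ, m.val μ = ∑ μ, n.val μ) (μ : Fin N) :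
    shiftTerm ξ n.val m.val μ = ∑ ν, (shiftCoef ν μ n m : Fun N) * pderiv ν (comp ξ μ) := by
  rw [shiftTerm]
  by_cases hm : 1 ≤ m.val μ
  · obtain ⟨k, hk⟩ := exists_eq_add_single hm
    have hs : ∑ ν, n.val ν = ∑ ν, k ν + 1 := by rw [← h, hk, sum_add_single]
    have hc : ∀ ν, m.val + Pi.single ν 1 = n.val + Pi.single μ 1 ↔ k + Pi.single ν 1 = n.val := by
      intro ν
      rw [hk, add_right_comm, add_left_inj]
    rw [if_pos ⟨hm, fun h' => by rw [hk, add_tsub_cancel_right] at h'; rw [h'] at hs; omega⟩, hk,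
      add_tsub_cancel_right]
    by_cases hle : k ≤ n.val
    · obtain ⟨ν, hν⟩ := exists_eq_add_single_of_le hle hs
      rw [Finset.sum_eq_single ν]
      · rw [shiftCoef, if_pos ((hc ν).2 hν), ← hν, add_tsub_cancel_left,
          ← zero_add (Pi.single ν 1 : Fin N → ℕ), partialD_add_single, partialD_zero, zero_add,
          multiChoose, ← Finset.mul_prod_erase _ _ (Finset.mem_univ ν), Finset.prod_eq_one]
        · simp
        · intro κ hκ
          simp [(Finset.mem_erase.1 hκ).1]
      · intro κ _ hκ
        rw [shiftCoef, if_neg, Nat.cast_zero, zero_mul]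
        rw [hc, ← hν, add_right_inj]
        intro h'
        have := congrFun h' κ
        simp [hκ] at this
      · simp
    · rw [multiChoose_eq_zero hle, Nat.cast_zero, zero_mul]
      refine (Finset.sum_eq_zero fun ν _ => ?_).symm
      rw [shiftCoef, if_neg, Nat.cast_zero, zero_mul]
      rw [hc]
      exact fun h' => hle (h' ▸ le_self_add)
  · rw [if_neg fun h' => hm h'.1]
    refine (Finset.sum_eq_zero fun ν _ => ?_).symm
    rw [shiftCoef]
    split_ifs with h'
    · have h1 := congrFun h' μ
      by_cases hν : ν = μ
      · subst hν
        simp only [Pi.add_apply, Pi.single_eq_same] at h1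
        rw [show n.val ν = 0 by omega, Nat.cast_zero, zero_mul]
      · simp only [Pi.add_apply, Pi.single_eq_same, Pi.single_eq_of_ne (Ne.symm hν)] at h1
        omega
    · rw [Nat.cast_zero, zero_mul]

theorem sum_shiftCoef (p : ℕ) (ν μ : Fin N) :
    (∑ n : MultiIdx N p, (shiftCoef ν μ n n : ℂ)) = if μ = ν then binom (N + p) (p - 1) else 0 := by
  by_cases h : μ = ν
  · subst h
    rw [if_pos rfl, ← sum_multiIdx_coord p μ]
    exact Finset.sum_congr rfl fun n _ => by rw [shiftCoef, if_pos rfl]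
  · rw [if_neg h]
    refine Finset.sum_eq_zero fun n _ => ?_
    rw [shiftCoef, if_neg, Nat.cast_zero]
    rw [add_right_inj]
    intro h'
    have := congrFun h' μ
    simp [h] at this

theorem single_add_single_eq {μ ν σ τ : Fin N}
    (h : (Pi.single ν 1 + Pi.single τ 1 : Fin N → ℕ) = Pi.single μ 1 + Pi.single σ 1) :
    (μ = ν ∧ σ = τ) ∨ (μ = τ ∧ σ = ν) := by
  have h1 := congrFun h ν
  have h2 := congrFun h μ
  have h3 := congrFun h τ
  have h4 := congrFun h σ
  simp only [Pi.add_apply, Pi.single_apply] at h1 h2 h3 h4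
  grind

/-- A nonzero term forces `m + ν = n + μ` and `n + τ = m + σ`, hence `ν + τ = μ + σ` as
multi-indices. So the upper and lower labels agree up to a permutation. -/
theorem sum_shiftCoef_mul (p : ℕ) (ν μ τ σ : Fin N) :
    (∑ n : MultiIdx N p, ∑ m : MultiIdx N p, (shiftCoef ν μ n m * shiftCoef τ σ m n : ℂ))
      = (if μ = τ ∧ σ = ν then binom (N + p + 1) (p - 1) else 0)
        + if μ = ν ∧ σ = τ then binom (N + p) (p - 2) else 0 := by
  have hself : ∀ (ν : Fin N) (n m : MultiIdx N p), m ≠ n → shiftCoef ν ν n m = 0 := by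
    intro ν n m h
    rw [shiftCoef, if_neg]
    rw [add_left_inj]
    exact fun h' => h (Subtype.ext (funext fun μ => Fin.ext (congrFun h' μ)))
  rw [← binom_add_binom]
  by_cases h1 : μ = ν ∧ σ = τ
  · obtain ⟨rfl, rfl⟩ := h1
    have : ∀ n : MultiIdx N p, ∑ m : MultiIdx N p, (shiftCoef μ μ n m * shiftCoef σ σ m n : ℂ)
        = n.val μ * n.val σ := by
      intro n
      rw [Finset.sum_eq_single n]
      · simp [shiftCoef]
      · intro m _ hm
        rw [hself μ n m hm, Nat.cast_zero, zero_mul]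
      · simp
    rw [Finset.sum_congr rfl fun n _ => this n, sum_multiIdx_coord_mul]
    by_cases h : μ = σ
    · subst h; simp; ring
    · simp [h]
  by_cases h2 : μ = τ ∧ σ = ν
  · obtain ⟨rfl, rfl⟩ := h2
    have hne : σ ≠ μ := fun h => h1 ⟨h.symm, h⟩
    -- The only intermediate index is `m = n - σ + μ`, with `m_μ = n_μ + 1`, so the product is `n_σ
    -- (n_μ + 1)`.
    have : ∀ n : MultiIdx N p, ∑ m : MultiIdx N p, (shiftCoef σ μ n m * shiftCoef μ σ m n : ℂ)
        = n.val σ * n.val μ + n.val σ := by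
      intro n
      by_cases h0 : 1 ≤ n.val σ
      · obtain ⟨k, hk⟩ := exists_eq_add_single h0
        have h3 := sum_multiIdx (p := p) (fun m => (((if m + Pi.single σ 1 = n.val + Pi.single μ 1 then
          n.val σ else 0 : ℕ) : ℂ) * ((if n.val + Pi.single μ 1 = m + Pi.single σ 1 then
          m μ else 0 : ℕ) : ℂ))) {k + Pi.single μ 1} ?_ ?_
        · refine Eq.trans ?_ (h3.trans ?_)
          · rfl
          · rw [Finset.sum_singleton, if_pos (by rw [hk, add_right_comm]),
              if_pos (by rw [hk, add_right_comm]), hk]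
            simp [hne.symm]
            ring
        · intro m hm _
          rw [Finset.mem_singleton.1 hm, sum_add_single]
          have := n.2
          change ∑ μ, n.val μ ≤ p at this
          rwa [hk, sum_add_single] at this
        · intro m _ hm
          rw [Finset.mem_singleton]
          by_contra hne'
          rw [if_neg] at hm
          · simp at hm
          · rw [hk, add_right_comm, add_left_inj]
            exact hne'
      · have h0 : n.val σ = 0 := by omega
        rw [h0]
        refine (Finset.sum_eq_zero fun m _ => ?_).trans (by simp)
        rw [shiftCoef, h0]
        simp
    rw [Finset.sum_congr rfl fun n _ => this n, Finset.sum_add_distrib, sum_multiIdx_coord_mul,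
      sum_multiIdx_coord]
    simp [hne, hne.symm]
  · rw [if_neg h1, if_neg h2, add_zero]
    refine Finset.sum_eq_zero fun n _ => Finset.sum_eq_zero fun m _ => ?_
    by_contra h0
    rw [← Nat.cast_mul, Nat.cast_eq_zero, mul_eq_zero, not_or, shiftCoef, shiftCoef] at h0
    have e1 := (ite_ne_right_iff.1 h0.1).1
    have e2 := (ite_ne_right_iff.1 h0.2).1
    have e3 : (Pi.single ν 1 + Pi.single τ 1 : Fin N → ℕ) = Pi.single μ 1 + Pi.single σ 1 := by
      have := congrArg₂ (· + ·) e1 e2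
      have h5 : (m.val + n.val) + (Pi.single ν 1 + Pi.single τ 1 : Fin N → ℕ)
          = (m.val + n.val) + (Pi.single μ 1 + Pi.single σ 1) := by
        rw [add_add_add_comm]
        refine this.trans ?_
        rw [add_add_add_comm, add_comm n.val]
      exact add_left_cancel h5
    rcases single_add_single_eq e3 with h | h
    · exact h1 h
    · exact h2 h

end

/-! ### Traces of the jet matrices. -/

section
variable {N p : ℕ} {ι : Type*} [Fintype ι] [DecidableEq ι]
  (ϱ : Matrix (Fin N) (Fin N) ℂ →ₗ⁅ℂ⁆ Matrix ι ι ℂ)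

/-- The image of the matrix unit `T^ν_μ` in the representation on homogeneous jets. -/
def jetUnit (ν μ : Fin N) (a b : JetIdx N p ι) : ℂ :=
  (if a.2 = b.2 then rhoT ϱ ν μ a.1 b.1 else 0) + if a.1 = b.1 then (shiftCoef ν μ a.2 b.2 : ℂ) else 0

theorem multiIdx_eq_of_le {n m : MultiIdx N p} (hle : m.val ≤ n.val)
    (h : ∑ μ, n.val μ ≤ ∑ μ, m.val μ) : n = m := by
  by_contra hne
  refine absurd (Finset.sum_lt_sum (fun μ _ => hle μ) ?_) (not_lt.2 h)
  by_contra! hc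
  exact hne (Subtype.ext (funext fun μ => Fin.ext (le_antisymm (hc μ (Finset.mem_univ μ)) (hle μ))))

/-- Between jets of equal order only first derivatives of `ξ` remain, so the matrix is linear in the
Jacobian and is the action of `gl(N)` on `V` tensored with homogeneous jets. -/
theorem jetT_eq_sum (ξ : Diff N) (a b : JetIdx N p ι) (h : ∑ μ, b.2.val μ = ∑ μ, a.2.val μ) :
    jetT ϱ ξ a b = ∑ μ, ∑ ν, pderiv ν (comp ξ μ) * MvPolynomial.C (jetUnit ϱ ν μ a b) := by
  have h1 : ∀ μ ν, (multiChoose a.2.val b.2.val : Fun N) *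
      partialD (a.2.val - b.2.val) (pderiv ν (comp ξ μ)) * MvPolynomial.C (rhoT ϱ ν μ a.1 b.1)
      = pderiv ν (comp ξ μ) * MvPolynomial.C (if a.2 = b.2 then rhoT ϱ ν μ a.1 b.1 else 0) := by
    intro μ ν
    by_cases hnm : a.2 = b.2
    · rw [if_pos hnm, hnm, multiChoose_self, tsub_self, partialD_zero, Nat.cast_one, one_mul]
      rfl
    · rw [if_neg hnm, map_zero, mul_zero, multiChoose_eq_zero fun hle =>
        hnm (multiIdx_eq_of_le hle h.ge), Nat.cast_zero, zero_mul, zero_mul]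
  have h2 : (if a.1 = b.1 then ∑ μ, shiftTerm ξ a.2.val b.2.val μ else 0)
      = ∑ μ, ∑ ν, pderiv ν (comp ξ μ) *
        MvPolynomial.C (if a.1 = b.1 then (shiftCoef ν μ a.2 b.2 : ℂ) else 0) := by
    split_ifs
    · refine Finset.sum_congr rfl fun μ _ => ?_
      rw [shiftTerm_eq ξ a.2 b.2 h]
      exact Finset.sum_congr rfl fun ν _ => by rw [map_natCast, mul_comm]
    · simp
  rw [jetT, Tmat_apply, h2, Finset.sum_congr rfl fun μ _ => Finset.sum_congr rfl fun ν _ => h1 μ ν,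
    ← Finset.sum_add_distrib]
  refine Finset.sum_congr rfl fun μ _ => ?_
  rw [← Finset.sum_add_distrib]
  exact Finset.sum_congr rfl fun ν _ => by rw [jetUnit, map_add, mul_add]

/-- The action never raises the order of a jet: each term needs `m ≤ n`, or `m - μ ≤ n` with `m - μ
≠ n`. -/
theorem jetT_eq_zero (ξ : Diff N) (a b : JetIdx N p ι) (h : ∑ μ, a.2.val μ < ∑ μ, b.2.val μ) :
    jetT ϱ ξ a b = 0 := by
  obtain ⟨β, n⟩ := a
  obtain ⟨α, m⟩ := b
  have h1 : multiChoose n.val m.val = 0 := multiChoose_eq_zero fun hle =>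
    absurd (Finset.sum_le_sum fun μ _ => hle μ) (not_le.2 h)
  have h2 : ∀ μ, shiftTerm ξ n.val m.val μ = 0 := by
    intro μ
    rw [shiftTerm]
    refine ite_eq_right_iff.2 fun hc => ?_
    rw [multiChoose_eq_zero, Nat.cast_zero, zero_mul]
    intro hle
    obtain ⟨k, hk⟩ := exists_eq_add_single hc.1
    rw [hk, add_tsub_cancel_right] at hle hc
    rw [hk, sum_add_single] at h
    refine hc.2 (le_antisymm hle ?_)
    by_contra hnot
    obtain ⟨ν, hν⟩ := not_forall.1 hnot
    have := Finset.sum_lt_sum (fun μ _ => hle μ) ⟨ν, Finset.mem_univ ν, not_le.1 hν⟩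
    change ∑ μ, n.val μ < _ at h
    omega
  simp [jetT, Tmat_apply, h1, h2]

theorem jetUnit_eq_zero (ν μ : Fin N) (a b : JetIdx N p ι) (h : ∑ μ, b.2.val μ ≠ ∑ μ, a.2.val μ) :
    jetUnit ϱ ν μ a b = 0 := by
  have h1 : a.2 ≠ b.2 := fun h' => h (by rw [h'])
  have h2 : shiftCoef ν μ a.2 b.2 = 0 := by
    rw [shiftCoef, if_neg]
    intro h'
    have := congrArg (fun f : Fin N → ℕ => ∑ μ, f μ) h'
    simp only [sum_add_single] at this
    omega
  simp [jetUnit, h1, h2]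

variable {k₀ k₁ k₂ : ℂ} (hk : IsTraceData ϱ k₀ k₁ k₂)

include hk in
theorem sum_jetUnit (ν μ : Fin N) : ∑ a : JetIdx N p ι, jetUnit ϱ ν μ a a
    = if μ = ν then binom (N + p) p * k₀ + binom (N + p) (p - 1) * Fintype.card ι else 0 := by
  have h : ∑ β, rhoT ϱ ν μ β β = if μ = ν then k₀ else 0 := by
    have := hk.1 ν μ
    simpa [Matrix.trace, eq_comm] using this
  rw [Fintype.sum_prod_type_right]
  simp only [jetUnit, if_true, Finset.sum_add_distrib, h, Finset.sum_const, Finset.card_univ]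
  rw [← Finset.smul_sum, sum_shiftCoef, binom_card, nsmul_eq_mul, nsmul_eq_mul]
  split_ifs <;> ring

include hk in
-- The units have the form `ϱ ⊗ 1 + 1 ⊗ S`. The two pure terms give `k₁`, `k₂` and the binomials of
-- `sum_shiftCoef_mul`; the two mixed terms are products of single traces and give `2 k₀`.
theorem sum_jetUnit_mul (ν μ τ σ : Fin N) :
    ∑ a : JetIdx N p ι, ∑ b : JetIdx N p ι, jetUnit ϱ ν μ a b * jetUnit ϱ τ σ b a
    = (if μ = τ ∧ σ = ν then binom (N + p) p * k₁ + binom (N + p + 1) (p - 1) * Fintype.card ι else 0)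
      + if μ = ν ∧ σ = τ then binom (N + p) p * k₂ + binom (N + p) (p - 2) * Fintype.card ι
        + 2 * binom (N + p) (p - 1) * k₀ else 0 := by
  have h0 : ∀ ν μ, ∑ β, rhoT ϱ ν μ β β = if μ = ν then k₀ else 0 := by
    intro ν μ
    have := hk.1 ν μ
    simpa [Matrix.trace, eq_comm] using this
  have h1 : ∑ β, ∑ α, rhoT ϱ ν μ β α * rhoT ϱ τ σ α β
      = (if μ = τ ∧ σ = ν then k₁ else 0) + if μ = ν ∧ σ = τ then k₂ else 0 := by
    have := hk.2 ν μ τ σ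
    simp only [Matrix.trace, Matrix.diag, Matrix.mul_apply] at this
    rw [this]
    congr 1
    · simp only [eq_comm (a := ν), eq_comm (a := τ), and_comm]
    · simp only [eq_comm (a := ν), eq_comm (a := τ)]
  have e : ∑ a : JetIdx N p ι, ∑ b : JetIdx N p ι, jetUnit ϱ ν μ a b * jetUnit ϱ τ σ b a
      = (∑ n : MultiIdx N p, ∑ β, ∑ α, rhoT ϱ ν μ β α * rhoT ϱ τ σ α β)
        + (∑ n : MultiIdx N p, ∑ β, rhoT ϱ ν μ β β * (shiftCoef τ σ n n : ℂ))
        + (∑ n : MultiIdx N p, ∑ β, (shiftCoef ν μ n n : ℂ) * rhoT ϱ τ σ β β)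
        + ∑ n : MultiIdx N p, ∑ β : ι, ∑ m : MultiIdx N p, (shiftCoef ν μ n m * shiftCoef τ σ m n : ℂ) := by
    rw [Fintype.sum_prod_type_right, ← Finset.sum_add_distrib, ← Finset.sum_add_distrib,
      ← Finset.sum_add_distrib]
    refine Finset.sum_congr rfl fun n _ => ?_
    rw [← Finset.sum_add_distrib, ← Finset.sum_add_distrib, ← Finset.sum_add_distrib]
    refine Finset.sum_congr rfl fun β _ => ?_
    simp only [jetUnit, add_mul, mul_add, Finset.sum_add_distrib]
    have e1 : ∑ b : JetIdx N p ι, (if n = b.2 then rhoT ϱ ν μ β b.1 else 0) *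
        (if b.2 = n then rhoT ϱ τ σ b.1 β else 0) = ∑ α, rhoT ϱ ν μ β α * rhoT ϱ τ σ α β := by
      rw [Fintype.sum_prod_type]
      refine Finset.sum_congr rfl fun α _ => ?_
      rw [Finset.sum_eq_single n] <;> simp +contextual [eq_comm]
    have e2 : ∑ b : JetIdx N p ι, (if n = b.2 then rhoT ϱ ν μ β b.1 else 0) *
        (if b.1 = β then (shiftCoef τ σ b.2 n : ℂ) else 0) = rhoT ϱ ν μ β β * shiftCoef τ σ n n := by
      rw [Finset.sum_eq_single (β, n)]
      · simp
      · rintro ⟨α, m⟩ - hb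
        by_cases h1 : n = m
        · have : α ≠ β := fun h => hb (by rw [h, h1])
          simp [this]
        · simp [h1]
      · simp
    have e3 : ∑ b : JetIdx N p ι, (if β = b.1 then (shiftCoef ν μ n b.2 : ℂ) else 0) *
        (if b.2 = n then rhoT ϱ τ σ b.1 β else 0) = shiftCoef ν μ n n * rhoT ϱ τ σ β β := by
      rw [Finset.sum_eq_single (β, n)]
      · simp
      · rintro ⟨α, m⟩ - hb
        by_cases h1 : m = n
        · have : β ≠ α := fun h => hb (by rw [h, h1])
          simp [this]
        · simp [h1]
      · simp
    have e4 : ∑ b : JetIdx N p ι, (if β = b.1 then (shiftCoef ν μ n b.2 : ℂ) else 0) *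
        (if b.1 = β then (shiftCoef τ σ b.2 n : ℂ) else 0)
        = ∑ m : MultiIdx N p, (shiftCoef ν μ n m * shiftCoef τ σ m n : ℂ) := by
      rw [Fintype.sum_prod_type_right]
      refine Finset.sum_congr rfl fun m _ => ?_
      rw [Finset.sum_eq_single β] <;> simp +contextual [eq_comm]
    rw [e1, e2, e3, e4]
    ring
  rw [e]
  simp only [← Finset.sum_mul, ← Finset.mul_sum, h0, h1, Finset.sum_const, Finset.card_univ,
    sum_shiftCoef, sum_shiftCoef_mul, nsmul_eq_mul]
  rw [binom_card]
  by_cases h2 : μ = ν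
  · by_cases h3 : σ = τ
    · simp only [h2, h3, if_true, and_self]
      split_ifs <;> ring
    · simp only [h2, h3, if_true, if_false, and_false]
      split_ifs <;> ring
  · simp only [h2, if_false, false_and]
    split_ifs <;> ring

include hk in
theorem sum_jetT (ξ : Diff N) : ∑ a : JetIdx N p ι, jetT ϱ ξ a a
    = (binom (N + p) p * k₀ + binom (N + p) (p - 1) * Fintype.card ι) • divergence ξ := by
  rw [Finset.sum_congr rfl fun a _ => jetT_eq_sum ϱ ξ a a rfl, Finset.sum_comm, divergence,
    Finset.smul_sum]
  refine Finset.sum_congr rfl fun μ _ => ?_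
  rw [Finset.sum_comm]
  simp only [← Finset.mul_sum, ← map_sum, sum_jetUnit ϱ hk, apply_ite MvPolynomial.C, map_zero,
    mul_ite, mul_zero, Finset.sum_ite_eq, Finset.mem_univ, if_true]
  rw [mul_comm, MvPolynomial.smul_eq_C_mul]

theorem atQ_C_mul (c : ℂ) (h : Fun N) : (atQ (h * MvPolynomial.C c) : Loc N) = c • atQ h := by
  rw [mul_comm, ← MvPolynomial.smul_eq_C_mul, map_smul]

include hk in
theorem sum_jetT_mul (x y : Diff N × Diff1) :
    ∑ a : JetIdx N p ι, ∑ b : JetIdx N p ι, totalD N (atQ (jetT ϱ x.1 a b)) * atQ (jetT ϱ y.1 b a)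
    = (binom (N + p) p * k₁ + binom (N + p + 1) (p - 1) * Fintype.card ι) • dens1 x y
      + (binom (N + p) p * k₂ + binom (N + p) (p - 2) * Fintype.card ι
        + 2 * binom (N + p) (p - 1) * k₀) • dens2 x y := by
  have e : ∀ a b : JetIdx N p ι, totalD N (atQ (jetT ϱ x.1 a b)) * atQ (jetT ϱ y.1 b a)
      = ∑ μ, ∑ ν, ∑ σ, ∑ τ, (jetUnit ϱ ν μ a b * jetUnit ϱ τ σ b a) •
        (totalD N (jacQ x μ ν) * jacQ y σ τ) := by
    intro a b
    rcases eq_or_ne (∑ μ, b.2.val μ) (∑ μ, a.2.val μ) with h | h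
    · rw [jetT_eq_sum ϱ x.1 a b h, jetT_eq_sum ϱ y.1 b a h.symm]
      simp only [map_sum, atQ_C_mul, Derivation.map_smul, Finset.sum_mul]
      simp only [Finset.mul_sum, smul_mul_smul_comm]
      rfl
    -- For jets of different order one of the two factors vanishes by triangularity.
    · simp only [jetUnit_eq_zero ϱ _ _ a b h, zero_mul, zero_smul, Finset.sum_const_zero]
      rcases lt_or_gt_of_ne h with h | h
      · rw [jetT_eq_zero ϱ y.1 b a h, map_zero, mul_zero]
      · rw [jetT_eq_zero ϱ x.1 a b h, map_zero, map_zero, zero_mul]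
  have hs : ∀ f : JetIdx N p ι → JetIdx N p ι → Fin N → Loc N,
      ∑ a, ∑ b, ∑ μ, f a b μ = ∑ μ, ∑ a, ∑ b, f a b μ := fun f => by
    rw [Finset.sum_congr rfl fun a _ => Finset.sum_comm, Finset.sum_comm]
  have hc : ∑ a : JetIdx N p ι, ∑ b : JetIdx N p ι, totalD N (atQ (jetT ϱ x.1 a b)) *
      atQ (jetT ϱ y.1 b a) = ∑ μ, ∑ ν, ∑ σ, ∑ τ, (∑ a : JetIdx N p ι, ∑ b : JetIdx N p ι,
        jetUnit ϱ ν μ a b * jetUnit ϱ τ σ b a) • (totalD N (jacQ x μ ν) * jacQ y σ τ) := by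
    rw [Finset.sum_congr rfl fun a _ => Finset.sum_congr rfl fun b _ => e a b, hs]
    refine Finset.sum_congr rfl fun μ _ => ?_
    rw [hs]
    refine Finset.sum_congr rfl fun ν _ => ?_
    rw [hs]
    refine Finset.sum_congr rfl fun σ _ => ?_
    rw [hs]
    refine Finset.sum_congr rfl fun τ _ => ?_
    simp only [Finset.sum_smul]
  rw [hc]
  simp only [sum_jetUnit_mul ϱ hk]
  generalize binom (N + p) p * k₁ + binom (N + p + 1) (p - 1) * Fintype.card ι = c₁
  generalize binom (N + p) p * k₂ + binom (N + p) (p - 2) * Fintype.card ι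
        + 2 * binom (N + p) (p - 1) * k₀ = c₂
  simp only [add_smul, Finset.sum_add_distrib]
  congr 1
  · rw [dens1_eq, Matrix.trace, Finset.smul_sum]
    refine Finset.sum_congr rfl fun μ _ => ?_
    rw [Matrix.diag, Matrix.mul_apply, Finset.smul_sum]
    refine Finset.sum_congr rfl fun ν _ => ?_
    rw [Finset.sum_eq_single ν, Finset.sum_eq_single μ]
    · simp [matD]
    · intro τ _ h; simp [Ne.symm h]
    · simp
    · intro σ _ h; simp [h]
    · simp
  · have hd : ∀ x : Diff N × Diff1, divQ x = ∑ μ, jacQ x μ μ := by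
      intro x
      rw [divQ, divergence, map_sum]
      rfl
    rw [dens2_eq, hd, hd, map_sum, Finset.sum_mul_sum, Finset.smul_sum]
    refine Finset.sum_congr rfl fun μ _ => ?_
    rw [Finset.sum_eq_single μ, Finset.smul_sum]
    · refine Finset.sum_congr rfl fun σ _ => ?_
      rw [Finset.sum_eq_single σ]
      · simp
      · intro τ _ h; simp [Ne.symm h]
      · simp
    · intro ν _ h; simp [Ne.symm h]
    · simp

end

/-! ### The integral of the anomaly density -/

section
variable {N : ℕ}

theorem block_identity {V : Type*} [AddCommGroup V] [Module ℂ V] (n : ℂ) (a b c d e w : V) :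
    Complex.I • a + (1 / 2 : ℂ) • (Complex.I • b + c) - (1 / 2 : ℂ) • (Complex.I • d + e) + n • w
      = Complex.I • a + (Complex.I / 2) • (b - d) + (1 / 2 : ℂ) • (c - e) + n • w := by
  module

theorem integral_totalD (P : Loc N) : integral (totalD N P) = 0 := integral_eq_zero rfl

theorem integral_totalD_mul (P Q : Loc N) :
    integral (totalD N P * Q) = -integral (P * totalD N Q) := by
  have h := integral_totalD (P * Q)
  rw [Derivation.leibniz, smul_eq_mul, smul_eq_mul, map_add, mul_comm Q] at h
  exact eq_neg_of_add_eq_zero_right h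

theorem integral_dt_mul (f g : Trig) : integral (MvPolynomial.C (dt f * g) : Loc N)
    = -integral (MvPolynomial.C (f * dt g) : Loc N) := by
  have h := integral_totalD_mul (MvPolynomial.C f : Loc N) (MvPolynomial.C g)
  rwa [totalD_C, totalD_C, ← map_mul, ← map_mul] at h

/-- The sum of the loop densities over a block of fields. -/
theorem sum_loopDensity {K : Type*} [Fintype K] [DecidableEq K] (A B : K → K → Loc N) (β γ : Trig) :
    ∑ i, ∑ j, loopDensity (A i j) (if j = i then MvPolynomial.C β else 0) (B j i)
        (if i = j then MvPolynomial.C γ else 0)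
      = Complex.I • ∑ i, ∑ j, totalD N (A i j) * B j i
        + (1 / 2 : ℂ) • (MvPolynomial.C (dt (dt β) - Complex.I • dt β) * ∑ i, B i i)
        - (1 / 2 : ℂ) • ((totalD N (totalD N (∑ i, A i i)) + Complex.I • totalD N (∑ i, A i i))
            * MvPolynomial.C γ)
        + (Fintype.card K * (Complex.I / 6)) • MvPolynomial.C ((dt (dt (dt β)) + dt β) * γ) := by
  have e : ∀ i j, loopDensity (A i j) (if j = i then MvPolynomial.C β else 0) (B j i)
        (if i = j then MvPolynomial.C γ else 0)
      = Complex.I • (totalD N (A i j) * B j i) + if j = i then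
        (1 / 2 : ℂ) • (MvPolynomial.C (dt (dt β) - Complex.I • dt β) * B i i)
        - (1 / 2 : ℂ) • ((totalD N (totalD N (A i i)) + Complex.I • totalD N (A i i))
            * MvPolynomial.C γ)
        + (Complex.I / 6) • MvPolynomial.C ((dt (dt (dt β)) + dt β) * γ) else 0 := by
    intro i j
    by_cases h : j = i
    · subst h
      simp only [if_true, loopDensity, totalD_C, map_sub, map_add, map_mul, C_smul_trig]
      abel
    · rw [if_neg h, if_neg fun h' => h h'.symm, if_neg h]
      simp [loopDensity]
  have e' : ∀ i, ∑ j, loopDensity (A i j) (if j = i then MvPolynomial.C β else 0) (B j i)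
        (if i = j then MvPolynomial.C γ else 0)
      = Complex.I • ∑ j, totalD N (A i j) * B j i +
        ((1 / 2 : ℂ) • (MvPolynomial.C (dt (dt β) - Complex.I • dt β) * B i i)
        - (1 / 2 : ℂ) • ((totalD N (totalD N (A i i)) + Complex.I • totalD N (A i i))
            * MvPolynomial.C γ)
        + (Complex.I / 6) • MvPolynomial.C ((dt (dt (dt β)) + dt β) * γ)) := by
    intro i
    rw [Finset.sum_congr rfl fun j _ => e i j, Finset.sum_add_distrib, ← Finset.smul_sum,
      Finset.sum_ite_eq' Finset.univ i, if_pos (Finset.mem_univ i)]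
  rw [Finset.sum_congr rfl fun i _ => e' i, Finset.sum_add_distrib, Finset.sum_add_distrib,
    Finset.sum_sub_distrib, ← Finset.smul_sum, ← Finset.smul_sum, ← Finset.smul_sum, ← Finset.mul_sum,
    ← Finset.sum_mul, Finset.sum_add_distrib, ← Finset.smul_sum, ← map_sum, ← map_sum,
    Finset.sum_const, Finset.card_univ, ← Nat.cast_smul_eq_nsmul ℂ, smul_smul, ← add_assoc,
    ← add_sub_assoc]

/-- The second-order terms of the loop density become symmetric after integration by parts. The
factor `i` in the first-order coefficients turns the cubic term into the density of the fourth
cocycle. -/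
theorem integral_sum_loopDensity {K : Type*} [Fintype K] [DecidableEq K] (A B : K → K → Loc N)
    (f h : Trig) :
    integral (∑ i, ∑ j, loopDensity (A i j) (if j = i then MvPolynomial.C (Complex.I • f) else 0)
        (B j i) (if i = j then MvPolynomial.C (Complex.I • h) else 0))
      = Complex.I • integral (∑ i, ∑ j, totalD N (A i j) * B j i)
        + (1 / 2 : ℂ) • integral (MvPolynomial.C (Complex.I • dt (dt f) + dt f) * ∑ i, B i i)
        - (1 / 2 : ℂ) • integral (MvPolynomial.C (Complex.I • dt (dt h) + dt h) * ∑ i, A i i)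
        + (Fintype.card K * (Complex.I / 6)) • integral
          (MvPolynomial.C (dt (dt f) * dt h - dt f * h) : Loc N) := by
  have e2 : dt (dt (Complex.I • f)) - Complex.I • dt (Complex.I • f)
      = Complex.I • dt (dt f) + dt f := by
    simp only [Derivation.map_smul, smul_smul, Complex.I_mul_I]
    rw [neg_smul, one_smul, sub_neg_eq_add]
  have e3 : integral ((totalD N (totalD N (∑ i, A i i)) + Complex.I • totalD N (∑ i, A i i))
            * MvPolynomial.C (Complex.I • h))
      = integral (MvPolynomial.C (Complex.I • dt (dt h) + dt h) * ∑ i, A i i) := by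
    have h1 : integral (totalD N (totalD N (∑ i, A i i)) * MvPolynomial.C (Complex.I • h))
        = Complex.I • integral (MvPolynomial.C (dt (dt h)) * ∑ i, A i i) := by
      rw [integral_totalD_mul, totalD_C, integral_totalD_mul, totalD_C, neg_neg, mul_comm,
        Derivation.map_smul, Derivation.map_smul, C_smul_trig, smul_mul_assoc, LinearMap.map_smul]
    have h2 : integral ((Complex.I • totalD N (∑ i, A i i)) * MvPolynomial.C (Complex.I • h))
        = integral (MvPolynomial.C (dt h) * ∑ i, A i i) := by
      rw [C_smul_trig, smul_mul_smul_comm, Complex.I_mul_I, neg_smul, one_smul, map_neg,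
        integral_totalD_mul, totalD_C, neg_neg, mul_comm]
    rw [add_mul, map_add, h1, h2, map_add, C_smul_trig, add_mul, map_add, smul_mul_assoc,
      LinearMap.map_smul]
  have e4 : integral (MvPolynomial.C ((dt (dt (dt (Complex.I • f))) + dt (Complex.I • f))
        * (Complex.I • h)) : Loc N)
      = integral (MvPolynomial.C (dt (dt f) * dt h - dt f * h) : Loc N) := by
    simp only [Derivation.map_smul, ← smul_add, smul_mul_smul_comm, Complex.I_mul_I]
    rw [neg_smul, one_smul, add_mul, map_neg, map_add, map_neg, map_add, integral_dt_mul, map_sub,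
      map_sub]
    abel
  rw [sum_loopDensity, map_add, map_sub, map_add, integral.map_smul, integral.map_smul,
    integral.map_smul, integral.map_smul, e2, e3, e4]

variable {A : Type*} [Fintype A] [DecidableEq A]

/-- Only the two diagonal blocks contribute. In the `q`-block the zeroth-order symbol is the
Jacobian of `ξ`, whose loop reproduces the four basic cocycles directly. -/
theorem integral_anomalyDensity (σ : ℂ) (x y : Diff N × Diff1) (M M' : A → A → Fun N) (g g' : Trig) :
    integral (anomalyDensity σ x y M M' g g')
      = -(Complex.I • integral (dens1 x y) + (Complex.I / 2) • integral (dens3 x y)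
          + (1 / 2 : ℂ) • integral (densA x y) + (N * (Complex.I / 6)) • integral (dens4 x y))
        - σ • (Complex.I • integral (∑ a, ∑ b, totalD N (jetMat M g a b) * jetMat M' g' b a)
          + (1 / 2 : ℂ) • integral (MvPolynomial.C (Complex.I • dt (dt (fcoef x.2)) + dt (fcoef x.2))
            * ∑ a, jetMat M' g' a a)
          - (1 / 2 : ℂ) • integral (MvPolynomial.C (Complex.I • dt (dt (fcoef y.2)) + dt (fcoef y.2))
            * ∑ a, jetMat M g a a)
          + (Fintype.card A * (Complex.I / 6)) • integral (dens4 x y)) := by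
  have e : anomalyDensity σ x y M M' g g'
      = -(∑ i, ∑ j, loopDensity (jacQ x i j)
          (if j = i then MvPolynomial.C (Complex.I • fcoef x.2) else 0) (jacQ y j i)
          (if i = j then MvPolynomial.C (Complex.I • fcoef y.2) else 0))
        - σ • ∑ i, ∑ j, loopDensity (jetMat M g i j)
          (if j = i then MvPolynomial.C (Complex.I • fcoef x.2) else 0) (jetMat M' g' j i)
          (if i = j then MvPolynomial.C (Complex.I • fcoef y.2) else 0) := by
    have h0 : loopDensity (0 : Loc N) 0 0 0 = 0 := by simp [loopDensity]
    rw [anomalyDensity, Fintype.sum_prod_type, Fintype.sum_sum_type]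
    simp only [Fintype.sum_sum_type, linZero, linOne, reduceCtorEq, if_false, h0,
      Finset.sum_const_zero, add_zero, zero_add, pairSign, one_smul, Sum.inl.injEq, Sum.inr.injEq,
      ← Finset.smul_sum]
    rw [neg_add, sub_eq_add_neg]
    rfl
  have hd : ∑ i, jacQ y i i = divQ y := by
    rw [divQ, divergence, map_sum]; rfl
  have hd' : ∑ i, jacQ x i i = divQ x := by
    rw [divQ, divergence, map_sum]; rfl
  have h1 : ∑ i, ∑ j, totalD N (jacQ x i j) * jacQ y j i = dens1 x y := by
    rw [dens1_eq]; rfl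
  have e3 : dens3 x y = MvPolynomial.C (dt (dt (fcoef x.2))) * divQ y
    - MvPolynomial.C (dt (dt (fcoef y.2))) * divQ x := rfl
  have eA : densA x y = MvPolynomial.C (dt (fcoef x.2)) * divQ y
    - MvPolynomial.C (dt (fcoef y.2)) * divQ x := rfl
  have h2 : ∀ (f : Trig) (u : Loc N), integral (MvPolynomial.C (Complex.I • dt (dt f) + dt f) * u)
      = Complex.I • integral (MvPolynomial.C (dt (dt f)) * u)
        + integral (MvPolynomial.C (dt f) * u) := by
    intro f u
    rw [map_add, C_smul_trig, add_mul, map_add, smul_mul_assoc, integral.map_smul]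
  have hq := integral_sum_loopDensity (fun i j => jacQ x i j) (fun i j => jacQ y i j) (fcoef x.2)
    (fcoef y.2)
  rw [hd, hd', h1, Fintype.card_fin, h2, h2, block_identity, ← map_sub, ← map_sub, ← e3, ← eA] at hq
  rw [e, map_sub, map_neg, integral.map_smul, hq, integral_sum_loopDensity]
  rfl

end

/-! ### The action of `diff(N) ⊕ diff(1)` on the jet fields. -/

section
variable {N p : ℕ} {ι : Type*} [Fintype ι] [DecidableEq ι]
  (ϱ : Matrix (Fin N) (Fin N) ℂ →ₗ⁅ℂ⁆ Matrix ι ι ℂ) (lam w : ℂ)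

/-- The matrix of the variation of the jet fields under a vector field. -/
def jetVariation (ξ : Diff N) (a b : JetIdx N p ι) : Fun N := -jetT ϱ ξ a b

/-- The function `i w f - λ f'`. -/
def weightCoef (f : Trig) : Trig := (Complex.I * w) • f - lam • dt f

theorem dt_weightCoef (f : Trig) : dt (weightCoef lam w f) = weightCoef lam w (dt f) := by
  rw [weightCoef, map_sub, Derivation.map_smul, Derivation.map_smul]
  rfl

/-- Both `f ↦ f` and `f ↦ f'` are 1-cocycles of `diff(1)` with values in functions on the circle,
hence so is their combination. -/
theorem weightCoef_lie (f h : Trig) : weightCoef lam w (f * dt h - h * dt f)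
    = f * dt (weightCoef lam w h) - h * dt (weightCoef lam w f) := by
  simp only [weightCoef, map_sub, Derivation.map_smul, Derivation.leibniz, smul_eq_mul, mul_sub,
    mul_smul_comm, smul_sub, smul_add, mul_comm (dt h) (dt f)]
  abel

theorem atQ_diff_apply (x : Diff N × Diff1) (h : Fun N) : atQ (x.1 h)
    = act x (atQ h) + MvPolynomial.C (fcoef x.2) * totalD N (atQ h) := by
  rw [act_atQ, sub_add_cancel]

/-- This supplies the closure condition of `op_comm`: `jetT_lie` accounts for the matrix part,
`weightCoef_lie` for the scalar part, and scalars drop out of the matrix commutator. -/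
theorem jetMat_lie (x y : Diff N × Diff1) (a b : JetIdx N p ι) :
    jetMat (jetVariation ϱ ⁅x, y⁆.1) (weightCoef lam w (fcoef ⁅x, y⁆.2)) a b
      = act x (jetMat (jetVariation ϱ y.1) (weightCoef lam w (fcoef y.2)) a b)
        - act y (jetMat (jetVariation ϱ x.1) (weightCoef lam w (fcoef x.2)) a b)
      + ∑ c, (jetMat (jetVariation ϱ y.1) (weightCoef lam w (fcoef y.2)) a c
            * jetMat (jetVariation ϱ x.1) (weightCoef lam w (fcoef x.2)) c b
          - jetMat (jetVariation ϱ x.1) (weightCoef lam w (fcoef x.2)) a c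
            * jetMat (jetVariation ϱ y.1) (weightCoef lam w (fcoef y.2)) c b)
      + MvPolynomial.C (fcoef x.2) *
          totalD N (jetMat (jetVariation ϱ y.1) (weightCoef lam w (fcoef y.2)) a b)
      - MvPolynomial.C (fcoef y.2) *
          totalD N (jetMat (jetVariation ϱ x.1) (weightCoef lam w (fcoef x.2)) a b) := by
  have h1 : ∑ c, (jetMat (jetVariation ϱ y.1) (weightCoef lam w (fcoef y.2)) a c
            * jetMat (jetVariation ϱ x.1) (weightCoef lam w (fcoef x.2)) c b
          - jetMat (jetVariation ϱ x.1) (weightCoef lam w (fcoef x.2)) a c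
            * jetMat (jetVariation ϱ y.1) (weightCoef lam w (fcoef y.2)) c b)
      = -atQ (∑ c, (jetT ϱ x.1 a c * jetT ϱ y.1 c b - jetT ϱ y.1 a c * jetT ϱ x.1 c b)) := by
    simp only [jetMat, jetVariation, map_neg, add_mul, mul_add, Finset.sum_add_distrib,
      Finset.sum_sub_distrib, ite_mul, mul_ite, zero_mul, mul_zero, Finset.sum_ite_eq,
      Finset.sum_ite_eq', Finset.mem_univ, if_true, map_sum, map_sub, map_mul]
    split_ifs <;> ring_nf
  have h2 : jetVariation ϱ ⁅x, y⁆.1 a b = x.1 (jetVariation ϱ y.1 a b) - y.1 (jetVariation ϱ x.1 a b)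
      - ∑ c, (jetT ϱ x.1 a c * jetT ϱ y.1 c b - jetT ϱ y.1 a c * jetT ϱ x.1 c b) := by
    have : (⁅x, y⁆ : Diff N × Diff1).1 = ⁅x.1, y.1⁆ := rfl
    rw [jetVariation, this, jetT_lie, jetVariation, jetVariation, map_neg, map_neg]
    ring
  rw [h1, fcoefQ_lie, weightCoef_lie]
  simp only [jetMat, h2, map_sub, map_add, atQ_diff_apply x, atQ_diff_apply y]
  by_cases hab : a = b
  · simp only [hab, if_true, act_C, totalD_C, map_mul]
    ring
  · simp only [hab, if_false, map_zero]
    ring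

/-! ### The anomaly of the operators of vector fields -/

theorem sum_totalD_jetMat_mul {A : Type*} [Fintype A] [DecidableEq A] (M M' : A → A → Fun N)
    (g g' : Trig) :
    ∑ a, ∑ b, totalD N (jetMat M g a b) * jetMat M' g' b a
      = ∑ a, ∑ b, totalD N (atQ (M a b)) * atQ (M' b a)
        + totalD N (atQ (∑ a, M a a)) * MvPolynomial.C g' + MvPolynomial.C (dt g) * atQ (∑ a, M' a a)
        + (Fintype.card A : ℂ) • MvPolynomial.C (dt g * g') := by
  have e : ∀ a, ∑ b, totalD N (jetMat M g a b) * jetMat M' g' b a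
      = ∑ b, totalD N (atQ (M a b)) * atQ (M' b a) + totalD N (atQ (M a a)) * MvPolynomial.C g'
        + MvPolynomial.C (dt g) * atQ (M' a a) + MvPolynomial.C (dt g * g') := by
    intro a
    have : ∀ b, totalD N (jetMat M g a b) * jetMat M' g' b a
        = totalD N (atQ (M a b)) * atQ (M' b a) + if b = a then
          totalD N (atQ (M a a)) * MvPolynomial.C g' + MvPolynomial.C (dt g) * atQ (M' a a)
            + MvPolynomial.C (dt g * g') else 0 := by
      intro b
      by_cases h : b = a
      · subst h
        simp only [jetMat, if_true, map_add, totalD_C, map_mul]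
        ring
      · simp only [jetMat, h, Ne.symm h, if_false, add_zero]
    rw [Finset.sum_congr rfl fun b _ => this b, Finset.sum_add_distrib, Finset.sum_ite_eq',
      if_pos (Finset.mem_univ a)]
    ring
  rw [Finset.sum_congr rfl fun a _ => e a, Finset.sum_add_distrib, Finset.sum_add_distrib,
    Finset.sum_add_distrib, ← Finset.sum_mul, ← Finset.mul_sum, ← map_sum, ← map_sum, ← map_sum,
    Finset.sum_const, Finset.card_univ, ← Nat.cast_smul_eq_nsmul ℂ]

theorem sum_jetMat {A : Type*} [Fintype A] [DecidableEq A] (M : A → A → Fun N) (g : Trig) :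
    ∑ a, jetMat M g a a = atQ (∑ a, M a a) + (Fintype.card A : ℂ) • MvPolynomial.C g := by
  simp only [jetMat, if_true, Finset.sum_add_distrib, map_sum, Finset.sum_const, Finset.card_univ,
    ← Nat.cast_smul_eq_nsmul ℂ]

/-! ### Integrals of functions of time alone. -/

/-- The functional `∫ dt f(t)`. -/
def trigIntegral (N : ℕ) : Trig →ₗ[ℂ] Obs N where
  toFun f := integral (MvPolynomial.C f)
  map_add' f g := by rw [map_add, map_add]
  map_smul' c f := by rw [C_smul_trig, integral.map_smul]; rfl

theorem trigIntegral_dt_mul (f g : Trig) :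
    trigIntegral N (dt f * g) = -trigIntegral N (f * dt g) := integral_dt_mul f g

/-- The cross terms, proportional to `λ w`, combine to the derivative of `f' h`. -/
theorem trigIntegral_weight_mul (f h : Trig) :
    trigIntegral N (dt (weightCoef lam w f) * weightCoef lam w h)
      = (lam ^ 2) • trigIntegral N (dt (dt f) * dt h) - (w ^ 2) • trigIntegral N (dt f * h) := by
  have e : dt (weightCoef lam w f) * weightCoef lam w h
      = (lam ^ 2) • (dt (dt f) * dt h) - (w ^ 2) • (dt f * h)
        - (Complex.I * w * lam) • (dt f * dt h + dt (dt f) * h) := by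
    rw [dt_weightCoef]
    simp only [weightCoef, sub_mul, mul_sub, smul_mul_smul_comm]
    match_scalars <;> ring_nf <;> simp
  rw [e, map_sub, map_sub, map_smul, map_smul, map_smul, map_add, trigIntegral_dt_mul (dt f) h,
    add_neg_cancel, smul_zero, sub_zero]

theorem trigIntegral_weight_antisymm (f h : Trig) :
    trigIntegral N ((Complex.I • dt (dt f) + dt f) * weightCoef lam w h)
      - trigIntegral N ((Complex.I • dt (dt h) + dt h) * weightCoef lam w f)
      = (2 * Complex.I * w) • trigIntegral N (dt f * h)
        - (2 * Complex.I * lam) • trigIntegral N (dt (dt f) * dt h) := by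
  have e : ∀ f h, (Complex.I • dt (dt f) + dt f) * weightCoef lam w h
      = (Complex.I * w) • (dt f * h) - (Complex.I * lam) • (dt (dt f) * dt h)
        - w • (dt (dt f) * h) - lam • (dt f * dt h) := by
    intro f h
    simp only [weightCoef, add_mul, mul_sub, mul_smul_comm, smul_mul_assoc]
    match_scalars <;> ring_nf <;> simp
  rw [e f h, e h f]
  simp only [map_sub, map_smul]
  rw [trigIntegral_dt_mul (dt f) h, trigIntegral_dt_mul (dt h) f, trigIntegral_dt_mul h f,
    mul_comm h (dt f), mul_comm (dt (dt h)) (dt f), mul_comm (dt h) (dt f)]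
  have h3 := trigIntegral_dt_mul (N := N) (dt f) (dt h)
  have h4 : trigIntegral N (dt f * dt (dt h)) = -trigIntegral N (dt (dt f) * dt h) := by
    rw [h3, neg_neg]
  rw [h4]
  module

theorem trigIntegral_lie (f h : Trig) :
    trigIntegral N (f * dt h - h * dt f) = (-2 : ℂ) • trigIntegral N (dt f * h) := by
  rw [map_sub, mul_comm h, ← neg_neg (trigIntegral N (f * dt h)), ← trigIntegral_dt_mul]
  module

theorem cocycle_apply (c₁ c₂ c₃ a₃ c₄ : ℂ) (x y : Diff N × Diff1) :
    (cocycle N c₁ c₂ c₃ a₃ c₄).1 x y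
      = (1 / (2 * Real.pi * Complex.I) : ℂ) • (c₁ • integral (dens1 x y) + c₂ • integral (dens2 x y))
        + (1 / (4 * Real.pi * Complex.I) : ℂ) • (c₃ • integral (dens3 x y)
          + (-Complex.I * a₃) • integral (densA x y))
        + (c₄ / (24 * Real.pi * Complex.I) : ℂ) • integral (dens4 x y) := rfl

/-- The vectors `a` and `b` stand for `∫ f' g` and `∫ f'' g'`; the fourth cocycle is their
difference. Eliminating `b` leaves a separate multiple of `a`, which is the coboundary term. -/
theorem anomaly_identity {V : Type*} [AddCommGroup V] [Module ℂ V] (d₁ d₂ d₃ dA d₄ a b : V)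
    (N n σ c₁ c₂ K : ℂ) (hb : b = d₄ + a) :
    (1 / (2 * Real.pi) : ℂ) • (-(Complex.I • d₁ + (Complex.I / 2) • d₃ + (1 / 2 : ℂ) • dA
        + (N * (Complex.I / 6)) • d₄)
      - σ • (Complex.I • (c₁ • d₁ + c₂ • d₂ + (K * lam) • d₃ - (K * Complex.I * w) • dA
          + n • ((lam ^ 2) • b - (w ^ 2) • a))
        + (1 / 2 : ℂ) • (-(K • (Complex.I • d₃ + dA))
          + n • ((2 * Complex.I * w) • a - (2 * Complex.I * lam) • b))
        + (n * (Complex.I / 6)) • d₄))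
    = (1 / (2 * Real.pi * Complex.I) : ℂ) • ((1 + σ * c₁) • d₁ + (σ * c₂) • d₂)
        + (1 / (4 * Real.pi * Complex.I) : ℂ) • ((1 + σ * (2 * lam - 1) * K) • d₃
          + (-Complex.I * (1 + σ * (2 * w - 1) * K)) • dA)
        + ((2 * N + σ * 2 * (1 - 6 * lam + 6 * lam ^ 2) * n) / (24 * Real.pi * Complex.I) : ℂ) • d₄
        + (σ * n * ((lam - lam ^ 2 - w + w ^ 2) / (4 * Real.pi * Complex.I)) * -2) • a := by
  have hpi : (Real.pi : ℂ) ≠ 0 := by exact_mod_cast Real.pi_ne_zero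
  have hI : (Complex.I : ℂ)⁻¹ = -Complex.I := Complex.inv_I
  have hI2 : (Complex.I : ℂ) ^ 2 = -1 := Complex.I_sq
  subst hb
  match_scalars <;> field_simp <;> ring_nf <;> simp only [hI2] <;> ring_nf

theorem weight_identity {V : Type*} [AddCommGroup V] [Module ℂ V] (K n : ℂ) (e a b c d v : V) :
    e + -((-K) • ((Complex.I * w) • a - lam • b)) + (-K) • ((Complex.I * w) • c - lam • d) + n • v
      = e + (K * lam) • (d - b) - (K * Complex.I * w) • (c - a) + n • v := by
  module

theorem weight_identity_antisymm {V : Type*} [AddCommGroup V] [Module ℂ V] (K n : ℂ)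
    (a b c d u v : V) :
    (1 / 2 : ℂ) • ((-K) • (Complex.I • a + b) + n • u) - (1 / 2 : ℂ) • ((-K) • (Complex.I • c + d) + n • v)
      = (1 / 2 : ℂ) • (-(K • (Complex.I • (a - c) + (b - d))) + n • (u - v)) := by
  module

/-- The last summand depends on `x` and `y` through the bracket only: since `∫ (f g' - g f') = -2 ∫
f' g`, it is the coboundary of the functional `∫ f`. -/
theorem integral_anomaly {k₀ k₁ k₂ : ℂ} (hk : IsTraceData ϱ k₀ k₁ k₂) (σ : ℂ) (x y : Diff N × Diff1) :
    (1 / (2 * Real.pi) : ℂ) • integral (anomalyDensity σ x y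
        (jetVariation ϱ x.1 : JetIdx N p ι → JetIdx N p ι → Fun N) (jetVariation ϱ y.1)
        (weightCoef lam w (fcoef x.2)) (weightCoef lam w (fcoef y.2)))
      = (cocycle N
          (1 + σ * (binom (N + p) p * k₁ + binom (N + p + 1) (p - 1) * Fintype.card ι))
          (σ * (binom (N + p) p * k₂ + binom (N + p) (p - 2) * Fintype.card ι
            + 2 * binom (N + p) (p - 1) * k₀))
          (1 + σ * (2 * lam - 1) * (binom (N + p) p * k₀ + binom (N + p) (p - 1) * Fintype.card ι))
          (1 + σ * (2 * w - 1) * (binom (N + p) p * k₀ + binom (N + p) (p - 1) * Fintype.card ι))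
          (2 * N + σ * 2 * (1 - 6 * lam + 6 * lam ^ 2) * (binom (N + p) p * Fintype.card ι))).1 x y
        + (σ * (binom (N + p) p * Fintype.card ι) *
            ((lam - lam ^ 2 - w + w ^ 2) / (4 * Real.pi * Complex.I)))
          • trigIntegral N (fcoef ⁅x, y⁆.2) := by
  have hcard : (Fintype.card (JetIdx N p ι) : ℂ) = binom (N + p) p * Fintype.card ι := by
    rw [Fintype.card_prod, binom_card, Nat.cast_mul, mul_comm]
  have htr : ∀ x : Diff N × Diff1, (atQ (∑ a : JetIdx N p ι, jetVariation ϱ x.1 a a) : Loc N)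
      = (-(binom (N + p) p * k₀ + binom (N + p) (p - 1) * Fintype.card ι)) • divQ x := by
    intro x
    simp only [jetVariation, Finset.sum_neg_distrib]
    rw [sum_jetT ϱ hk, ← neg_smul, map_smul]
    rfl
  have hmul := sum_jetT_mul (p := p) ϱ hk x y
  have hneg : ∀ h : Fun N, (atQ (-h) : Loc N) = (-1 : ℂ) • atQ h := by
    intro h
    rw [← neg_one_smul ℂ h, map_smul]
  have hmul' : ∑ a : JetIdx N p ι, ∑ b : JetIdx N p ι, totalD N (atQ (jetVariation ϱ x.1 a b))
      * atQ (jetVariation ϱ y.1 b a) = ∑ a : JetIdx N p ι, ∑ b : JetIdx N p ι,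
        totalD N (atQ (jetT ϱ x.1 a b)) * atQ (jetT ϱ y.1 b a) :=
    Finset.sum_congr rfl fun a _ => Finset.sum_congr rfl fun b _ => by
      rw [jetVariation, jetVariation, hneg, hneg, Derivation.map_smul, smul_mul_smul_comm]
      norm_num
  rw [cocycle_apply, fcoefQ_lie, trigIntegral_lie, integral_anomalyDensity, hcard]
  rw [sum_totalD_jetMat_mul, sum_jetMat, sum_jetMat, htr, htr, hmul', hmul, hcard]
  generalize binom (N + p) p * k₁ + binom (N + p + 1) (p - 1) * Fintype.card ι = c₁
  generalize binom (N + p) p * k₂ + binom (N + p) (p - 2) * Fintype.card ι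
        + 2 * binom (N + p) (p - 1) * k₀ = c₂
  generalize binom (N + p) p * k₀ + binom (N + p) (p - 1) * Fintype.card ι = K
  generalize binom (N + p) p * Fintype.card ι = n
  have e3 : dens3 x y = MvPolynomial.C (dt (dt (fcoef x.2))) * divQ y
    - MvPolynomial.C (dt (dt (fcoef y.2))) * divQ x := rfl
  have eA : densA x y = MvPolynomial.C (dt (fcoef x.2)) * divQ y
    - MvPolynomial.C (dt (fcoef y.2)) * divQ x := rfl
  have hw : ∀ (f : Trig) (u : Loc N), integral (MvPolynomial.C (weightCoef lam w f) * u)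
      = (Complex.I * w) • integral (MvPolynomial.C f * u)
        - lam • integral (MvPolynomial.C (dt f) * u) := by
    intro f u
    rw [weightCoef, map_sub, C_smul_trig, C_smul_trig, sub_mul, map_sub, smul_mul_assoc,
      smul_mul_assoc, integral.map_smul, integral.map_smul]
  have h2 : ∀ (f : Trig) (u : Loc N), integral (MvPolynomial.C (Complex.I • dt (dt f) + dt f) * u)
      = Complex.I • integral (MvPolynomial.C (dt (dt f)) * u)
        + integral (MvPolynomial.C (dt f) * u) := by
    intro f u
    rw [map_add, C_smul_trig, add_mul, map_add, smul_mul_assoc, integral.map_smul]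
  have h3 : ∀ (f g : Trig) (u : Loc N), integral (MvPolynomial.C f
      * ((-K) • u + n • MvPolynomial.C g)) = (-K) • integral (MvPolynomial.C f * u)
        + n • trigIntegral N (f * g) := by
    intro f g u
    rw [mul_add, map_add, mul_smul_comm, mul_smul_comm, integral.map_smul, integral.map_smul, ← map_mul]
    rfl
  have t1 : integral (c₁ • dens1 x y + c₂ • dens2 x y
        + totalD N ((-K) • divQ x) * MvPolynomial.C (weightCoef lam w (fcoef y.2))
        + MvPolynomial.C (dt (weightCoef lam w (fcoef x.2))) * (-K) • divQ y
        + n • MvPolynomial.C (dt (weightCoef lam w (fcoef x.2)) * weightCoef lam w (fcoef y.2)))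
      = c₁ • integral (dens1 x y) + c₂ • integral (dens2 x y) + (K * lam) • integral (dens3 x y)
        - (K * Complex.I * w) • integral (densA x y)
        + n • ((lam ^ 2) • trigIntegral N (dt (dt (fcoef x.2)) * dt (fcoef y.2))
          - (w ^ 2) • trigIntegral N (dt (fcoef x.2) * fcoef y.2)) := by
    rw [← trigIntegral_weight_mul]
    simp only [map_add, integral.map_smul]
    rw [integral_totalD_mul, totalD_C, mul_comm ((-K) • divQ x), dt_weightCoef, dt_weightCoef,
      mul_smul_comm, mul_smul_comm, integral.map_smul, integral.map_smul, hw, hw, e3, eA, map_sub,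
      map_sub]
    exact weight_identity lam w K n _ _ _ _ _ _
  have t2 : (1 / 2 : ℂ) • integral (MvPolynomial.C (Complex.I • dt (dt (fcoef x.2)) + dt (fcoef x.2))
            * ((-K) • divQ y + n • MvPolynomial.C (weightCoef lam w (fcoef y.2))))
          - (1 / 2 : ℂ) • integral (MvPolynomial.C (Complex.I • dt (dt (fcoef y.2)) + dt (fcoef y.2))
            * ((-K) • divQ x + n • MvPolynomial.C (weightCoef lam w (fcoef x.2))))
      = (1 / 2 : ℂ) • (-(K • (Complex.I • integral (dens3 x y) + integral (densA x y)))
          + n • ((2 * Complex.I * w) • trigIntegral N (dt (fcoef x.2) * fcoef y.2)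
            - (2 * Complex.I * lam) • trigIntegral N (dt (dt (fcoef x.2)) * dt (fcoef y.2)))) := by
    rw [← trigIntegral_weight_antisymm]
    rw [h3, h3, h2, h2, e3, eA, map_sub, map_sub]
    exact weight_identity_antisymm K n _ _ _ _ _ _
  have hb : trigIntegral N (dt (dt (fcoef x.2)) * dt (fcoef y.2))
      = integral (dens4 x y) + trigIntegral N (dt (fcoef x.2) * fcoef y.2) := by
    have : integral (dens4 x y) = trigIntegral N (dt (dt (fcoef x.2)) * dt (fcoef y.2)
      - dt (fcoef x.2) * fcoef y.2) := rfl
    rw [this, map_sub, sub_add_cancel]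
  rw [t1, add_sub_assoc, t2, smul_smul]
  exact anomaly_identity lam w _ _ _ _ _ _ _ N n σ c₁ c₂ K hb

end

/-! ### Linearity of the operators in the vector fields -/

section
variable {N p : ℕ} {ι : Type*} [Fintype ι] [DecidableEq ι]
  (ϱ : Matrix (Fin N) (Fin N) ℂ →ₗ⁅ℂ⁆ Matrix ι ι ℂ) (lam w : ℂ)

theorem deltaQ_add (x y : Diff N × Diff1) (μ : Fin N) :
    deltaQ (x + y) μ = deltaQ x μ + deltaQ y μ := by
  simp [deltaQ, comp, fcoef_add]; ring

theorem deltaQ_smul (c : ℂ) (x : Diff N × Diff1) (μ : Fin N) :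
    deltaQ (c • x) μ = c • deltaQ x μ := by
  rw [deltaQ, deltaQ, Prod.smul_fst, Prod.smul_snd, comp_smul, map_smul, fcoef_smul, C_smul_trig,
    smul_sub, smul_mul_assoc]

theorem shiftTerm_add (ξ η : Diff N) (n m : Fin N → ℕ) (μ : Fin N) :
    shiftTerm (ξ + η) n m μ = shiftTerm ξ n m μ + shiftTerm η n m μ := by
  unfold shiftTerm
  split_ifs <;> simp [comp_add, mul_add]

theorem shiftTerm_smul (c : ℂ) (ξ : Diff N) (n m : Fin N → ℕ) (μ : Fin N) :
    shiftTerm (c • ξ) n m μ = c • shiftTerm ξ n m μ := by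
  unfold shiftTerm
  split_ifs <;> simp [comp_smul]

theorem jetT_add (ξ η : Diff N) (a b : JetIdx N p ι) :
    jetT ϱ (ξ + η) a b = jetT ϱ ξ a b + jetT ϱ η a b := by
  simp only [jetT, Tmat_apply, comp_add, map_add, mul_add, add_mul, Finset.sum_add_distrib,
    shiftTerm_add]
  split_ifs <;> ring

theorem jetT_smul (c : ℂ) (ξ : Diff N) (a b : JetIdx N p ι) :
    jetT ϱ (c • ξ) a b = c • jetT ϱ ξ a b := by
  simp only [jetT, Tmat_apply, comp_smul, Derivation.map_smul, map_smul, mul_smul_comm,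
    smul_mul_assoc, Finset.smul_sum, shiftTerm_smul, smul_add, smul_ite, smul_zero]

theorem weightCoef_add (f g : Trig) : weightCoef lam w (f + g)
    = weightCoef lam w f + weightCoef lam w g := by
  simp only [weightCoef, map_add, smul_add]; abel

theorem weightCoef_smul (c : ℂ) (f : Trig) : weightCoef lam w (c • f) = c • weightCoef lam w f := by
  simp only [weightCoef, Derivation.map_smul, smul_sub, smul_comm c]

/-- The matrix of densities by which `(ξ, f)` acts on the jet fields. -/
def jetAct (x : Diff N × Diff1) : JetIdx N p ι → JetIdx N p ι → Loc N :=
  jetMat (jetVariation ϱ x.1) (weightCoef lam w (fcoef x.2))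

theorem jetAct_add (x y : Diff N × Diff1) (a b : JetIdx N p ι) :
    jetAct ϱ lam w (x + y) a b = jetAct ϱ lam w x a b + jetAct ϱ lam w y a b := by
  simp only [jetAct, jetMat, jetVariation, Prod.fst_add, Prod.snd_add, fcoef_add, jetT_add,
    weightCoef_add, map_add, neg_add_rev]
  split_ifs <;> ring

theorem jetAct_smul (c : ℂ) (x : Diff N × Diff1) (a b : JetIdx N p ι) :
    jetAct ϱ lam w (c • x) a b = c • jetAct ϱ lam w x a b := by
  simp only [jetAct, jetMat, jetVariation, Prod.smul_fst, Prod.smul_snd, fcoef_smul, jetT_smul,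
    weightCoef_smul, ← smul_neg, map_smul, C_smul_trig]
  split_ifs <;> simp only [smul_add, smul_zero]

end

/-! ### The operators of vector fields and of local functionals. -/

namespace ModeRep

section
variable {N : ℕ} {A F : Type*} [AddCommGroup F] [Module ℂ F] {σ : ℂ} (R : ModeRep N A F σ)

/-- The normal-ordered product with a momentum, as a linear map. -/
def normLin (I : Fin N ⊕ A) : R.cFields →ₗ[ℂ] Series F where
  toFun ψ := Series.norm (pairSign σ I I) (R.mom I) ψ
  map_add' ψ χ := funext fun k =>
    ((Series.normExists_of_bdd _ (R.bdd_mom I) (ψ + χ).2.1).hasSum k).unique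
      ((((Series.normExists_of_bdd _ (R.bdd_mom I) ψ.2.1).hasSum k).add
        ((Series.normExists_of_bdd _ (R.bdd_mom I) χ.2.1).hasSum k)).congr_fun fun n => by
          simp only [Series.normTerm, Submodule.coe_add, Pi.add_apply, mul_add, add_mul, smul_add]
          split_ifs <;> rfl)
  map_smul' c ψ := funext fun k =>
    ((Series.normExists_of_bdd _ (R.bdd_mom I) (c • ψ).2.1).hasSum k).unique
      (((Series.normExists_of_bdd _ (R.bdd_mom I) ψ.2.1).hasSum k).end_smul c |>.congr_fun fun n => by
          simp only [Series.normTerm, Submodule.coe_smul, Pi.smul_apply, mul_smul_comm,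
            smul_mul_assoc]
          split_ifs
          · rfl
          · exact smul_comm _ _ _)

theorem normLin_apply (I : Fin N ⊕ A) (ψ : R.cFields) :
    R.normLin I ψ = Series.norm (pairSign σ I I) (R.mom I) ψ := rfl

/-- Normal ordering splits the momentum only, so a function of `t` can be moved outside. -/
theorem normLin_trigHom_smul (I : Fin N ⊕ A) (f : Trig) (ψ : R.cFields) :
    R.normLin I (R.trigHom f • ψ) = Series.trigMul f (R.normLin I ψ) := by
  funext k
  rw [trigHom_apply, Finsupp.sum, Finset.sum_smul, map_sum, Finset.sum_apply, Series.trigMul,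
    Finsupp.sum]
  refine Finset.sum_congr rfl fun m _ => ?_
  rw [smul_assoc, map_smul, Pi.smul_apply, normLin_apply, normLin_apply, Series.norm, Series.norm]
  congr 2
  funext n
  simp only [Series.normTerm, expField_smul_apply]
  rw [show k - n + m = k + m - n by ring]

/-- The variation of the fields `u = (q, φ)`, as elements of `cFields`. -/
def varC [Fintype A] (x : Diff N × Diff1) (M : A → A → Loc N) : Fin N ⊕ A → R.cFields
  | .inl μ => ⟨_, R.qFields_le (R.locHom (deltaQ x μ)).2⟩
  | .inr a => R.jetVar (fcoef x.2) M a

theorem coe_varC [Fintype A] (x : Diff N × Diff1) (M : A → A → Loc N) (I : Fin N ⊕ A) :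
    (R.varC x M I : Series F) = R.var x M I := by cases I <;> rfl

theorem op_var [Fintype A] [DecidableEq A] (x : Diff N × Diff1) (M : A → A → Loc N) :
    R.op (R.var x M) = ∑ I, (2 * Real.pi * pairSign σ I I : ℂ) • R.normLin I (R.varC x M I) 0 := by
  simp only [normLin_apply, coe_varC]
  rfl

/-- The operator `∫ dt P(t, q(t), q'(t), …)` of a local functional. -/
def obsOp : Obs N →ₗ[ℂ] Module.End ℂ F :=
  Submodule.liftQ _
    { toFun := fun P => Series.integral (R.locHom P)
      map_add' := fun P Q => by
        rw [map_add]
        exact smul_add _ _ _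
      map_smul' := fun c P => by
        rw [locHom_smul]
        exact smul_comm (2 * Real.pi : ℂ) c ((R.locHom P : Series F) 0) } (by
    rintro _ ⟨Q, rfl⟩
    change Series.integral (R.locHom (totalD N Q) : Series F) = 0
    rw [locHom_totalD, coe_dtQ, Series.integral, Series.ddt]
    simp)

theorem obsOp_integral (P : Loc N) : R.obsOp (integral P) = Series.integral (R.locHom P) := rfl

theorem obsOp_comm (m m' : Obs N) : R.obsOp m * R.obsOp m' = R.obsOp m' * R.obsOp m := by
  obtain ⟨P, rfl⟩ := integral_surjective m
  obtain ⟨Q, rfl⟩ := integral_surjective m'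
  rw [obsOp_integral, obsOp_integral, Series.integral, Series.integral, smul_mul_smul_comm,
    smul_mul_smul_comm, R.bicomm_comm ((R.locHom P).2.2 0) ((R.locHom Q).2.2 0)]

theorem obsOp_trigIntegral (f : Trig) :
    R.obsOp (trigIntegral N f) = (2 * Real.pi * f.coeff 0 : ℂ) • 1 := by
  change Series.integral (R.locHom (MvPolynomial.C f) : Series F) = _
  rw [locHom_C, Series.integral, trigHom_apply_mode, neg_zero, smul_smul]

end

section
variable {N p : ℕ} {ι : Type*} [Fintype ι] [DecidableEq ι]
  (ϱ : Matrix (Fin N) (Fin N) ℂ →ₗ⁅ℂ⁆ Matrix ι ι ℂ) (lam w κ : ℂ)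
  {F : Type*} [AddCommGroup F] [Module ℂ F] {σ : ℂ} (R : ModeRep N (JetIdx N p ι) F σ)

theorem varC_add (x y : Diff N × Diff1) (I : Fin N ⊕ JetIdx N p ι) :
    R.varC (x + y) (jetAct ϱ lam w (x + y)) I
      = R.varC x (jetAct ϱ lam w x) I + R.varC y (jetAct ϱ lam w y) I := by
  rcases I with μ | a
  · refine Subtype.ext ?_
    simp only [varC, deltaQ_add, map_add]
    rfl
  · simp only [varC, jetVar, jetAct_add, map_add, add_smul, Finset.sum_add_distrib, Prod.snd_add,
      fcoef_add]
    abel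

theorem varC_smul (c : ℂ) (x : Diff N × Diff1) (I : Fin N ⊕ JetIdx N p ι) :
    R.varC (c • x) (jetAct ϱ lam w (c • x)) I = c • R.varC x (jetAct ϱ lam w x) I := by
  rcases I with μ | a
  · refine Subtype.ext ?_
    simp only [varC, deltaQ_smul, locHom_smul]
    rfl
  · simp only [varC, jetVar, jetAct_smul, locHom_smul, smul_assoc, ← Finset.smul_sum, Prod.smul_snd,
      fcoef_smul, map_smul, smul_sub]

/-- The operators of the vector fields. -/
def rep : Diff N × Diff1 →ₗ[ℂ] Module.End ℂ F where
  toFun x := R.op (R.var x (jetAct ϱ lam w x)) + κ • R.obsOp (trigIntegral N (fcoef x.2))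
  map_add' x y := by
    simp only [op_var, varC_add, map_add, Pi.add_apply, smul_add, Finset.sum_add_distrib,
      Prod.snd_add, fcoef_add]
    abel
  map_smul' c x := by
    simp only [op_var, varC_smul, map_smul, Pi.smul_apply, smul_comm _ c, ← Finset.smul_sum,
      Prod.smul_snd, fcoef_smul, RingHom.id_apply, smul_add]

theorem rep_apply (x : Diff N × Diff1) : R.rep ϱ lam w κ x
    = R.op (R.var x (jetAct ϱ lam w x)) + κ • R.obsOp (trigIntegral N (fcoef x.2)) := rfl

theorem rep_lie_obsOp (hσ : σ * σ = 1) (x : Diff N × Diff1) (m : Obs N) :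
    R.rep ϱ lam w κ x * R.obsOp m - R.obsOp m * R.rep ϱ lam w κ x = R.obsOp ⁅x, m⁆ := by
  obtain ⟨P, rfl⟩ := integral_surjective m
  rw [lie_integral, rep_apply, obsOp_trigIntegral, obsOp_integral, obsOp_integral, Series.integral,
    Series.integral, ← R.lie_op_locHom hσ x (jetVariation ϱ x.1) (weightCoef lam w (fcoef x.2))]
  simp only [jetAct, add_mul, mul_add, mul_smul_comm, smul_mul_assoc, one_mul, mul_one, smul_sub]
  module

/-- The scalar shift `κ ∫ f` commutes with everything, and its value on `⁅x, y⁆` is exactly the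
coboundary term of `integral_anomaly`. -/
theorem rep_lie {k₀ k₁ k₂ : ℂ} (hk : IsTraceData ϱ k₀ k₁ k₂) (hσ : σ * σ = 1)
    (hκ : κ = σ * (binom (N + p) p * Fintype.card ι) *
      ((lam - lam ^ 2 - w + w ^ 2) / (4 * Real.pi * Complex.I))) (x y : Diff N × Diff1) :
    R.rep ϱ lam w κ x * R.rep ϱ lam w κ y - R.rep ϱ lam w κ y * R.rep ϱ lam w κ x
      = R.rep ϱ lam w κ ⁅x, y⁆ + R.obsOp ((cocycle N
          (1 + σ * (binom (N + p) p * k₁ + binom (N + p + 1) (p - 1) * Fintype.card ι))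
          (σ * (binom (N + p) p * k₂ + binom (N + p) (p - 2) * Fintype.card ι
            + 2 * binom (N + p) (p - 1) * k₀))
          (1 + σ * (2 * lam - 1) * (binom (N + p) p * k₀ + binom (N + p) (p - 1) * Fintype.card ι))
          (1 + σ * (2 * w - 1) * (binom (N + p) p * k₀ + binom (N + p) (p - 1) * Fintype.card ι))
          (2 * N + σ * 2 * (1 - 6 * lam + 6 * lam ^ 2) * (binom (N + p) p * Fintype.card ι))).1 x y) := by
  have h1 := R.op_comm hσ x y _ _ _ _ _ _ (jetMat_lie (p := p) ϱ lam w x y)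
  have hpi : (2 * Real.pi : ℂ) ≠ 0 := by simp
  -- An integral over the circle is `2π` times the zero mode, and the anomaly is a zero mode; this
  -- cancels the factor `1 / 2π`.
  have h2 := congrArg R.obsOp (integral_anomaly (p := p) ϱ lam w hk σ x y)
  rw [map_smul, obsOp_integral, Series.integral, smul_smul, one_div_mul_cancel hpi, one_smul, map_add,
    map_smul] at h2
  rw [h2, ← hκ] at h1
  rw [obsOp_trigIntegral, add_comm _ ((_ : ℂ) • _ : Module.End ℂ F)] at h1
  simp only [rep_apply, obsOp_trigIntegral, jetAct]
  rw [add_assoc, ← h1]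
  simp only [add_mul, mul_add, mul_smul_comm, smul_mul_assoc, one_mul, mul_one]
  module

end

end ModeRep

/-! ### The operators as integrals of normal-ordered densities -/

namespace Series
variable {F : Type*} [AddCommGroup F] [Module ℂ F]

/-- Multiplication by a trigonometric polynomial, as a linear map. -/
def trigMulLin (f : Trig) : Series F →ₗ[ℂ] Series F where
  toFun := trigMul f
  map_add' X Y := funext fun k => by
    simp only [trigMul, Finsupp.sum, Pi.add_apply, smul_add, Finset.sum_add_distrib]
  map_smul' c X := funext fun k => by
    simp only [trigMul, Finsupp.sum, Pi.smul_apply, smul_comm _ c, ← Finset.smul_sum, RingHom.id_apply]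

theorem trigMulLin_apply (f : Trig) (X : Series F) : trigMulLin f X = trigMul f X := rfl

theorem trigMul_eq_sum (f : Trig) (X : Series F) (k : ℤ) {s : Finset ℤ} (hs : f.coeff.support ⊆ s) :
    trigMul f X k = ∑ m ∈ s, f.coeff m • X (k + m) :=
  Finsupp.sum_of_support_subset _ hs _ fun _ _ => zero_smul _ _

theorem coeff_dt (f : Trig) (m : ℤ) : (dt f).coeff m = Complex.I * m * f.coeff m := by
  induction f using LaurentPolynomial.induction_on' with
  | add p q hp hq => simp only [map_add, AddMonoidAlgebra.coeff_add, Finsupp.add_apply, hp, hq, mul_add]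
  | C_mul_T n a =>
    have h : dt (LaurentPolynomial.C a * T n) = LaurentPolynomial.C (Complex.I * n * a) * T n :=
      dtLin_C_mul_T a n
    rw [h, ← LaurentPolynomial.single_eq_C_mul_T, ← LaurentPolynomial.single_eq_C_mul_T,
      AddMonoidAlgebra.coeff_single, AddMonoidAlgebra.coeff_single, Finsupp.single_apply,
      Finsupp.single_apply]
    split_ifs with h
    · rw [h]
    · rw [mul_zero]

/-- Integration by parts on the circle; it is the reason why the term `λ d/dt` of `L(t)` appears as
`-λ f'` in `weightCoef`. -/
theorem trigMul_ddt_zero (f : Trig) (X : Series F) : trigMul f X.ddt 0 = -trigMul (dt f) X 0 := by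
  rw [trigMul_eq_sum f X.ddt 0 (Finset.subset_union_left (s₂ := (dt f).coeff.support)),
    trigMul_eq_sum (dt f) X 0 (Finset.subset_union_right (s₁ := f.coeff.support)),
    ← Finset.sum_neg_distrib]
  refine Finset.sum_congr rfl fun m _ => ?_
  rw [ddt, coeff_dt, smul_smul, ← neg_smul]
  congr 1
  push_cast; ring

theorem trigMul_const_zero (f : Trig) (c : ℂ) :
    trigMul f (const c : Series F) 0 = (c * f.coeff 0) • 1 := by
  rw [trigMul_eq_sum f _ 0 (Finset.subset_union_left (s₂ := {0})), Finset.sum_eq_single 0]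
  · simp [const, smul_smul, mul_comm]
  · intro m _ hm
    simp [const, hm]
  · simp

end Series

theorem sum_jetIdx {N p : ℕ} {ι M : Type*} [Fintype ι] [AddCommMonoid M]
    (G : JetIdx N p ι → JetIdx N p ι → M) :
    ∑ n : MultiIdx N p, ∑ m : MultiIdx N p, ∑ α, ∑ β, G (β, n) (α, m) = ∑ a, ∑ b, G a b := by
  rw [Fintype.sum_prod_type_right]
  refine Finset.sum_congr rfl fun n _ => ?_
  symm
  rw [Finset.sum_congr rfl fun β _ => Fintype.sum_prod_type_right (G (β, n)), Finset.sum_comm]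
  exact Finset.sum_congr rfl fun m _ => Finset.sum_comm

theorem fcoef_zero : fcoef 0 = 0 := by simp [fcoef]

theorem jetT_zero {N p : ℕ} {ι : Type*} [Fintype ι] [DecidableEq ι]
    (ϱ : Matrix (Fin N) (Fin N) ℂ →ₗ⁅ℂ⁆ Matrix ι ι ℂ) (a b : JetIdx N p ι) : jetT ϱ 0 a b = 0 := by
  have h := jetT_smul ϱ 0 0 a b
  rwa [zero_smul, zero_smul] at h

namespace ModeRep

variable {N p : ℕ} {ι : Type*} [Fintype ι] [DecidableEq ι]
  (ϱ : Matrix (Fin N) (Fin N) ℂ →ₗ⁅ℂ⁆ Matrix ι ι ℂ) (lam w κ : ℂ)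
  {F : Type*} [AddCommGroup F] [Module ℂ F] {σ : ℂ} (R : ModeRep N (JetIdx N p ι) F σ)

theorem jetAct_left (ξ : Diff N) (a b : JetIdx N p ι) :
    jetAct ϱ lam w (ξ, 0) a b = atQ (-jetT ϱ ξ a b) := by
  have h : weightCoef lam w 0 = 0 := by simp [weightCoef]
  simp [jetAct, jetMat, jetVariation, fcoef_zero, h]

theorem jetAct_right (f : Diff1) (a b : JetIdx N p ι) :
    jetAct ϱ lam w (0, f) a b
      = if a = b then MvPolynomial.C (weightCoef lam w (fcoef f)) else 0 := by
  simp [jetAct, jetMat, jetVariation, jetT_zero]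

/-- The quantization weights each jet component by the sign `σ`, and the variation of `φ` is `-T(ξ)
φ`; together they give the factor `∓` in `𝓛_ξ`. -/
theorem rep_left (ξ : Diff N) : R.rep ϱ lam w κ (ξ, 0)
    = Series.integral (∑ μ, Series.norm 1 (R.mom (.inl μ)) (R.locHom (atQ (comp ξ μ)))
      + (-σ) • ∑ n : MultiIdx N p, ∑ m : MultiIdx N p, ∑ α, ∑ β,
        Series.norm σ (R.mom (.inr (β, n)))
          (Series.mul (R.locHom (atQ (Tmat ϱ ξ n.val m.val β α))) (R.u (.inr (α, m))))) := by
  have h0 : (∑ n : MultiIdx N p, ∑ m : MultiIdx N p, ∑ α, ∑ β, Series.norm σ (R.mom (.inr (β, n)))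
      (Series.mul (R.locHom (atQ (Tmat ϱ ξ n.val m.val β α))) (R.u (.inr (α, m)))))
      = ∑ a, ∑ b, Series.norm σ (R.mom (.inr a))
        (Series.mul (R.locHom (atQ (jetT ϱ ξ a b))) (R.u (.inr b))) :=
    sum_jetIdx fun a b => Series.norm σ (R.mom (.inr a))
      (Series.mul (R.locHom (atQ (jetT ϱ ξ a b))) (R.u (.inr b)))
  rw [h0]
  have h1 : ∀ μ, R.varC (ξ, 0) (jetAct ϱ lam w (ξ, 0)) (.inl μ)
      = ⟨_, R.qFields_le (R.locHom (atQ (comp ξ μ))).2⟩ := by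
    intro μ
    simp [varC, deltaQ, fcoef_zero]
  have h2 : ∀ a, R.varC (ξ, 0) (jetAct ϱ lam w (ξ, 0)) (.inr a)
      = (-1 : ℂ) • ∑ b, R.locHom (atQ (jetT ϱ ξ a b)) • R.phi b := by
    intro a
    have hn : ∀ h : Fun N, (atQ (-h) : Loc N) = (-1 : ℂ) • atQ h := fun h => by
      rw [← neg_one_smul ℂ h, map_smul]
    simp only [varC, jetVar, jetAct_left, fcoef_zero, map_zero, zero_smul, sub_zero, hn, locHom_smul,
      smul_assoc, Finset.smul_sum]
  rw [rep_apply, fcoef_zero, map_zero, map_zero, smul_zero, add_zero, op_var, Fintype.sum_sum_type,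
    Series.integral, Pi.add_apply, smul_add, Finset.sum_apply, Finset.smul_sum, Pi.smul_apply,
    Finset.sum_apply, smul_smul, Finset.smul_sum]
  congr 1
  · refine Finset.sum_congr rfl fun μ _ => ?_
    rw [h1, normLin_apply]
    simp only [pairSign, mul_one]
  · refine Finset.sum_congr rfl fun a _ => ?_
    rw [h2, map_smul, map_sum, Pi.smul_apply, smul_smul]
    congr 1
    simp only [pairSign]
    ring

theorem rep_right (f : Diff1) : R.rep ϱ lam w κ (0, f)
    = Series.integral (Series.trigMul (fcoef f)
        (-∑ μ, Series.norm 1 (R.mom (.inl μ)) (Series.ddt (R.u (.inl μ)))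
          + (σ • (∑ a : JetIdx N p ι, (-Series.norm σ (R.mom (.inr a)) (Series.ddt (R.u (.inr a)))
              + lam • Series.ddt (Series.norm σ (R.mom (.inr a)) (R.u (.inr a)))
              + (Complex.I * w) • Series.norm σ (R.mom (.inr a)) (R.u (.inr a))))
            + Series.const κ))) := by
  have h1 : ∀ μ, R.varC (0, f) (jetAct ϱ lam w (0, f)) (.inl μ)
      = -(R.trigHom (fcoef f) • (⟨_, R.qFields_le (R.qField (μ, 1)).2⟩ : R.cFields)) := by
    intro μ
    refine Subtype.ext ?_
    rw [coe_varC]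
    simp only [var, deltaQ, comp, Derivation.zero_apply, map_zero, zero_sub, map_neg, map_mul, locHom_C,
      locHom_X]
    rfl
  have h2 : ∀ a, R.varC (0, f) (jetAct ϱ lam w (0, f)) (.inr a)
      = -(R.trigHom (fcoef f) • R.dtC (R.phi a)) - lam • (R.trigHom (dt (fcoef f)) • R.phi a)
        + (Complex.I * w) • (R.trigHom (fcoef f) • R.phi a) := by
    intro a
    have hs : ∑ b, R.locHom (jetAct ϱ lam w (0, f) a b) • R.phi b
        = R.trigHom (weightCoef lam w (fcoef f)) • R.phi a := by
      rw [Finset.sum_eq_single a]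
      · rw [jetAct_right, if_pos rfl, locHom_C]
      · intro b _ hb
        rw [jetAct_right, if_neg (Ne.symm hb), map_zero, zero_smul]
      · exact fun h => absurd (Finset.mem_univ a) h
    simp only [varC, jetVar, hs]
    rw [weightCoef, map_sub, qFields_sub_smul, map_smul, map_smul, smul_assoc, smul_assoc]
    abel
  rw [rep_apply, op_var, Fintype.sum_sum_type, obsOp_trigIntegral, Series.integral,
    ← Series.trigMulLin_apply]
  simp only [map_add, map_neg, map_sum, map_smul, h1, h2, normLin_trigHom_smul, map_sub,
    Series.trigMulLin_apply, Pi.add_apply, Pi.neg_apply, Pi.smul_apply, Pi.sub_apply,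
    Finset.sum_apply, Series.trigMul_ddt_zero, Series.trigMul_const_zero]
  rw [smul_add, smul_add, ← add_assoc]
  congr 1
  · congr 1
    · rw [← Finset.sum_neg_distrib, Finset.smul_sum]
      refine Finset.sum_congr rfl fun μ _ => ?_
      simp only [pairSign, mul_one, normLin_apply]
      rw [coe_qField]
      rfl
    · rw [smul_smul, Finset.smul_sum]
      refine Finset.sum_congr rfl fun a _ => ?_
      simp only [pairSign, normLin_apply]
      change _ • (-Series.trigMul _ (Series.norm σ (R.mom (.inr a)) (Series.ddt (R.u (.inr a)))) 0
        - lam • Series.trigMul _ (Series.norm σ (R.mom (.inr a)) (R.u (.inr a))) 0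
        + _ • Series.trigMul _ (Series.norm σ (R.mom (.inr a)) (R.u (.inr a))) 0) = _
      module
  · module

end ModeRep

/-! ### The realization -/

namespace ModeRep

variable {N p : ℕ} {ι : Type*} [Fintype ι] [DecidableEq ι]
  (ϱ : Matrix (Fin N) (Fin N) ℂ →ₗ⁅ℂ⁆ Matrix ι ι ℂ) (lam w κ : ℂ)
  {F : Type*} [AddCommGroup F] [Module ℂ F] {σ : ℂ} (R : ModeRep N (JetIdx N p ι) F σ)

/-- An abelian extension is represented once the vector fields close up to the operator of the
cocycle, act correctly on the functionals, and the functionals commute. -/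
theorem exists_lieHom {k₀ k₁ k₂ : ℂ} (hk : IsTraceData ϱ k₀ k₁ k₂) (hσ : σ * σ = 1)
    (hκ : κ = σ * (binom (N + p) p * Fintype.card ι) *
      ((lam - lam ^ 2 - w + w ^ 2) / (4 * Real.pi * Complex.I))) {c₁ c₂ c₃ a₃ c₄ : ℂ}
    (h₁ : c₁ = 1 + σ * (binom (N + p) p * k₁ + binom (N + p + 1) (p - 1) * Fintype.card ι))
    (h₂ : c₂ = σ * (binom (N + p) p * k₂ + binom (N + p) (p - 2) * Fintype.card ι
      + 2 * binom (N + p) (p - 1) * k₀))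
    (h₃ : c₃ = 1 + σ * (2 * lam - 1) * (binom (N + p) p * k₀
      + binom (N + p) (p - 1) * Fintype.card ι))
    (h₃' : a₃ = 1 + σ * (2 * w - 1) * (binom (N + p) p * k₀
      + binom (N + p) (p - 1) * Fintype.card ι))
    (h₄ : c₄ = 2 * N + σ * 2 * (1 - 6 * lam + 6 * lam ^ 2) * (binom (N + p) p * Fintype.card ι)) :
    ∃ Φ : DROAlg N c₁ c₂ c₃ a₃ c₄ →ₗ⁅ℂ⁆ Module.End ℂ F, ∀ x m,
      Φ (LieAlgebra.ofTwoCocycle.mk (x, m)) = R.rep ϱ lam w κ x + R.obsOp m := by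
  refine ⟨{ toFun := fun z => R.rep ϱ lam w κ z.carrier.1 + R.obsOp z.carrier.2
            map_add' := ?_, map_smul' := ?_, map_lie' := ?_ }, fun x m => rfl⟩
  · rintro ⟨x, m⟩ ⟨y, m'⟩
    change R.rep ϱ lam w κ (x + y) + R.obsOp (m + m')
      = (R.rep ϱ lam w κ x + R.obsOp m) + (R.rep ϱ lam w κ y + R.obsOp m')
    rw [map_add, map_add]
    abel
  · rintro c ⟨x, m⟩
    change R.rep ϱ lam w κ (c • x) + R.obsOp (c • m) = c • (R.rep ϱ lam w κ x + R.obsOp m)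
    rw [map_smul, map_smul, smul_add]
  · rintro ⟨x, m⟩ ⟨y, m'⟩
    change R.rep ϱ lam w κ ⁅x, y⁆
        + R.obsOp ((cocycle N c₁ c₂ c₃ a₃ c₄).1 x y + ⁅x, m'⁆ - ⁅y, m⁆)
      = (R.rep ϱ lam w κ x + R.obsOp m) * (R.rep ϱ lam w κ y + R.obsOp m')
        - (R.rep ϱ lam w κ y + R.obsOp m') * (R.rep ϱ lam w κ x + R.obsOp m)
    have h := R.rep_lie ϱ lam w κ hk hσ hκ x y
    rw [← h₁, ← h₂, ← h₃, ← h₃', ← h₄] at h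
    have hx := R.rep_lie_obsOp ϱ lam w κ hσ x m'
    have hy := R.rep_lie_obsOp ϱ lam w κ hσ y m
    have hm := R.obsOp_comm m m'
    rw [map_sub, map_add, ← hx, ← hy, mul_add, add_mul, add_mul, mul_add, add_mul, add_mul, hm,
      add_sub_assoc, ← add_assoc, ← h]
    abel

end ModeRep

/-! ### Fock space -/

section
variable {N : ℕ} {A : Type*} (st : Stat)

theorem modeOp_mul_add {x y : Mode N A} {s v : ℂ} (hs : commSign st x y = s)
    (hv : commValue st x y = v) :
    modeOp st x * modeOp st y = s • (modeOp st y * modeOp st x) + v • 1 := by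
  rw [← hs, ← hv]
  exact modeOp_mul st x y

theorem add_zero_smul_one {F : Type*} [AddCommGroup F] [Module ℂ F] (a : Module.End ℂ F) :
    a + (0 : ℂ) • 1 = a := by rw [zero_smul, add_zero]

theorem modeOp_mul_of {x y : Mode N A} {s : ℂ} (hs : commSign st x y = s)
    (hv : commValue st x y = 0) :
    modeOp st x * modeOp st y = s • (modeOp st y * modeOp st x) :=
  (modeOp_mul_add st hs hv).trans (add_zero_smul_one _)

/-- Fock space as a representation of the mode algebra. -/
def fockRep (N : ℕ) (A : Type*) (st : Stat) : ModeRep N A (Fock N A st) st.sign where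
  u := Sum.elim (qF st) (phiF st)
  mom := Sum.elim (pF st) (piF st)
  bdd_u := by
    rintro (μ | a)
    · exact bdd_qF st μ
    · exact bdd_phiF st a
  bdd_mom := by
    rintro (μ | a)
    · exact bdd_pF st μ
    · exact bdd_piF st a
  u_mul_u := by
    rintro (μ | a) (ν | b) m n
    all_goals exact modeOp_mul_of st (by simp [commSign, Mode.IsJet, pairSign]) rfl
  mom_mul_mom := by
    rintro (μ | a) (ν | b) m n
    all_goals exact modeOp_mul_of st (by simp [commSign, Mode.IsJet, pairSign]) rfl
  mom_mul_u := by
    rintro (μ | a) (ν | b) m n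
    all_goals refine modeOp_mul_add st (by simp [commSign, Mode.IsJet, pairSign]) ?_
    · simp [commValue]
    · simp [commValue]
    · simp [commValue]
    · by_cases h : a = b ∧ m + n = 0
      · exact (if_pos h).trans (if_pos ⟨congrArg _ h.1, h.2⟩).symm
      · exact (if_neg h).trans (if_neg fun h' => h ⟨Sum.inr_injective h'.1, h'.2⟩).symm

theorem qWord_eq (l : List (Fin N × ℕ)) :
    (qWord st l : Series (Fock N A st)) = ((l.map (fockRep N A st).qField).prod : (fockRep N A st).qFields) := by
  induction l with
  | nil => rfl
  | cons i l ih =>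
    rw [List.map_cons, List.prod_cons, ModeRep.coe_mul, ModeRep.coe_qField, ← ih]
    rfl

/-- The operator field of a density is written as a sum over monomials with an arbitrary order of
factors; commutativity of the ring of `q`-fields turns it into a ring homomorphism applied to the
density. -/
theorem locF_eq (P : Loc N) : (locF st P : Series (Fock N A st)) = (fockRep N A st).locHom P := by
  have h : (fockRep N A st).locHom P = ∑ s ∈ P.support,
      (fockRep N A st).trigHom (MvPolynomial.coeff s P)
        * ((Finsupp.toMultiset s).toList.map (fockRep N A st).qField).prod := by
    refine (MvPolynomial.eval₂_eq _ _ _).trans (Finset.sum_congr rfl fun s _ => ?_)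
    congr 1
    rw [← Multiset.prod_coe, ← Multiset.map_coe, Multiset.coe_toList]
    rw [Finsupp.toMultiset_map, Finsupp.prod_toMultiset,
      Finsupp.prod_mapDomain_index (fun _ => pow_zero _) (fun _ _ _ => pow_add _ _ _)]
    rfl
  rw [h, Submodule.coe_sum, locF]
  refine Finset.sum_congr rfl fun s _ => ?_
  rw [qWord_eq]
  exact ((fockRep N A st).trigHom_smul _ ⟨_, (fockRep N A st).qFields_le (Subtype.prop _)⟩).symm

theorem funF_eq (h : Fun N) :
    (funF st h : Series (Fock N A st)) = (fockRep N A st).locHom (atQ h) := locF_eq st _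

end

/-! ### The operators of the theorem as values of the abstract representation. -/

section
variable {N p : ℕ} {ι : Type*} [Fintype ι] [DecidableEq ι] (st : Stat)
  (ϱ : Matrix (Fin N) (Fin N) ℂ →ₗ⁅ℂ⁆ Matrix ι ι ℂ) (lam w : ℂ)

theorem opL_eq (κ : ℂ) (ξ : Diff N) :
    opL p st ϱ ξ = (fockRep N (JetIdx N p ι) st).rep ϱ lam w κ (ξ, 0) := by
  rw [ModeRep.rep_left, opL, TF]
  simp only [funF_eq]
  rfl

theorem opR_eq (f : Diff1) : opR N p ι st lam w f = (fockRep N (JetIdx N p ι) st).rep ϱ lam w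
    (st.sign * binom (N + p) p * Fintype.card ι *
        ((lam - lam ^ 2 - w + w ^ 2) / (4 * Real.pi * Complex.I))) (0, f) := by
  rw [ModeRep.rep_right]
  rfl

omit [Fintype ι] [DecidableEq ι] in
theorem opO_eq (P : Loc N) : opO p ι st P = (fockRep N (JetIdx N p ι) st).obsOp (integral P) := by
  rw [ModeRep.obsOp_integral, opO, locF_eq]

omit [Fintype ι] [DecidableEq ι] in
theorem operatorsExist : OperatorsExist N p ι st := by
  have hfun : ∀ h : Fun N, (funF st h : Series (Fock N (JetIdx N p ι) st))
      ∈ (fockRep N (JetIdx N p ι) st).qFields := fun h => by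
    rw [funF_eq]
    exact Subtype.prop _
  have hphi : ∀ a : JetIdx N p ι, phiF st a ∈ (fockRep N (JetIdx N p ι) st).cFields :=
    fun a => ((fockRep N (JetIdx N p ι) st).phi a).2
  refine ⟨fun i l => ?_, fun h μ => ?_, fun μ => ?_, fun h a => ?_, fun h a b => ?_, fun a => ?_,
    fun a => ?_⟩
  · rw [qWord_eq]
    have := ((fockRep N (JetIdx N p ι) st).qField i).2
    rw [ModeRep.coe_qField] at this
    exact ModeRep.mulExists this ((fockRep N (JetIdx N p ι) st).qFields_le (Subtype.prop _))
  · exact Series.normExists_of_bdd _ (bdd_pF st μ) (hfun h).1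
  · exact Series.normExists_of_bdd _ (bdd_pF st μ) (bdd_qF st μ).ddt
  · exact ModeRep.mulExists (hfun h) (hphi a)
  · exact Series.normExists_of_bdd _ (bdd_piF st b) (ModeRep.mul_mem_cFields (hfun h) (hphi a)).1
  · exact Series.normExists_of_bdd _ (bdd_piF st a) (bdd_phiF st a)
  · exact Series.normExists_of_bdd _ (bdd_piF st a) (bdd_phiF st a).ddt

end

/-! ### The trace data of a representation of `gl(N)` -/

section
variable {N : ℕ} {ι : Type*} [Fintype ι] [DecidableEq ι]
  (ϱ : Matrix (Fin N) (Fin N) ℂ →ₗ⁅ℂ⁆ Matrix ι ι ℂ)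

theorem rhoT_comm (μ ν σ τ : Fin N) : rhoT ϱ μ ν * rhoT ϱ σ τ - rhoT ϱ σ τ * rhoT ϱ μ ν
    = (if ν = σ then rhoT ϱ μ τ else 0) - (if μ = τ then rhoT ϱ σ ν else 0) := by
  have h : ⁅ϱ (Matrix.single μ ν 1), ϱ (Matrix.single σ τ 1)⁆
      = ϱ ⁅(Matrix.single μ ν 1 : Matrix (Fin N) (Fin N) ℂ), Matrix.single σ τ 1⁆ :=
    (LieHom.map_lie ϱ _ _).symm
  rw [LieRing.of_associative_ring_bracket, LieRing.of_associative_ring_bracket, map_sub] at h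
  rw [rhoT, rhoT, h]
  congr 1
  · split_ifs with h1
    · subst h1; simp [rhoT]
    · simp [h1]
  · split_ifs with h1
    · subst h1; simp [rhoT]
    · simp [Ne.symm h1]

omit [DecidableEq ι] in
theorem trace_ite (P : Prop) [Decidable P] (M : Matrix ι ι ℂ) :
    (if P then M else 0).trace = if P then M.trace else 0 := by
  split_ifs <;> simp

/-- The trace of a commutator vanishes. -/
theorem trace_commutator (μ ν σ τ : Fin N) :
    (if ν = σ then (rhoT ϱ μ τ).trace else 0) = if μ = τ then (rhoT ϱ σ ν).trace else 0 := by
  have h := congrArg Matrix.trace (rhoT_comm ϱ μ ν σ τ)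
  rw [Matrix.trace_sub, Matrix.trace_sub, Matrix.trace_mul_comm, sub_self, trace_ite, trace_ite] at h
  exact sub_eq_zero.1 h.symm

/-- The trace form of the matrix units. -/
def traceForm (μ ν σ τ : Fin N) : ℂ := (rhoT ϱ μ ν * rhoT ϱ σ τ).trace

theorem traceForm_comm (μ ν σ τ : Fin N) : traceForm ϱ μ ν σ τ = traceForm ϱ σ τ μ ν :=
  Matrix.trace_mul_comm _ _

/-- Invariance of the trace form under `T^κ_ρ`, by cyclicity of the trace. -/
theorem traceForm_invariant (κ ρ μ ν σ τ : Fin N) :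
    (if ρ = μ then traceForm ϱ κ ν σ τ else 0) - (if κ = ν then traceForm ϱ μ ρ σ τ else 0)
      + ((if ρ = σ then traceForm ϱ μ ν κ τ else 0)
        - (if κ = τ then traceForm ϱ μ ν σ ρ else 0)) = 0 := by
  have h1 := congrArg (fun M => (M * rhoT ϱ σ τ).trace) (rhoT_comm ϱ κ ρ μ ν)
  have h2 := congrArg (fun M => (rhoT ϱ μ ν * M).trace) (rhoT_comm ϱ κ ρ σ τ)
  simp only [sub_mul, mul_sub, Matrix.trace_sub, ite_mul, mul_ite, zero_mul, mul_zero] at h1 h2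
  have h3 : (rhoT ϱ κ ρ * rhoT ϱ μ ν * rhoT ϱ σ τ).trace
      = (rhoT ϱ μ ν * (rhoT ϱ σ τ * rhoT ϱ κ ρ)).trace := by
    rw [Matrix.mul_assoc, Matrix.trace_mul_comm, Matrix.mul_assoc]
  have h4 : (rhoT ϱ μ ν * rhoT ϱ κ ρ * rhoT ϱ σ τ).trace
      = (rhoT ϱ μ ν * (rhoT ϱ κ ρ * rhoT ϱ σ τ)).trace := by rw [Matrix.mul_assoc]
  rw [h3, h4, trace_ite, trace_ite] at h1
  rw [trace_ite, trace_ite] at h2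
  unfold traceForm
  rw [← h1, ← h2]
  ring

/-- The case `μ = ρ ≠ σ` of invariance, solved for its first term. It already has the shape of the
claim, except that the coefficients still depend on labels. -/
theorem traceForm_eq {ρ σ : Fin N} (h : ρ ≠ σ) (κ ν τ : Fin N) : traceForm ϱ κ ν σ τ
    = (if κ = τ then traceForm ϱ ρ ν σ ρ else 0) + if κ = ν then traceForm ϱ ρ ρ σ τ else 0 := by
  have := traceForm_invariant ϱ κ ρ ρ ν σ τ
  rw [if_pos rfl, if_neg h] at this
  linear_combination this

/-- Off the diagonal, `g a c` is independent of `a`, and by symmetry also of `c`; any off-diagonal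
pair can be moved to `(o, o')` in such steps. -/
theorem symm_offDiag_const {κ M : Type*} {g : κ → κ → M} (hs : ∀ a b, g a b = g b a)
    (hg : ∀ a b c, a ≠ c → b ≠ c → g a c = g b c) {o o' : κ} (ho : o ≠ o') {a b : κ} (hab : a ≠ b) :
    g a b = g o o' := by
  by_cases h : b = o
  · subst h
    rw [hg a o' b hab ho.symm, hs]
  · rw [hg a o b hab (Ne.symm h), hs, hg b o' o h ho.symm, hs]

theorem exists_isTraceData : ∃ k₀ k₁ k₂ : ℂ, IsTraceData ϱ k₀ k₁ k₂ := by
  rcases isEmpty_or_nonempty (Fin N) with hN | ⟨⟨o⟩⟩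
  · exact ⟨0, 0, 0, fun μ => hN.elim μ, fun μ => hN.elim μ⟩
  have htr : ∀ μ ν, (rhoT ϱ μ ν).trace = if μ = ν then (rhoT ϱ o o).trace else 0 := fun μ ν => by
    simpa using trace_commutator ϱ μ o o ν
  by_cases hN : ∀ μ, μ = o
  -- For `N = 1` both products of deltas equal one, so `k₁` and `k₂` are not separately determined;
  -- everything is put into `k₁`.
  · refine ⟨_, traceForm ϱ o o o o, 0, htr, fun μ ν σ τ => ?_⟩
    rw [hN μ, hN ν, hN σ, hN τ]
    simp [traceForm]
  push Not at hN
  obtain ⟨o', ho⟩ := hN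
  have hother : ∀ σ : Fin N, ∃ ρ, ρ ≠ σ := fun σ => by
    by_cases h : o = σ
    · exact ⟨o', h ▸ ho⟩
    · exact ⟨o, h⟩
  -- For `N ≥ 2` these two relations show that `tr T^a_b T^b_a` and `tr T^a_a T^b_b` with `a ≠ b`
  -- depend only on `b`; by symmetry they are constants, which serve as `k₁` and `k₂`.
  have hcross : ∀ {ρ' ρ σ : Fin N} (ν), ρ' ≠ ρ → σ ≠ ρ →
      traceForm ϱ σ ρ ρ ν = if σ = ν then traceForm ϱ ρ' ρ ρ ρ' else 0 := fun ν h h' => by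
    rw [traceForm_eq ϱ h, if_neg h', add_zero]
  have hdiag : ∀ {ρ' ρ σ : Fin N} (τ), ρ' ≠ ρ → σ ≠ ρ →
      traceForm ϱ σ τ ρ ρ = if σ = τ then traceForm ϱ ρ' ρ' ρ ρ else 0 := fun τ h h' => by
    rw [traceForm_eq ϱ h, if_neg h', zero_add]
  have hk₁ : ∀ {ρ σ : Fin N}, ρ ≠ σ → traceForm ϱ ρ σ σ ρ = traceForm ϱ o o' o' o := fun h =>
    symm_offDiag_const (g := fun a b => traceForm ϱ a b b a) (fun a b => traceForm_comm ϱ _ _ _ _)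
      (fun a b c ha hb => by simpa using hcross a hb ha) ho.symm h
  have hk₂ : ∀ {ρ σ : Fin N}, ρ ≠ σ → traceForm ϱ ρ ρ σ σ = traceForm ϱ o o o' o' := fun h =>
    symm_offDiag_const (g := fun a b => traceForm ϱ a a b b) (fun a b => traceForm_comm ϱ _ _ _ _)
      (fun a b c ha hb => by simpa using hdiag a hb ha) ho.symm h
  refine ⟨_, traceForm ϱ o o' o' o, traceForm ϱ o o o' o', htr, fun κ ν σ τ => ?_⟩
  obtain ⟨ρ, hρ⟩ := hother σ
  have h1 : traceForm ϱ ρ ν σ ρ = if σ = ν then traceForm ϱ o o' o' o else 0 := by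
    rw [traceForm_comm, hcross ν hρ.symm hρ.symm, hk₁ hρ.symm]
  have h2 : traceForm ϱ ρ ρ σ τ = if σ = τ then traceForm ϱ o o o' o' else 0 := by
    rw [traceForm_comm, hdiag τ hρ.symm hρ.symm, hk₂ hρ.symm]
  have := traceForm_eq ϱ hρ κ ν τ
  rw [h1, h2, ← ite_and, ← ite_and] at this
  exact this

end

end

end DRO

/-! ### The realization theorem. -/

theorem theorem1 (N p : ℕ) {ι : Type*} [Fintype ι] [DecidableEq ι]
    (ϱ : Matrix (Fin N) (Fin N) ℂ →ₗ⁅ℂ⁆ Matrix ι ι ℂ) (st : DRO.Stat) (lam w : ℂ) :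
    DRO.OperatorsExist N p ι st ∧
    (∃ k₀ k₁ k₂ : ℂ, DRO.IsTraceData ϱ k₀ k₁ k₂) ∧
    ∀ k₀ k₁ k₂ : ℂ, DRO.IsTraceData ϱ k₀ k₁ k₂ →
      ∀ c₁ c₂ c₃ a₃ c₄ : ℂ,
      c₁ = 1 + st.sign * (DRO.binom (N + p) p * k₁
        + DRO.binom (N + p + 1) (p - 1) * Fintype.card ι) →
      c₂ = st.sign * (DRO.binom (N + p) p * k₂ + DRO.binom (N + p) (p - 2) * Fintype.card ι
        + 2 * DRO.binom (N + p) (p - 1) * k₀) →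
      c₃ = 1 + st.sign * (2 * lam - 1) * (DRO.binom (N + p) p * k₀
        + DRO.binom (N + p) (p - 1) * Fintype.card ι) →
      a₃ = 1 + st.sign * (2 * w - 1) * (DRO.binom (N + p) p * k₀
        + DRO.binom (N + p) (p - 1) * Fintype.card ι) →
      c₄ = 2 * N + st.sign * 2 * (1 - 6 * lam + 6 * lam ^ 2) * DRO.binom (N + p) p
        * Fintype.card ι →
      ∃ Φ : DRO.DROAlg N c₁ c₂ c₃ a₃ c₄ →ₗ⁅ℂ⁆ Module.End ℂ (DRO.Fock N (DRO.JetIdx N p ι) st),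
        (∀ ξ : DRO.Diff N, Φ (DRO.genL ξ) = DRO.opL p st ϱ ξ) ∧
        (∀ f : DRO.Diff1, Φ (DRO.genR f) = DRO.opR N p ι st lam w f) ∧
        ∀ P : DRO.Loc N, Φ (DRO.genO (DRO.integral P)) = DRO.opO p ι st P := by
  refine ⟨DRO.operatorsExist st, DRO.exists_isTraceData ϱ, ?_⟩
  intro k₀ k₁ k₂ hk c₁ c₂ c₃ a₃ c₄ h₁ h₂ h₃ h₃' h₄
  obtain ⟨Φ, hΦ⟩ := (DRO.fockRep N (DRO.JetIdx N p ι) st).exists_lieHom ϱ lam w _ hk st.sign_mul_sign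
    rfl h₁ h₂ h₃ h₃' (h₄.trans (by rw [mul_assoc _ (DRO.binom _ _)]))
  refine ⟨Φ, fun ξ => ?_, fun f => ?_, fun P => ?_⟩
  · rw [DRO.opL_eq]
    exact (hΦ _ _).trans (by rw [map_zero, add_zero])
  · rw [DRO.opR_eq]
    refine (hΦ _ _).trans ?_
    rw [map_zero, add_zero, mul_assoc _ (DRO.binom _ _)]
  · rw [DRO.opO_eq]
    exact (hΦ _ _).trans (by rw [map_zero, zero_add])
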